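/- A metric graph $\mathcal G$ is obtained from an at most countable family of intervals $[0,\ell_e]$, $0<\ell_e<\infty$, by identifying endpoints along an equivalence relation; it carries the canonical path metric, its vertices are the classes of endpoints, its length is $L=\sum_e \ell_e$, and it is locally finite if every vertex has finite degree. Call $\mathcal G$ doubly connected if any two distinct points $x,y\in\mathcal G$ are joined by two injective continuous paths which, apart from $x$ and $y$ themselves, have at most finitely many points in common, all of them vertices. Let $H^1(\mathcal G)$ be the space of continuous functions on $\mathcal G$ that are absolutely continuous on every edge and that are, together with their derivatives, square integrable over $\mathcal G$. The Neumann extension $\mathcal H_{\mathrm N}$ is the self-adjoint operator in $L^2(\mathcal G)$ associated with the quadratic form $f\mapsto\int_{\mathcal G}|f'|^2\,dx$ with domain $H^1(\mathcal G)$. Its eigenvalues $\mu_1<\mu_2\le\mu_3\le\dots$ are listed in increasing order and repeated according to multiplicity (here $\mu_1=0$). A symmetric necklace is a metric graph obtained by concatenating, in a chain, a finite or countably infinite number (at least one) of pumpkin graphs, each consisting of two parallel edges of equal length between two vertices; an infinite chain may be infinite in one or in both directions. Metric graphs that are isometric, i.e. differ only by vertices of degree two, are not distinguished. Theorem. Let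 $\mathcal G$ be a locally finite, doubly connected metric graph of finite length $L>0$. Then the second eigenvalue (the first nontrivial eigenvalue) $\mu_2(\mathcal G)$ of the Neumann extension $\mathcal H_{\mathrm N}$ exists and satisfies $$\mu_2(\mathcal G)\ \ge\ \frac{4\pi^2}{L^2}.$$ Equality holds if and only if $\mathcal G$ is a symmetric necklace. -/

import Mathlib

open Set MeasureTheory
open scoped ENNReal

/-- A metric graph with edge set `E`: every edge `e` is an interval `[0, ℓ e]` of positive finite
length, and the endpoints are glued along an equivalence relation. `(e, false)` is the endpoint `0`
of the edge `e`, `(e, true)` is its endpoint `ℓ e`. Loops and parallel edges are allowed. -/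
structure MetricGraph (E : Type*) where
  length : E → ℝ
  length_pos : ∀ e, 0 < length e
  glue : Setoid (E × Bool)

namespace MetricGraph

variable {E : Type*} (G : MetricGraph E)

/-- The disjoint union of the metric edges `[0, ℓ e]`. -/
abbrev EdgeSpace : Type _ := Σ e : E, Icc (0 : ℝ) (G.length e)

/-- The endpoints of the edges, as points of the disjoint union. -/
def endpoint (a : E × Bool) : G.EdgeSpace :=
  ⟨a.1, if a.2 then ⟨G.length a.1, (G.length_pos a.1).le, le_rfl⟩
    else ⟨0, le_rfl, (G.length_pos a.1).le⟩⟩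

theorem endpoint_injective : Function.Injective G.endpoint := by
  rintro ⟨e, b⟩ ⟨f, c⟩ h
  obtain rfl : e = f := congrArg Sigma.fst h
  have h2 := eq_of_heq (Sigma.mk.inj h).2
  have hp := G.length_pos e
  cases b <;> cases c <;> simp_all [Subtype.ext_iff]

/-- The canonical extension of the gluing relation from the endpoints to all points of the edges. -/
def pointSetoid : Setoid G.EdgeSpace where
  r p q := p = q ∨ ∃ a b, p = G.endpoint a ∧ q = G.endpoint b ∧ G.glue a b
  iseqv :=
    { refl := fun _ => Or.inl rfl
      symm := by
        rintro p q (rfl | ⟨a, b, rfl, rfl, h⟩)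
        · exact Or.inl rfl
        · exact Or.inr ⟨b, a, rfl, rfl, G.glue.symm h⟩
      trans := by
        rintro p q r (rfl | ⟨a, b, rfl, rfl, h⟩) (rfl | ⟨c, d, hc, rfl, h'⟩)
        · exact Or.inl rfl
        · exact Or.inr ⟨c, d, hc, rfl, h'⟩
        · exact Or.inr ⟨a, b, rfl, rfl, h⟩
        · obtain rfl := G.endpoint_injective hc
          exact Or.inr ⟨a, d, rfl, rfl, G.glue.trans h h'⟩ }

/-- The points of the metric graph. -/
def Point : Type _ := Quotient G.pointSetoid

/-- The point with coordinate `t` on the edge `e`. -/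
def pt (e : E) (t : Icc (0 : ℝ) (G.length e)) : G.Point :=
  Quotient.mk G.pointSetoid ⟨e, t⟩

/-- The vertices, as a set of points. -/
def vertexSet : Set G.Point :=
  Set.range fun a : E × Bool => (Quotient.mk G.pointSetoid (G.endpoint a) : G.Point)

/-- `G.Route x y d`: one can go from `x` to `y` through finitely many segments, each contained in a
single edge, whose lengths add up to `d`. -/
inductive Route : G.Point → G.Point → ℝ≥0∞ → Prop
  | nil (x : G.Point) : Route x x 0
  | cons (e : E) (s t : Icc (0 : ℝ) (G.length e)) {z : G.Point} {d : ℝ≥0∞}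
      (h : Route (G.pt e t) z d) : Route (G.pt e s) z (edist s t + d)

variable {G} in
theorem Route.append {x y z : G.Point} {c d : ℝ≥0∞} (h : G.Route x y c) (h' : G.Route y z d) :
    G.Route x z (c + d) := by
  induction h with
  | nil x => simpa using h'
  | cons e s t h ih =>
    rw [add_assoc]
    exact Route.cons e s t (ih h')

variable {G} in
theorem Route.reverse {x y : G.Point} {c : ℝ≥0∞} (h : G.Route x y c) : G.Route y x c := by
  induction h with
  | nil x => exact Route.nil x
  | cons e s t h ih =>
    have h1 : G.Route (G.pt e t) (G.pt e s) (edist t s + 0) := Route.cons e t s (Route.nil _)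
    have h2 := ih.append h1
    rwa [add_zero, add_comm, edist_comm] at h2

/-- The canonical (extended) distance of a metric graph: the infimum of the lengths of routes. It
is infinite between points that no route connects. -/
noncomputable instance : PseudoEMetricSpace G.Point where
  edist x y := ⨅ (d : ℝ≥0∞) (_ : G.Route x y d), d
  edist_self x := le_antisymm (iInf₂_le 0 (Route.nil x)) bot_le
  edist_comm x y :=
    le_antisymm (le_iInf₂ fun d h => iInf₂_le d h.reverse)
      (le_iInf₂ fun d h => iInf₂_le d h.reverse)
  edist_triangle x y z := by
    simp only [ENNReal.iInf_add, ENNReal.add_iInf]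
    exact le_iInf₂ fun d h2 => le_iInf₂ fun c h1 => iInf₂_le _ (h1.append h2)

/-- Every vertex has finite degree; loops count twice. -/
def LocallyFinite : Prop :=
  ∀ a : E × Bool, {b : E × Bool | G.glue a b}.Finite

/-- Any two distinct points are joined by two injective paths that have, apart from the two points
themselves, at most finitely many points in common, all of which are vertices. -/
def DoublyConnected : Prop :=
  ∀ x y : G.Point, x ≠ y → ∃ P₁ P₂ : Path x y,
    Function.Injective P₁ ∧ Function.Injective P₂ ∧
    (Set.range P₁ ∩ Set.range P₂).Finite ∧
    (Set.range P₁ ∩ Set.range P₂) \ {x, y} ⊆ G.vertexSet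

/-! ### Function spaces and the Neumann Laplacian -/

variable {G}

/-- The restriction of a function on the graph to the edge `e`, in the coordinate of that edge
(continued by constants outside `[0, ℓ e]`). -/
noncomputable def onEdge (f : G.Point → ℝ) (e : E) : ℝ → ℝ :=
  IccExtend (G.length_pos e).le fun t => f (G.pt e t)

variable (G) in
/-- The space `L²(G)`; its elements are given by their restrictions to the edges. -/
structure MemL2 (w : E → ℝ → ℝ) : Prop where
  memLp : ∀ e, MemLp (w e) 2 (volume.restrict (Ioc 0 (G.length e)))
  summable : Summable fun e => ∫ t in (0 : ℝ)..(G.length e), w e t ^ 2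

variable (G) in
/-- The inner product of `L²(G)`. -/
noncomputable def innerL2 (w v : E → ℝ → ℝ) : ℝ :=
  ∑' e, ∫ t in (0 : ℝ)..(G.length e), w e t * v e t

/-- The edgewise derivative. -/
noncomputable def edgeDeriv (f : G.Point → ℝ) (e : E) : ℝ → ℝ :=
  deriv (onEdge f e)

/-- The Sobolev space `H¹(G)`: continuous functions on `G` that are absolutely continuous on every
edge and that are, together with their edgewise derivatives, square integrable over `G`. -/
structure MemH1 (f : G.Point → ℝ) : Prop where
  continuous : Continuous f
  absolutelyContinuous : ∀ e, AbsolutelyContinuousOnInterval (onEdge f e) 0 (G.length e)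
  memL2 : G.MemL2 (onEdge f)
  memL2_deriv : G.MemL2 (edgeDeriv f)

/-- The (polarised) quadratic form `∫_G u' v'`; the Neumann form is this form with domain `H¹`. -/
noncomputable def energy (u v : G.Point → ℝ) : ℝ :=
  G.innerL2 (edgeDeriv u) (edgeDeriv v)

/-- The graph of the Neumann extension `H_N`, the self-adjoint operator in `L²(G)` that is
associated with the Neumann form: `u` belongs to its domain and `H_N u = w`. -/
def IsNeumannLaplacian (u : G.Point → ℝ) (w : E → ℝ → ℝ) : Prop :=
  MemH1 u ∧ G.MemL2 w ∧ ∀ v : G.Point → ℝ, MemH1 v → energy u v = G.innerL2 w (onEdge v)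

/-- `u` is a nonzero solution of `H_N u = c u`. -/
def IsNeumannEigenfunction (c : ℝ) (u : G.Point → ℝ) : Prop :=
  u ≠ 0 ∧ IsNeumannLaplacian u fun e t => c * onEdge u e t

variable (G) in
/-- `c` is the `k`-th eigenvalue (`k = 1, 2, …`) of `H_N` when the eigenvalues are listed in
increasing order and repeated according to their multiplicities: the eigenfunctions with eigenvalues
below `c` span a space of dimension less than `k`, those with eigenvalues at most `c` span a space of
dimension at least `k`. -/
def IsNeumannEigenvalue (k : ℕ) (c : ℝ) : Prop :=
  Module.rank ℝ (Submodule.span ℝ {u : G.Point → ℝ | ∃ b < c, IsNeumannEigenfunction b u}) < k ∧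
  k ≤ Module.rank ℝ (Submodule.span ℝ {u : G.Point → ℝ | ∃ b ≤ c, IsNeumannEigenfunction b u})

/-! ### Symmetric necklaces -/

/-- The chain of pumpkins with two equally long edges. The pumpkins are indexed by a set `I` of
integers; the pumpkin `i` consists of two edges of length `a i` from the vertex `i` to the vertex
`i + 1`. -/
def necklace (I : Set ℤ) (a : I → ℝ) (ha : ∀ i, 0 < a i) : MetricGraph (I × Bool) where
  length e := a e.1
  length_pos e := ha e.1
  glue := Setoid.ker fun p : (I × Bool) × Bool => (p.1.1 : ℤ) + if p.2 then 1 else 0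

variable (G) in
/-- `G` is, up to an isometry (that is, up to dummy vertices of degree two), the concatenation of
finitely or countably many pumpkins with two equally long edges. The index set is a finite interval
of integers, or an infinite one (which gives one or two ends). -/
def IsSymmetricNecklace : Prop :=
  ∃ (I : Set ℤ) (a : I → ℝ) (ha : ∀ i, 0 < a i), I.Nonempty ∧ I.OrdConnected ∧
    Nonempty (G.Point ≃ᵢ (necklace I a ha).Point)

end MetricGraph

/-!
The second eigenvalue is the minimum of the Rayleigh quotient `∫ |f'|² / ∫ f²` over the functions of
mean zero in `H¹`. The minimum is attained by the direct method (`exists_minimizer`): a minimising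
sequence is equicontinuous along the edges, it is bounded because the oscillation of a function is
controlled by its total variation, and a pointwise convergent subsequence is Cauchy in energy by the
parallelogram law. The Euler–Lagrange equation identifies the minimum with the second eigenvalue
(`isNeumannEigenvalue_two`).

*The lower bound.* Let `f` be a function of mean zero and `Φ t = ∫_{f > t} f` its tail integral.
The layer cake formula gives `∫ f² = ∫ Φ t dt`. On a doubly connected graph almost every level
between two values of `f` is crossed at least twice (`ae_two_le_crossings`), so the coarea inequality
gives `2 ∫ f² ≤ ∫ (Φ ∘ f) |f'|`. In terms of the decreasing rearrangement `g` of `f` to `[0, L]`,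
the function `Φ ∘ f` is bounded by the primitive of `g` that vanishes at `0` and `L`, whose `L²` norm
is at most `L / π` times that of `g` by Wirtinger's inequality. With the inequality of Cauchy and
Schwarz this yields `4 π² / L² ∫ f² ≤ ∫ |f'|²`, with the defect under control
(`IsTrial.integral_defect_sq_le`).

*Graphs that attain the bound.* Equality forces the rearrangement to be a cosine, almost every level
to be crossed at most twice, and `f` to solve the eikonal equation `|f'| = (2 π / L) √(A² - f²)`.
Hence `h = (L / 2 π) arccos (f / A)` is a height: it has slope `±1` along the edges, no plateaus, and
at most two points on the levels of a dense set. The levels of a height with a single point are its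
knots. Comparing the two paths between two points of the same level shows that every other level lies
between two knots, and that between two consecutive knots the graph consists of two disjoint strands
on which `h` is a coordinate. Only finitely many knots lie between two given ones, as they are common
points of two paths. This is the isometry with a symmetric necklace
(`IsHeight.isSymmetricNecklace`).

*Symmetric necklaces attain the bound.* The projection of a necklace to the line folds it onto an
interval with two sheets, and this property is invariant under isometries (`IsTwoSheeted`). Each sheet
is injective, so the length `L` is at most twice the length of the interval; by the coarea inequality
it is at least that. Therefore the interval has length `L / 2`, the projection pushes the length
measure forward to twice the Lebesgue measure, and the cosine of half a period on the interval attains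
the bound (`IsTwoSheeted.exists_energy_le`).
-/

namespace MetricGraph

/-! ### The path metric near a point -/

section Topology

variable {E : Type*} {G : MetricGraph E}

theorem edist_pt_le (e : E) (s t : Icc (0 : ℝ) (G.length e)) :
    edist (G.pt e s) (G.pt e t) ≤ edist s t := by
  have h : G.Route (G.pt e s) (G.pt e t) (edist s t + 0) := Route.cons e s t (Route.nil _)
  rw [add_zero] at h
  exact iInf₂_le (f := fun d (_ : G.Route (G.pt e s) (G.pt e t) d) => d) _ h

theorem lipschitzWith_pt (e : E) : LipschitzWith 1 (G.pt e) := fun s t => by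
  simpa using edist_pt_le e s t

theorem continuous_pt (e : E) : Continuous (G.pt e) := (lipschitzWith_pt e).continuous

theorem exists_pt_eq (p : G.Point) : ∃ e s, G.pt e s = p := by
  obtain ⟨⟨e, s⟩, rfl⟩ := Quotient.exists_rep p
  exact ⟨e, s, rfl⟩

/-- A map that does not increase distances along the edges does not increase distances. -/
theorem lipschitzWith_one_of_edges {Y : Type*} [PseudoEMetricSpace Y] {F : G.Point → Y}
    (h : ∀ e s t, edist (F (G.pt e s)) (F (G.pt e t)) ≤ edist s t) : LipschitzWith 1 F := by
  intro x y
  simp only [ENNReal.coe_one, one_mul]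
  refine le_iInf₂ fun d hd => ?_
  induction hd with
  | nil x => simp
  | cons e s t hr ih => exact (edist_triangle _ _ _).trans (add_le_add (h e s t) ih)

theorem pt_eq_pt_iff {e f : E} {s : Icc (0 : ℝ) (G.length e)} {t : Icc (0 : ℝ) (G.length f)} :
    G.pt e s = G.pt f t ↔ (⟨e, s⟩ : G.EdgeSpace) = ⟨f, t⟩ ∨
      ∃ a b, (⟨e, s⟩ : G.EdgeSpace) = G.endpoint a ∧ ⟨f, t⟩ = G.endpoint b ∧ G.glue a b :=
  Quotient.eq (r := G.pointSetoid)

theorem eq_zero_or_eq_length_of_eq_endpoint {e : E} {s : Icc (0 : ℝ) (G.length e)} {a : E × Bool}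
    (h : (⟨e, s⟩ : G.EdgeSpace) = G.endpoint a) : (s : ℝ) = 0 ∨ (s : ℝ) = G.length e := by
  obtain ⟨f, b⟩ := a
  obtain rfl : e = f := congrArg Sigma.fst h
  have h2 := eq_of_heq (Sigma.mk.inj h).2
  cases b <;> simp_all

/-- A point in the interior of an edge has a single representative. -/
theorem eq_of_pt_eq_pt_of_interior {e f : E} {s : Icc (0 : ℝ) (G.length e)}
    {t : Icc (0 : ℝ) (G.length f)} (h : G.pt e s = G.pt f t) (h0 : 0 < (s : ℝ))
    (h1 : (s : ℝ) < G.length e) : (⟨e, s⟩ : G.EdgeSpace) = ⟨f, t⟩ := by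
  rcases pt_eq_pt_iff.1 h with h | ⟨a, b, ha, -, -⟩
  · exact h
  · rcases eq_zero_or_eq_length_of_eq_endpoint ha with h | h <;> linarith

/-- The representatives of a point in the disjoint union of the edges. -/
def reps (p : G.Point) : Set G.EdgeSpace := {x | G.pt x.1 x.2 = p}

theorem finite_reps (hfin : G.LocallyFinite) (p : G.Point) : (reps p).Finite := by
  obtain ⟨e, s, rfl⟩ := exists_pt_eq p
  by_cases h : ∃ a, (⟨e, s⟩ : G.EdgeSpace) = G.endpoint a
  · obtain ⟨a, ha⟩ := h
    refine ((hfin a).image G.endpoint).subset ?_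
    rintro ⟨f, t⟩ hx
    have hx' : G.pt e s = G.pt f t := (show G.pt f t = G.pt e s from hx).symm
    rcases pt_eq_pt_iff.1 hx' with h | ⟨a', b, ha', hb, hab⟩
    · exact ⟨a, G.glue.refl a, by rw [← ha, h]⟩
    · obtain rfl := G.endpoint_injective (ha.symm.trans ha')
      exact ⟨b, hab, hb.symm⟩
  · refine (finite_singleton (⟨e, s⟩ : G.EdgeSpace)).subset ?_
    rintro ⟨f, t⟩ hx
    have hx' : G.pt e s = G.pt f t := (show G.pt f t = G.pt e s from hx).symm
    rcases pt_eq_pt_iff.1 hx' with h' | ⟨a', b, ha', -, -⟩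
    · exact h'.symm
    · exact absurd ⟨a', ha'⟩ h

/-- A point with finitely many representatives is the centre of a star: every point close to it is
reached along a single edge, at the distance given by the coordinates of this edge. -/
theorem exists_star (p : G.Point) (hp : (reps p).Finite) :
    ∃ r : ℝ≥0∞, 0 < r ∧ ∀ q, edist p q < r →
      ∃ e s t, G.pt e s = p ∧ G.pt e t = q ∧ edist s t = edist p q := by
  classical
  -- below `r` no point at distance less than `r` from a representative is an endpoint
  obtain ⟨r, hr0, hr⟩ : ∃ r : ℝ, 0 < r ∧ ∀ x ∈ reps p, ∀ t : Icc (0 : ℝ) (G.length x.1),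
      t ≠ x.2 → |(x.2 : ℝ) - t| < r → 0 < (t : ℝ) ∧ (t : ℝ) < G.length x.1 := by
    have key : ∀ x : G.EdgeSpace, ∃ r : ℝ, 0 < r ∧ ∀ t : Icc (0 : ℝ) (G.length x.1),
        t ≠ x.2 → |(x.2 : ℝ) - t| < r → 0 < (t : ℝ) ∧ (t : ℝ) < G.length x.1 := by
      rintro ⟨e, s⟩
      have hl := G.length_pos e
      have hs := s.2
      refine ⟨if (s : ℝ) = 0 then G.length e else if (s : ℝ) = G.length e then G.length e
        else min (s : ℝ) (G.length e - s), ?_, ?_⟩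
      · split_ifs with h1 h2
        · exact hl
        · exact hl
        · exact lt_min (lt_of_le_of_ne hs.1 (Ne.symm h1)) (sub_pos.2 (lt_of_le_of_ne hs.2 h2))
      · intro t hts ht
        have ht2 := t.2
        have hne : (t : ℝ) ≠ s := fun h => hts (Subtype.ext h)
        rw [abs_lt] at ht
        dsimp only at ht hne ⊢
        split_ifs at ht with h1 h2
        · exact ⟨lt_of_le_of_ne ht2.1 (by rw [h1] at hne; exact hne.symm), by linarith [ht.1, ht.2]⟩
        · refine ⟨by linarith [ht.1, ht.2], lt_of_le_of_ne ht2.2 (by rwa [h2] at hne)⟩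
        · have := min_le_left (s : ℝ) (G.length e - s)
          have := min_le_right (s : ℝ) (G.length e - s)
          exact ⟨by linarith [ht.1, ht.2], by linarith [ht.1, ht.2]⟩
    choose R hR0 hR using key
    rcases hp.toFinset.eq_empty_or_nonempty with h0 | h0
    · refine ⟨1, one_pos, fun x hx => ?_⟩
      have : x ∈ hp.toFinset := by simpa using hx
      simp [h0] at this
    · obtain ⟨x, -, hx2⟩ := hp.toFinset.exists_min_image R h0
      exact ⟨R x, hR0 x, fun y hy t h1 h2 => hR y t h1 (h2.trans_le (hx2 y (by simpa using hy)))⟩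
  -- along a short route the distance to a representative grows at most by the length of the route
  have route : ∀ {x z : G.Point} {d : ℝ≥0∞}, G.Route x z d → ∀ e s t, G.pt e s = p →
      G.pt e t = x → edist s t + d < ENNReal.ofReal r →
      ∃ e' s' t', G.pt e' s' = p ∧ G.pt e' t' = z ∧ edist s' t' ≤ edist s t + d := by
    intro x z d hroute
    induction hroute with
    | nil x => exact fun e s t hs ht _ => ⟨e, s, t, hs, ht, le_self_add⟩
    | @cons e' s' t' z d h ih =>
      intro e s t hs ht hlt
      by_cases hst : t = s
      · subst hst
        obtain ⟨e2, s2, t2, h1, h2, h3⟩ := ih e' s' t' (ht.symm.trans hs) rfl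
          (lt_of_le_of_lt le_add_self hlt)
        exact ⟨e2, s2, t2, h1, h2, h3.trans le_add_self⟩
      · have hd : edist s t < ENNReal.ofReal r := lt_of_le_of_lt le_self_add hlt
        rw [edist_dist, Subtype.dist_eq, Real.dist_eq, ENNReal.ofReal_lt_ofReal_iff hr0] at hd
        obtain ⟨h0, h1⟩ := hr ⟨e, s⟩ hs t hst hd
        have heq := eq_of_pt_eq_pt_of_interior ht h0 h1
        cases heq
        have htri : edist s t' + d ≤ edist s s' + (edist s' t' + d) := by
          rw [← add_assoc]; exact add_le_add (edist_triangle _ _ _) le_rfl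
        obtain ⟨e2, s2, t2, h1, h2, h3⟩ := ih _ s t' hs rfl (lt_of_le_of_lt htri hlt)
        exact ⟨e2, s2, t2, h1, h2, h3.trans htri⟩
  -- the infimum over the routes is attained, as there are finitely many candidates
  refine ⟨ENNReal.ofReal r, ENNReal.ofReal_pos.2 hr0, fun q hq => ?_⟩
  have hex : ∀ d, G.Route p q d → d < ENNReal.ofReal r →
      ∃ e s t, G.pt e s = p ∧ G.pt e t = q ∧ edist s t ≤ d := by
    intro d hd hlt
    obtain ⟨e, s, hs⟩ := exists_pt_eq p
    simpa using route hd e s s hs hs (by simpa using hlt)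
  let T : Set (Σ e : E, Icc (0 : ℝ) (G.length e) × Icc (0 : ℝ) (G.length e)) :=
    {x | G.pt x.1 x.2.1 = p ∧ G.pt x.1 x.2.2 = q}
  let V : Set ℝ≥0∞ := (fun x : Σ e : E, Icc (0 : ℝ) (G.length e) × Icc (0 : ℝ) (G.length e) =>
    edist x.2.1 x.2.2) '' T
  have hq' : sInf V ≤ edist p q := by
    refine le_of_forall_gt fun c hc => ?_
    obtain ⟨d, hd⟩ := iInf_lt_iff.1 (lt_min hc hq)
    obtain ⟨hd1, hd2⟩ := iInf_lt_iff.1 hd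
    obtain ⟨e, s, t, h1, h2, h3⟩ := hex d hd1 (hd2.trans_le (min_le_right _ _))
    have hmem : edist s t ∈ V := ⟨⟨e, s, t⟩, ⟨h1, h2⟩, rfl⟩
    exact lt_of_le_of_lt ((sInf_le hmem).trans h3)
      (hd2.trans_le (min_le_left _ _))
  have hVne : V.Nonempty := by
    obtain ⟨d, hd⟩ := iInf_lt_iff.1 hq
    obtain ⟨hd1, hd2⟩ := iInf_lt_iff.1 hd
    obtain ⟨e, s, t, h1, h2, -⟩ := hex d hd1 hd2
    exact ⟨_, ⟨e, s, t⟩, ⟨h1, h2⟩, rfl⟩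
  have hVfin : V.Finite := by
    -- for each representative `(e, s)` of `p`, the candidates are `q` itself, an endpoint, or the
    -- single interior representative of `q`
    refine Set.Finite.image _ ?_
    have hT : T ⊆ ⋃ x ∈ reps p, (fun t : Icc (0 : ℝ) (G.length x.1) =>
        (⟨x.1, x.2, t⟩ : Σ e : E, Icc (0 : ℝ) (G.length e) × Icc (0 : ℝ) (G.length e))) ''
        {t | G.pt x.1 t = q} := by
      rintro ⟨e, s, t⟩ ⟨h1, h2⟩
      exact mem_iUnion₂.2 ⟨⟨e, s⟩, h1, t, h2, rfl⟩
    refine (hp.biUnion fun x _ => Set.Finite.image _ ?_).subset hT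
    by_cases h : ∃ t : Icc (0 : ℝ) (G.length x.1), G.pt x.1 t = q ∧ 0 < (t : ℝ) ∧
        (t : ℝ) < G.length x.1
    · obtain ⟨t, h1, h2, h3⟩ := h
      refine (finite_singleton t).subset fun t' ht' => ?_
      have := eq_of_pt_eq_pt_of_interior (h1.trans (show G.pt x.1 t' = q from ht').symm) h2 h3
      cases this
      rfl
    · push Not at h
      refine ((finite_singleton (⟨0, le_rfl, (G.length_pos x.1).le⟩ : Icc (0 : ℝ) (G.length x.1))).union
        (finite_singleton ⟨G.length x.1, (G.length_pos x.1).le, le_rfl⟩)).subset fun t' ht' => ?_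
      rcases eq_or_lt_of_le t'.2.1 with h0 | h0
      · exact Or.inl (Subtype.ext h0.symm)
      · exact Or.inr (Subtype.ext (le_antisymm t'.2.2 (h t' ht' h0)))
  obtain ⟨⟨e, s, t⟩, ⟨h1, h2⟩, h3⟩ := hVne.csInf_mem hVfin
  refine ⟨e, s, t, h1, h2, le_antisymm (h3.trans_le hq') ?_⟩
  rw [← h1, ← h2]
  exact edist_pt_le e s t

theorem eq_of_edist_eq_zero_of_locallyFinite (hfin : G.LocallyFinite) {p q : G.Point}
    (h : edist p q = 0) : p = q := by
  obtain ⟨r, hr, hstar⟩ := exists_star p (finite_reps hfin p)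
  obtain ⟨e, s, t, rfl, rfl, h3⟩ := hstar q (by rwa [h])
  rw [h, edist_eq_zero] at h3
  rw [h3]

theorem t2Space_of_locallyFinite (hfin : G.LocallyFinite) : T2Space G.Point := by
  have : T0Space G.Point :=
    ⟨fun p q h => eq_of_edist_eq_zero_of_locallyFinite hfin (EMetric.inseparable_iff.1 h)⟩
  infer_instance

theorem finite_reps_of_interior {e : E} {s : Icc (0 : ℝ) (G.length e)} (h0 : 0 < (s : ℝ))
    (h1 : (s : ℝ) < G.length e) : (reps (G.pt e s)).Finite :=
  (finite_singleton (⟨e, s⟩ : G.EdgeSpace)).subset fun x hx =>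
    (eq_of_pt_eq_pt_of_interior (show G.pt x.1 x.2 = G.pt e s from hx).symm h0 h1).symm

end Topology

/-! ### Height functions -/

section Height

variable {E : Type*} {G : MetricGraph E}

theorem onEdge_of_mem (f : G.Point → ℝ) (e : E) {t : ℝ} (ht : t ∈ Icc (0 : ℝ) (G.length e)) :
    onEdge f e t = f (G.pt e ⟨t, ht⟩) := IccExtend_of_mem _ _ ht

theorem onEdge_coe (f : G.Point → ℝ) (e : E) (t : Icc (0 : ℝ) (G.length e)) :
    onEdge f e t = f (G.pt e t) := onEdge_of_mem f e t.2

theorem continuous_onEdge {f : G.Point → ℝ} (hf : Continuous f) (e : E) :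
    Continuous (onEdge f e) :=
  (hf.comp (continuous_pt e)).Icc_extend'

/-- The levels that a function attains at no more than two points. -/
def thinLevels (h : G.Point → ℝ) : Set ℝ :=
  {c | ∀ p q r, h p = c → h q = c → h r = c → p = q ∨ q = r ∨ p = r}

/-- A height function has slope one along the edges and takes most of its values at most twice. The
slope is encoded by the Lipschitz bound, together with equality on the segments where the function
is injective. -/
structure IsHeight (h : G.Point → ℝ) : Prop where
  lip : LipschitzWith 1 h
  iso : ∀ e, ∀ s ∈ Icc 0 (G.length e), ∀ t ∈ Icc 0 (G.length e), InjOn (onEdge h e) (uIcc s t) →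
    |onEdge h e t - onEdge h e s| = |t - s|
  null : ∀ e c, volume (Icc 0 (G.length e) ∩ onEdge h e ⁻¹' {c}) = 0
  dense : Dense (thinLevels h)

theorem IsHeight.neg {h : G.Point → ℝ} (hh : IsHeight h) : IsHeight (-h) where
  lip := by
    intro x y
    simpa [edist_neg_neg] using hh.lip x y
  iso e s hs t ht hinj := by
    have hneg : ∀ u, onEdge (-h) e u = - onEdge h e u := fun u => rfl
    rw [hneg, hneg, ← hh.iso e s hs t ht (fun u hu v hv huv => hinj hu hv (by
      rw [hneg, hneg, huv])), ← abs_neg]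
    congr 1
    ring
  null e c := by
    have : onEdge (-h) e ⁻¹' {c} = onEdge h e ⁻¹' {-c} := by
      ext u
      change - onEdge h e u = c ↔ onEdge h e u = -c
      constructor <;> intro h <;> linarith
    rw [this]
    exact hh.null e (-c)
  dense := by
    have : thinLevels (-h) = Homeomorph.neg ℝ '' thinLevels h := by
      ext c
      simp only [mem_image, Homeomorph.coe_neg, thinLevels, mem_ofPred_eq, Pi.neg_apply]
      constructor
      · intro H
        refine ⟨-c, fun p q r hp hq hr => H p q r ?_ ?_ ?_, by simp⟩ <;> linarith
      · rintro ⟨c', H, rfl⟩ p q r hp hq hr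
        refine H p q r ?_ ?_ ?_ <;> linarith
    rw [this]
    exact (Homeomorph.neg ℝ).surjective.denseRange.dense_image
      (Homeomorph.neg ℝ).continuous hh.dense

/-- A pair of injective paths, parametrised by `[0, 1]`, with finitely many common points. -/
structure IsPathPair (γ δ : ℝ → G.Point) (x y : G.Point) : Prop where
  cont₁ : Continuous γ
  cont₂ : Continuous δ
  inj₁ : InjOn γ (Icc 0 1)
  inj₂ : InjOn δ (Icc 0 1)
  zero₁ : γ 0 = x
  zero₂ : δ 0 = x
  one₁ : γ 1 = y
  one₂ : δ 1 = y
  fin : (γ '' Icc 0 1 ∩ δ '' Icc 0 1).Finite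

theorem IsPathPair.symm {γ δ : ℝ → G.Point} {x y : G.Point} (h : IsPathPair γ δ x y) :
    IsPathPair δ γ x y :=
  ⟨h.cont₂, h.cont₁, h.inj₂, h.inj₁, h.zero₂, h.zero₁, h.one₂, h.one₁, by
    rw [inter_comm]; exact h.fin⟩

theorem DoublyConnected.exists_isPathPair (hdc : G.DoublyConnected) {x y : G.Point} (hxy : x ≠ y) :
    ∃ γ δ, IsPathPair γ δ x y := by
  obtain ⟨P, Q, hP, hQ, hfin, -⟩ := hdc x y hxy
  have hinj : ∀ P : Path x y, Function.Injective P → InjOn P.extend (Icc 0 1) := by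
    intro P hP s hs t ht hst
    rw [Path.extend_apply P hs, Path.extend_apply P ht] at hst
    exact congrArg Subtype.val (hP hst)
  have him : ∀ P : Path x y, P.extend '' Icc 0 1 ⊆ range P := by
    rintro P _ ⟨s, hs, rfl⟩
    exact ⟨⟨s, hs⟩, (Path.extend_apply P hs).symm⟩
  exact ⟨P.extend, Q.extend, P.continuous_extend, Q.continuous_extend, hinj P hP, hinj Q hQ,
    P.extend_zero, Q.extend_zero, P.extend_one, Q.extend_one,
    hfin.subset (inter_subset_inter (him P) (him Q))⟩

namespace IsHeight

variable {h : G.Point → ℝ}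

theorem exists_thinLevel (hh : IsHeight h) {a b : ℝ} (hab : a < b) {F : Set ℝ} (hF : F.Finite) :
    ∃ c, a < c ∧ c < b ∧ c ∈ thinLevels h ∧ c ∉ F := by
  obtain ⟨c, hc, hc'⟩ := (hh.dense.sdiff_finite hF).exists_between hab
  exact ⟨c, hc'.1, hc'.2, hc.1, hc.2⟩

/-- A level set contains no nontrivial curve. -/
theorem exists_ne_of_curve (hh : IsHeight h) (hfin : G.LocallyFinite) {γ : ℝ → G.Point}
    (hγ : Continuous γ) {a b : ℝ} (hab : a ≤ b) (hne : γ a ≠ γ b) (c : ℝ) :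
    ∃ u ∈ Icc a b, h (γ u) ≠ c := by
  by_contra! hc
  obtain ⟨r, hr, hstar⟩ := exists_star (γ a) (finite_reps hfin (γ a))
  have hφ : Continuous fun u => edist (γ a) (γ u) := continuous_const.edist hγ
  have hb : 0 < edist (γ a) (γ b) :=
    pos_iff_ne_zero.2 fun h0 => hne (eq_of_edist_eq_zero_of_locallyFinite hfin h0)
  obtain ⟨d₁, hd₁, hd₁'⟩ : ∃ d₁ : ℝ, 0 < d₁ ∧ ENNReal.ofReal d₁ ≤ min r (edist (γ a) (γ b)) := by
    obtain ⟨d, hd0, hd1⟩ := ENNReal.lt_iff_exists_nnreal_btwn.1 (lt_min hr hb)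
    exact ⟨d, by exact_mod_cast hd0, by simpa using hd1.le⟩
  -- every small distance is attained on the curve, at a point of the level set on one of the edges
  let Z : G.EdgeSpace → Set ℝ := fun x => Icc 0 (G.length x.1) ∩ onEdge h x.1 ⁻¹' {c}
  have hcov : Ioo 0 d₁ ⊆ ⋃ x ∈ reps (γ a),
      ((fun d : ℝ => (x.2 : ℝ) + d) ⁻¹' Z x ∪ (fun d : ℝ => (x.2 : ℝ) - d) ⁻¹' Z x) := by
    intro d hd
    have hdlt : ENNReal.ofReal d < min r (edist (γ a) (γ b)) :=
      ((ENNReal.ofReal_lt_ofReal_iff hd₁).2 hd.2).trans_le hd₁'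
    obtain ⟨u, hu, hud⟩ := intermediate_value_Icc hab hφ.continuousOn
      ⟨by simp, (hdlt.trans_le (min_le_right _ _)).le⟩
    obtain ⟨e, s, t, h1, h2, h3⟩ := hstar (γ u) (by
      rw [show edist (γ a) (γ u) = _ from hud]; exact hdlt.trans_le (min_le_left _ _))
    rw [show edist (γ a) (γ u) = _ from hud, edist_dist, Subtype.dist_eq, Real.dist_eq,
      ENNReal.ofReal_eq_ofReal_iff (abs_nonneg _) hd.1.le] at h3
    have hZ : (t : ℝ) ∈ Z ⟨e, s⟩ := ⟨t.2, by
      rw [mem_preimage, onEdge_coe, h2]; exact hc u hu⟩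
    refine mem_iUnion₂.2 ⟨⟨e, s⟩, h1, ?_⟩
    rcases abs_cases ((s : ℝ) - t) with h4 | h4
    · right
      change (s : ℝ) - d ∈ Z ⟨e, s⟩
      rwa [show (s : ℝ) - d = t by linarith]
    · left
      change (s : ℝ) + d ∈ Z ⟨e, s⟩
      rwa [show (s : ℝ) + d = t by linarith]
  have hnull : volume (⋃ x ∈ reps (γ a),
      ((fun d : ℝ => (x.2 : ℝ) + d) ⁻¹' Z x ∪ (fun d : ℝ => (x.2 : ℝ) - d) ⁻¹' Z x)) = 0 := by
    refine (measure_biUnion_null_iff (finite_reps hfin (γ a)).countable).2 fun x _ =>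
      measure_union_null ?_ ?_
    · rw [measure_preimage_add]
      exact hh.null x.1 c
    · exact (Measure.measurePreserving_sub_left volume
        (x.2 : ℝ)).quasiMeasurePreserving.preimage_null (hh.null x.1 c)
  have := measure_mono_null hcov hnull
  simp [Real.volume_Ioo, hd₁.not_ge] at this

/-- Near every point there are points at thin levels. -/
theorem exists_thin_near (hh : IsHeight h) (r : G.Point) {U : Set G.Point} (hU : U ∈ nhds r)
    {F : Set ℝ} (hF : F.Finite) : ∃ q ∈ U, h q ∈ thinLevels h ∧ h q ∉ F := by
  obtain ⟨e, s, rfl⟩ := exists_pt_eq r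
  have hl := G.length_pos e
  have hs := s.2
  let π : ℝ → G.Point := IccExtend hl.le (G.pt e)
  have hπ : Continuous π := (continuous_pt e).Icc_extend'
  have hπs : π s = G.pt e s := IccExtend_of_mem _ _ s.2
  have hU' : π ⁻¹' U ∈ nhds (s : ℝ) := hπ.continuousAt.preimage_mem_nhds (by rwa [hπs])
  obtain ⟨δ, hδ, hball⟩ := Metric.mem_nhds_iff.1 hU'
  have hαβ : max 0 ((s : ℝ) - δ / 2) < min (G.length e) (s + δ / 2) := by
    refine max_lt (lt_min hl ?_) (lt_min ?_ ?_) <;> linarith [hs.1, hs.2]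
  set α := max 0 ((s : ℝ) - δ / 2) with hα
  set β := min (G.length e) ((s : ℝ) + δ / 2) with hβ
  have hIcc : Icc α β ⊆ Icc 0 (G.length e) :=
    Icc_subset_Icc (le_max_left _ _) (min_le_left _ _)
  have hIU : ∀ t ∈ Icc α β, π t ∈ U := by
    intro t ht
    apply hball
    rw [Metric.mem_ball, Real.dist_eq, abs_lt]
    have h1 := le_max_right 0 ((s : ℝ) - δ / 2)
    have h2 := min_le_right (G.length e) ((s : ℝ) + δ / 2)
    constructor <;> linarith [ht.1, ht.2]
  have hcont := continuous_onEdge hh.lip.continuous e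
  obtain ⟨t, ht, htne⟩ : ∃ t ∈ Icc α β, onEdge h e t ≠ onEdge h e α := by
    by_contra! hcon
    have hsub : Icc α β ⊆ Icc 0 (G.length e) ∩ onEdge h e ⁻¹' {onEdge h e α} :=
      fun t ht => ⟨hIcc ht, hcon t ht⟩
    have := measure_mono_null hsub (hh.null e _)
    simp [Real.volume_Icc, hαβ.not_ge] at this
  have huIcc : uIcc α t ⊆ Icc α β := by
    rw [uIcc_of_le ht.1]
    exact Icc_subset_Icc le_rfl ht.2
  have hlt : min (onEdge h e α) (onEdge h e t) < max (onEdge h e α) (onEdge h e t) :=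
    min_lt_max.2 htne.symm
  obtain ⟨c, hc1, hc2, hcD, hcF⟩ := hh.exists_thinLevel hlt hF
  obtain ⟨u, hu, hcu⟩ := intermediate_value_uIcc (a := α) (b := t) hcont.continuousOn
    ⟨hc1.le, hc2.le⟩
  have hu' := huIcc hu
  have hval : h (π u) = c := hcu
  exact ⟨π u, hIU u hu', by rwa [hval], by rwa [hval]⟩

/-- A closed set that contains all points at thin levels between `a` and `b` contains all points
at levels between `a` and `b`. -/
theorem mem_of_isClosed (hh : IsHeight h) {S : Set G.Point} (hS : IsClosed S) {a b : ℝ}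
    {F : Set ℝ} (hF : F.Finite)
    (hmem : ∀ q, h q ∈ Ioo a b → h q ∈ thinLevels h → h q ∉ F → q ∈ S) {r : G.Point}
    (hr : h r ∈ Ioo a b) : r ∈ S := by
  rw [← hS.closure_eq, mem_closure_iff_nhds]
  intro U hU
  have hV : U ∩ h ⁻¹' Ioo a b ∈ nhds r :=
    Filter.inter_mem hU (hh.lip.continuous.continuousAt.preimage_mem_nhds (Ioo_mem_nhds hr.1 hr.2))
  obtain ⟨q, hq, hqD, hqF⟩ := hh.exists_thin_near r hV hF
  exact ⟨q, hq.1, hmem q hq.2 hqD hqF⟩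

theorem exists_eq_of_mem_uIcc (hh : IsHeight h) {γ : ℝ → G.Point} (hγ : Continuous γ) {a b c : ℝ}
    (hc : min (h (γ a)) (h (γ b)) ≤ c) (hc' : c ≤ max (h (γ a)) (h (γ b))) (hab : a ≤ b) :
    ∃ u ∈ Icc a b, h (γ u) = c := by
  have := intermediate_value_uIcc (a := a) (b := b) (hh.lip.continuous.comp hγ).continuousOn
    (show c ∈ uIcc _ _ from ⟨hc, hc'⟩)
  rw [uIcc_of_le hab] at this
  exact this

/-- A thin level is not passed three times by an injective path. -/
theorem false_of_three {γ : ℝ → G.Point} (hinj : InjOn γ (Icc 0 1)) {c u v w : ℝ}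
    (hc : c ∈ thinLevels h) (hu : u ∈ Icc (0 : ℝ) 1) (hv : v ∈ Icc (0 : ℝ) 1)
    (hw : w ∈ Icc (0 : ℝ) 1) (huv : u < v) (hvw : v < w) (hu' : h (γ u) = c) (hv' : h (γ v) = c)
    (hw' : h (γ w) = c) : False := by
  rcases hc _ _ _ hu' hv' hw' with h1 | h1 | h1
  · exact huv.ne (hinj hu hv h1)
  · exact hvw.ne (hinj hv hw h1)
  · exact (huv.trans hvw).ne (hinj hu hw h1)

/-- A thin level that is passed by both paths of a pair, away from their common points, is passed
once by each of them. -/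
theorem eq_of_pathPair {γ δ : ℝ → G.Point} {x y : G.Point} (hp : IsPathPair γ δ x y) {c u v w : ℝ}
    (hc : c ∈ thinLevels h) (hcF : c ∉ h '' (γ '' Icc 0 1 ∩ δ '' Icc 0 1))
    (hu : u ∈ Icc (0 : ℝ) 1) (hv : v ∈ Icc (0 : ℝ) 1)
    (hw : w ∈ Icc (0 : ℝ) 1) (hu' : h (γ u) = c) (hv' : h (γ v) = c)
    (hw' : h (δ w) = c) : u = v := by
  have hne : ∀ u ∈ Icc (0 : ℝ) 1, h (γ u) = c → γ u ≠ δ w := fun u hu hu' heq =>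
    hcF ⟨γ u, ⟨⟨u, hu, rfl⟩, ⟨w, hw, heq.symm⟩⟩, hu'⟩
  rcases hc _ _ _ hu' hv' hw' with h1 | h1 | h1
  · exact hp.inj₁ hu hv h1
  · exact absurd h1 (hne v hv hv')
  · exact absurd h1 (hne u hu hu')

/-- Of two paths between points at the same level, at most one goes above this level. -/
theorem not_both_above (hh : IsHeight h) {γ δ : ℝ → G.Point} {x y : G.Point}
    (hp : IsPathPair γ δ x y) (hxy : h x = h y) {u v : ℝ} (hu : u ∈ Icc (0 : ℝ) 1)
    (hv : v ∈ Icc (0 : ℝ) 1) (hγ : h x < h (γ u)) (hδ : h x < h (δ v)) : False := by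
  obtain ⟨c, hc1, hc2, hcD, hcF⟩ := hh.exists_thinLevel (lt_min hγ hδ) (hp.fin.image h)
  have hcu := hc2.trans_le (min_le_left _ _)
  have hcv := hc2.trans_le (min_le_right _ _)
  obtain ⟨u1, hu1, hu1'⟩ := hh.exists_eq_of_mem_uIcc hp.cont₁ (a := 0) (b := u) (c := c)
    (min_le_of_left_le (by rw [hp.zero₁]; exact hc1.le)) (le_max_of_le_right hcu.le) hu.1
  obtain ⟨u2, hu2, hu2'⟩ := hh.exists_eq_of_mem_uIcc hp.cont₁ (a := u) (b := 1) (c := c)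
    (min_le_of_right_le (by rw [hp.one₁, ← hxy]; exact hc1.le)) (le_max_of_le_left hcu.le) hu.2
  obtain ⟨v1, hv1, hv1'⟩ := hh.exists_eq_of_mem_uIcc hp.cont₂ (a := 0) (b := v) (c := c)
    (min_le_of_left_le (by rw [hp.zero₂]; exact hc1.le)) (le_max_of_le_right hcv.le) hv.1
  have heq := eq_of_pathPair hp hcD hcF ⟨hu1.1, hu1.2.trans hu.2⟩ ⟨hu.1.trans hu2.1, hu2.2⟩
    ⟨hv1.1, hv1.2.trans hv.2⟩ hu1' hu2' hv1'
  have : u1 = u := le_antisymm hu1.2 (heq ▸ hu2.1)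
  rw [this] at hu1'
  exact hcu.ne hu1'.symm

theorem not_both_below (hh : IsHeight h) {γ δ : ℝ → G.Point} {x y : G.Point}
    (hp : IsPathPair γ δ x y) (hxy : h x = h y) {u v : ℝ} (hu : u ∈ Icc (0 : ℝ) 1)
    (hv : v ∈ Icc (0 : ℝ) 1) (hγ : h (γ u) < h x) (hδ : h (δ v) < h x) : False :=
  hh.neg.not_both_above hp (by simp [hxy]) hu hv (by simpa using hγ) (by simpa using hδ)

/-- Two points at the same level are joined by an injective path above this level. -/
theorem exists_path_above (hh : IsHeight h) (hfin : G.LocallyFinite) (hdc : G.DoublyConnected)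
    {x y : G.Point} (hne : x ≠ y) (hxy : h x = h y) :
    ∃ γ : ℝ → G.Point, Continuous γ ∧ InjOn γ (Icc 0 1) ∧ γ 0 = x ∧ γ 1 = y ∧
      ∀ u ∈ Icc (0 : ℝ) 1, h x ≤ h (γ u) := by
  obtain ⟨γ, δ, hp⟩ := hdc.exists_isPathPair hne
  by_cases hγ : ∃ u ∈ Icc (0 : ℝ) 1, h x < h (γ u)
  · obtain ⟨u, hu, hγu⟩ := hγ
    -- the other path is not above, so it is somewhere below
    obtain ⟨v, hv, hδv⟩ := hh.exists_ne_of_curve hfin hp.cont₂ zero_le_one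
      (by rwa [hp.zero₂, hp.one₂]) (h x)
    refine ⟨γ, hp.cont₁, hp.inj₁, hp.zero₁, hp.one₁, fun w hw => ?_⟩
    by_contra! hlt
    rcases lt_or_gt_of_ne hδv with h1 | h1
    · exact hh.not_both_below hp hxy hw hv hlt h1
    · exact hh.not_both_above hp hxy hu hv hγu h1
  · push Not at hγ
    obtain ⟨v, hv, hγv⟩ := hh.exists_ne_of_curve hfin hp.cont₁ zero_le_one
      (by rwa [hp.zero₁, hp.one₁]) (h x)
    refine ⟨δ, hp.cont₂, hp.inj₂, hp.zero₂, hp.one₂, fun w hw => ?_⟩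
    by_contra! hlt
    exact hh.not_both_below hp hxy hv hw (lt_of_le_of_ne (hγ v hv) hγv) hlt

theorem exists_path_below (hh : IsHeight h) (hfin : G.LocallyFinite) (hdc : G.DoublyConnected)
    {x y : G.Point} (hne : x ≠ y) (hxy : h x = h y) :
    ∃ γ : ℝ → G.Point, Continuous γ ∧ InjOn γ (Icc 0 1) ∧ γ 0 = x ∧ γ 1 = y ∧
      ∀ u ∈ Icc (0 : ℝ) 1, h (γ u) ≤ h x := by
  obtain ⟨γ, h1, h2, h3, h4, h5⟩ := hh.neg.exists_path_above hfin hdc hne (by simp [hxy])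
  exact ⟨γ, h1, h2, h3, h4, fun u hu => by simpa using h5 u hu⟩

/-- The levels taken at exactly one point. -/
def knots (h : G.Point → ℝ) : Set ℝ := {k | ∃ p, h p = k ∧ ∀ q, h q = k → q = p}

/-- An injective path that starts at the level `t` and stays below the level `M > t` reaches `M` at
most once. -/
theorem false_of_two_tops (hh : IsHeight h) (hfin : G.LocallyFinite) {γ : ℝ → G.Point}
    (hγ : Continuous γ) (hinj : InjOn γ (Icc 0 1)) {t M σ τ : ℝ} (h0 : h (γ 0) = t)
    (hM : ∀ u ∈ Icc (0 : ℝ) 1, h (γ u) ≤ M) (htM : t < M) (hσ : 0 ≤ σ) (hτ : τ ≤ 1) (hστ : σ < τ)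
    (hσM : h (γ σ) = M) (hτM : h (γ τ) = M) : False := by
  have hne : γ σ ≠ γ τ := fun h1 =>
    hστ.ne (hinj ⟨hσ, hστ.le.trans hτ⟩ ⟨hσ.trans hστ.le, hτ⟩ h1)
  obtain ⟨v, hv, hvM⟩ := hh.exists_ne_of_curve hfin hγ hστ.le hne M
  have hvM' : h (γ v) < M := lt_of_le_of_ne (hM v ⟨hσ.trans hv.1, hv.2.trans hτ⟩) hvM
  obtain ⟨c, hc1, hc2, hcD, -⟩ := hh.exists_thinLevel (max_lt htM hvM') finite_empty
  have hct := (le_max_left _ _).trans_lt hc1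
  have hcv := (le_max_right _ _).trans_lt hc1
  obtain ⟨u1, hu1, hu1'⟩ := hh.exists_eq_of_mem_uIcc hγ (a := 0) (b := σ) (c := c)
    (min_le_of_left_le (h0 ▸ hct.le)) (le_max_of_le_right (hσM ▸ hc2.le)) hσ
  obtain ⟨u2, hu2, hu2'⟩ := hh.exists_eq_of_mem_uIcc hγ (a := σ) (b := v) (c := c)
    (min_le_of_right_le hcv.le) (le_max_of_le_left (hσM ▸ hc2.le)) hv.1
  obtain ⟨u3, hu3, hu3'⟩ := hh.exists_eq_of_mem_uIcc hγ (a := v) (b := τ) (c := c)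
    (min_le_of_left_le hcv.le) (le_max_of_le_right (hτM ▸ hc2.le)) hv.2
  have hne1 : u1 ≠ σ := fun h1 => by rw [h1, hσM] at hu1'; exact hc2.ne hu1'.symm
  have hne2 : u2 ≠ v := fun h1 => by rw [h1] at hu2'; exact hcv.ne hu2'
  have h12 : u1 < u2 := (lt_of_le_of_ne hu1.2 hne1).trans_le hu2.1
  have h23 : u2 < u3 := (lt_of_le_of_ne hu2.2 hne2).trans_le hu3.1
  exact false_of_three hinj hcD ⟨hu1.1, by linarith [hu3.2]⟩ ⟨by linarith [hu1.1], by linarith [hu3.2]⟩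
    ⟨by linarith [hu1.1], by linarith [hu3.2]⟩ h12 h23 hu1' hu2' hu3'

/-- Above a level that is taken twice there is a knot: the top of the path above this level. -/
theorem exists_knot_above (hh : IsHeight h) (hfin : G.LocallyFinite) (hdc : G.DoublyConnected)
    {x y : G.Point} (hne : x ≠ y) (hxy : h x = h y) : ∃ k ∈ knots h, h x < k := by
  have := t2Space_of_locallyFinite hfin
  obtain ⟨γ, hγ, hinj, hγ0, hγ1, habove⟩ := hh.exists_path_above hfin hdc hne hxy
  obtain ⟨τ, hτ, hmax⟩ := isCompact_Icc.exists_isMaxOn (nonempty_Icc.2 (zero_le_one (α := ℝ)))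
    (hh.lip.continuous.comp hγ).continuousOn
  have hM : ∀ u ∈ Icc (0 : ℝ) 1, h (γ u) ≤ h (γ τ) := fun u hu => hmax hu
  obtain ⟨v, hv, hvne⟩ := hh.exists_ne_of_curve hfin hγ zero_le_one (by rwa [hγ0, hγ1]) (h x)
  have htM : h x < h (γ τ) := (lt_of_le_of_ne (habove v hv) hvne.symm).trans_le (hM v hv)
  refine ⟨h (γ τ), ⟨γ τ, rfl, fun r hr => ?_⟩, htM⟩
  by_contra hrne
  obtain ⟨R, hR, hRinj, hR0, hR1, hbelow⟩ := hh.exists_path_below hfin hdc (Ne.symm hrne) hr.symm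
  -- the lower path to `r` runs through points of the first path, which therefore contains `r`
  have hmem : r ∈ γ '' Icc 0 1 := by
    have hclosed : IsClosed (γ '' Icc 0 1) := (isCompact_Icc.image hγ).isClosed
    rw [← hclosed.closure_eq, mem_closure_iff_nhds]
    intro U hU
    have hV : U ∩ h ⁻¹' Ioi (h x) ∈ nhds r := Filter.inter_mem hU
      (hh.lip.continuous.continuousAt.preimage_mem_nhds (Ioi_mem_nhds (by rw [hr]; exact htM)))
    have hV' : R ⁻¹' (U ∩ h ⁻¹' Ioi (h x)) ∈ nhds (1 : ℝ) :=
      hR.continuousAt.preimage_mem_nhds (by rwa [hR1])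
    obtain ⟨ε, hε, hball⟩ := Metric.mem_nhds_iff.1 hV'
    have hnear : ∀ u ∈ Icc (max 0 (1 - ε / 2)) 1, R u ∈ U ∩ h ⁻¹' Ioi (h x) := by
      intro u hu
      apply hball
      rw [Metric.mem_ball, Real.dist_eq, abs_lt]
      have := le_max_right 0 (1 - ε / 2)
      constructor <;> linarith [hu.1, hu.2]
    have hlt1 : max 0 (1 - ε / 2) < 1 := max_lt one_pos (by linarith)
    have hne' : R (max 0 (1 - ε / 2)) ≠ R 1 := fun h1 =>
      hlt1.ne (hRinj ⟨le_max_left _ _, hlt1.le⟩ ⟨zero_le_one, le_rfl⟩ h1)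
    obtain ⟨v, hv, hvne⟩ := hh.exists_ne_of_curve hfin hR hlt1.le hne' (h (γ τ))
    have hv01 : v ∈ Icc (0 : ℝ) 1 := ⟨(le_max_left _ _).trans hv.1, hv.2⟩
    have hvlt : h (R v) < h (γ τ) := lt_of_le_of_ne (hbelow v hv01) hvne
    obtain ⟨c, hc1, hc2, hcD, -⟩ := hh.exists_thinLevel hvlt finite_empty
    obtain ⟨w, hw, hwc⟩ := hh.exists_eq_of_mem_uIcc hR (a := v) (b := 1) (c := c)
      (min_le_of_left_le hc1.le) (le_max_of_le_right (by rw [hR1, hr]; exact hc2.le)) hv.2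
    have hwU := hnear w ⟨hv.1.trans hw.1, hw.2⟩
    have hxc : h x < c := by rw [← hwc]; exact hwU.2
    obtain ⟨u1, hu1, hu1'⟩ := hh.exists_eq_of_mem_uIcc hγ (a := 0) (b := τ) (c := c)
      (min_le_of_left_le (by rw [hγ0]; exact hxc.le)) (le_max_of_le_right hc2.le) hτ.1
    obtain ⟨u2, hu2, hu2'⟩ := hh.exists_eq_of_mem_uIcc hγ (a := τ) (b := 1) (c := c)
      (min_le_of_right_le (by rw [hγ1, ← hxy]; exact hxc.le)) (le_max_of_le_left hc2.le) hτ.2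
    have hu1m : u1 ∈ Icc (0 : ℝ) 1 := ⟨hu1.1, hu1.2.trans hτ.2⟩
    have hu2m : u2 ∈ Icc (0 : ℝ) 1 := ⟨hτ.1.trans hu2.1, hu2.2⟩
    refine ⟨R w, hwU.1, ?_⟩
    rcases hcD _ _ _ hu1' hu2' hwc with h1 | h1 | h1
    · have heq := hinj hu1m hu2m h1
      have : u1 = τ := le_antisymm hu1.2 (heq ▸ hu2.1)
      rw [this] at hu1'
      exact absurd hu1' hc2.ne'
    · exact ⟨u2, hu2m, h1⟩
    · exact ⟨u1, hu1m, h1⟩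
  obtain ⟨σ, hσ, rfl⟩ := hmem
  rcases lt_trichotomy σ τ with h1 | h1 | h1
  · exact hh.false_of_two_tops hfin hγ hinj (by rw [hγ0]) hM htM hσ.1 hτ.2 h1 hr rfl
  · exact hrne (by rw [h1])
  · exact hh.false_of_two_tops hfin hγ hinj (by rw [hγ0]) hM htM hτ.1 hσ.2 h1 rfl hr

theorem knots_neg (h : G.Point → ℝ) : knots (-h) = Neg.neg ⁻¹' knots h := by
  ext k
  simp only [knots, mem_ofPred_eq, mem_preimage, Pi.neg_apply]
  constructor <;> rintro ⟨p, hp, hq⟩ <;> exact ⟨p, by linarith, fun q h1 => hq q (by linarith)⟩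

theorem exists_knot_below (hh : IsHeight h) (hfin : G.LocallyFinite) (hdc : G.DoublyConnected)
    {x y : G.Point} (hne : x ≠ y) (hxy : h x = h y) : ∃ k ∈ knots h, k < h x := by
  obtain ⟨k, hk, hlt⟩ := hh.neg.exists_knot_above hfin hdc hne (by simp [hxy])
  rw [knots_neg] at hk
  exact ⟨-k, hk, by simp only [Pi.neg_apply] at hlt; linarith⟩

/-- Both paths of a pair pass through every knot between the levels of their endpoints. -/
theorem finite_knots_inter_Icc (hh : IsHeight h) (hdc : G.DoublyConnected) (x y : G.Point) :
    (knots h ∩ Icc (h x) (h y)).Finite := by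
  by_cases hxy : x = y
  · subst hxy
    exact (finite_singleton (h x)).subset fun k hk => le_antisymm hk.2.2 hk.2.1
  obtain ⟨γ, δ, hp⟩ := hdc.exists_isPathPair hxy
  refine (hp.fin.image h).subset ?_
  rintro k ⟨⟨p, hpk, hpu⟩, hk⟩
  obtain ⟨u, hu, huk⟩ := hh.exists_eq_of_mem_uIcc hp.cont₁ (a := 0) (b := 1) (c := k)
    (min_le_of_left_le (by rw [hp.zero₁]; exact hk.1))
    (le_max_of_le_right (by rw [hp.one₁]; exact hk.2)) zero_le_one
  obtain ⟨v, hv, hvk⟩ := hh.exists_eq_of_mem_uIcc hp.cont₂ (a := 0) (b := 1) (c := k)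
    (min_le_of_left_le (by rw [hp.zero₂]; exact hk.1))
    (le_max_of_le_right (by rw [hp.one₂]; exact hk.2)) zero_le_one
  exact ⟨p, ⟨⟨u, hu, hpu _ huk⟩, ⟨v, hv, hpu _ hvk⟩⟩, hpk⟩

end IsHeight

end Height

/-! ### Strands between consecutive knots -/

section Strands

variable {E : Type*} {G : MetricGraph E}

/-- A curve that locally stretches no distances from the centre stretches no distances. -/
theorem edist_le_of_local {Y : Type*} [PseudoEMetricSpace Y] {γ : ℝ → Y} {a b : ℝ}
    (hloc : ∀ s ∈ Icc a b, ∀ᶠ t in nhdsWithin s (Icc a b), edist (γ s) (γ t) ≤ edist s t)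
    {s t : ℝ} (hs : s ∈ Icc a b) (ht : t ∈ Icc a b) : edist (γ s) (γ t) ≤ edist s t := by
  wlog hst : s ≤ t generalizing s t
  · rw [edist_comm, edist_comm s]
    exact this ht hs (le_of_not_ge hst)
  have hsub : Icc s t ⊆ Icc a b := Icc_subset_Icc hs.1 ht.2
  have hcont : ContinuousOn γ (Icc a b) := by
    intro u hu
    rw [ContinuousWithinAt, tendsto_iff_edist_tendsto_0]
    refine tendsto_of_tendsto_of_tendsto_of_le_of_le' tendsto_const_nhds ?_
      (Filter.Eventually.of_forall fun _ => zero_le) ((hloc u hu).mono fun v hv => ?_)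
      (h := fun v => edist u v)
    · have : Filter.Tendsto (fun v : ℝ => edist u v) (nhds u) (nhds (edist u u)) :=
        (continuous_const.edist continuous_id).tendsto u
      rw [edist_self] at this
      exact this.mono_left nhdsWithin_le_nhds
    · rwa [edist_comm]
  have hclosed : IsClosed ({u | edist (γ s) (γ u) ≤ edist s u} ∩ Icc s t) := by
    have h1 : ContinuousOn (fun u => edist (γ s) (γ u)) (Icc s t) :=
      (continuous_const.edist continuous_id).comp_continuousOn (hcont.mono hsub)
    have h2 : ContinuousOn (fun u => edist s u) (Icc s t) :=
      (continuous_const.edist continuous_id).continuousOn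
    have := isClosed_Icc.isClosed_le h1 h2
    rwa [inter_comm] 
  refine hclosed.Icc_subset_of_forall_mem_nhdsWithin (by simp) ?_ ⟨hst, le_rfl⟩
  rintro u ⟨hu, hu1, hu2⟩
  have hu' : u ∈ Icc a b := hsub ⟨hu1, hu2.le⟩
  have hev : ∀ᶠ v in nhdsWithin u (Ioi u), edist (γ u) (γ v) ≤ edist u v := by
    have h1 : nhdsWithin u (Ioi u) = nhdsWithin u (Ioc u t) :=
      (nhdsWithin_Ioc_eq_nhdsGT hu2).symm
    rw [h1]
    exact (hloc u hu').filter_mono (nhdsWithin_mono u fun v hv =>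
      hsub ⟨hu1.trans hv.1.le, hv.2⟩)
  filter_upwards [hev, self_mem_nhdsWithin] with v hv huv
  have huv : u < v := huv
  calc edist (γ s) (γ v) ≤ edist (γ s) (γ u) + edist (γ u) (γ v) := edist_triangle _ _ _
    _ ≤ edist s u + edist u v := add_le_add hu hv
    _ = edist s v := by
      rw [edist_dist, edist_dist, edist_dist, Real.dist_eq, Real.dist_eq, Real.dist_eq,
        ← ENNReal.ofReal_add (abs_nonneg _) (abs_nonneg _), abs_of_nonpos (sub_nonpos.2 hu1),
        abs_of_neg (sub_neg.2 huv), abs_of_neg (sub_neg.2 (hu1.trans_lt huv))]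
      congr 1
      ring

/-- Two strands of a graph between the levels `k` and `l` of the height function `h`: two sections
of `h` that meet at most over `k` and `l` and contain all points between these levels. -/
structure IsStrandPair (h : G.Point → ℝ) (k l : ℝ) (σ : Bool → ℝ → G.Point) : Prop where
  cont : ∀ b, ContinuousOn (σ b) (Icc k l)
  section_eq : ∀ b, ∀ c ∈ Icc k l, h (σ b c) = c
  cover : ∀ p, h p ∈ Icc k l → ∃ b, p = σ b (h p)
  disjoint : ∀ c ∈ Ioo k l, σ false c ≠ σ true c

namespace IsHeight

variable {h : G.Point → ℝ}

/-- Consecutive knots are joined by two strands. -/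
theorem exists_isStrandPair (hh : IsHeight h) (hfin : G.LocallyFinite) (hdc : G.DoublyConnected)
    {k l : ℝ} (hk : k ∈ knots h) (hl : l ∈ knots h) (hkl : k < l)
    (hcons : ∀ m ∈ knots h, m ∉ Ioo k l) : ∃ σ, IsStrandPair h k l σ := by
  have := t2Space_of_locallyFinite hfin
  obtain ⟨p, hpk, hpu⟩ := hk
  obtain ⟨q, hql, hqu⟩ := hl
  have hpq : p ≠ q := fun h1 => hkl.ne (by rw [← hpk, ← hql, h1])
  obtain ⟨γ₁, γ₂, hp⟩ := hdc.exists_isPathPair hpq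
  have hFfin := hp.fin.image h
  set F := h '' (γ₁ '' Icc 0 1 ∩ γ₂ '' Icc 0 1) with hF
  -- a path of a pair between the two knots is a strand
  have key : ∀ γ δ : ℝ → G.Point, IsPathPair γ δ p q → ∃ σ : ℝ → G.Point,
      ContinuousOn σ (Icc k l) ∧ (∀ c ∈ Icc k l, h (σ c) = c) ∧
      (∀ u ∈ Icc (0 : ℝ) 1, γ u = σ (h (γ u))) ∧ (∀ c ∈ Icc k l, σ c ∈ γ '' Icc 0 1) := by
    intro γ δ hp
    have hrange : ∀ γ : ℝ → G.Point, Continuous γ → InjOn γ (Icc 0 1) → γ 0 = p → γ 1 = q →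
        ∀ u ∈ Icc (0 : ℝ) 1, h (γ u) ∈ Icc k l := by
      intro γ hγ hinj h0 h1 u hu
      constructor
      · by_contra! hlt
        obtain ⟨v, hv, hvk⟩ := hh.exists_eq_of_mem_uIcc hγ (a := u) (b := 1) (c := k)
          (min_le_of_left_le hlt.le) (le_max_of_le_right (by rw [h1, hql]; exact hkl.le)) hu.2
        have hv0 : v = 0 := hinj ⟨hu.1.trans hv.1, hv.2⟩ ⟨le_rfl, zero_le_one⟩
          ((hpu _ hvk).trans h0.symm)
        have hu0 : u = 0 := le_antisymm (hv0 ▸ hv.1) hu.1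
        rw [hu0, h0, hpk] at hlt
        exact hlt.false
      · by_contra! hlt
        obtain ⟨v, hv, hvl⟩ := hh.exists_eq_of_mem_uIcc hγ (a := 0) (b := u) (c := l)
          (min_le_of_left_le (by rw [h0, hpk]; exact hkl.le)) (le_max_of_le_right hlt.le) hu.1
        have hv1 : v = 1 := hinj ⟨hv.1, hv.2.trans hu.2⟩ ⟨zero_le_one, le_rfl⟩
          ((hqu _ hvl).trans h1.symm)
        have hu1 : u = 1 := le_antisymm hu.2 (hv1 ▸ hv.2)
        rw [hu1, h1, hql] at hlt
        exact hlt.false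
    have hγr := hrange γ hp.cont₁ hp.inj₁ hp.zero₁ hp.one₁
    have once : ∀ c ∈ thinLevels h, c ∉ h '' (γ '' Icc 0 1 ∩ δ '' Icc 0 1) → c ∈ Ioo k l →
        ∀ u ∈ Icc (0 : ℝ) 1, ∀ v ∈ Icc (0 : ℝ) 1, h (γ u) = c → h (γ v) = c → u = v := by
      intro c hc hcF hckl u hu v hv huc hvc
      obtain ⟨w, hw, hwc⟩ := hh.exists_eq_of_mem_uIcc hp.cont₂ (a := 0) (b := 1) (c := c)
        (min_le_of_left_le (by rw [hp.zero₂, hpk]; exact hckl.1.le))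
        (le_max_of_le_right (by rw [hp.one₂, hql]; exact hckl.2.le)) zero_le_one
      exact eq_of_pathPair hp hc hcF hu hv hw huc hvc hwc
    have nodrop : ∀ u ∈ Icc (0 : ℝ) 1, ∀ v ∈ Icc (0 : ℝ) 1, u < v → ¬ h (γ v) < h (γ u) := by
      intro u hu v hv huv hlt
      obtain ⟨c, hc1, hc2, hcD, hcF⟩ := hh.exists_thinLevel hlt (hp.fin.image h)
      obtain ⟨u1, hu1, hu1'⟩ := hh.exists_eq_of_mem_uIcc hp.cont₁ (a := 0) (b := u) (c := c)
        (min_le_of_left_le (by rw [hp.zero₁, hpk]; exact (hγr v hv).1.trans hc1.le))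
        (le_max_of_le_right hc2.le) hu.1
      obtain ⟨u2, hu2, hu2'⟩ := hh.exists_eq_of_mem_uIcc hp.cont₁ (a := u) (b := v) (c := c)
        (min_le_of_right_le hc1.le) (le_max_of_le_left hc2.le) huv.le
      have heq := once c hcD hcF ⟨(hγr v hv).1.trans_lt hc1, hc2.trans_le (hγr u hu).2⟩
        u1 ⟨hu1.1, hu1.2.trans hu.2⟩ u2 ⟨hu.1.trans hu2.1, hu2.2.trans hv.2⟩ hu1' hu2'
      have : u1 = u := le_antisymm hu1.2 (heq ▸ hu2.1)
      rw [this] at hu1'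
      exact hc2.ne hu1'.symm
    have hmono : ∀ u ∈ Icc (0 : ℝ) 1, ∀ v ∈ Icc (0 : ℝ) 1, u < v → h (γ u) < h (γ v) := by
      intro u hu v hv huv
      refine lt_of_le_of_ne (not_lt.1 (nodrop u hu v hv huv)) fun heq => ?_
      obtain ⟨w, hw, hwne⟩ := hh.exists_ne_of_curve hfin hp.cont₁ huv.le
        (fun h1 => huv.ne (hp.inj₁ hu hv h1)) (h (γ u))
      have hw01 : w ∈ Icc (0 : ℝ) 1 := ⟨hu.1.trans hw.1, hw.2.trans hv.2⟩
      rcases lt_or_gt_of_ne hwne with h1 | h1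
      · refine nodrop u hu w hw01 (lt_of_le_of_ne hw.1 ?_) h1
        rintro rfl
        exact h1.false
      · refine nodrop w hw01 v hv (lt_of_le_of_ne hw.2 ?_) (heq ▸ h1)
        rintro rfl
        exact h1.ne heq
    let φ : Icc (0 : ℝ) 1 → Icc k l := fun u => ⟨h (γ u), hγr u u.2⟩
    have hφ : StrictMono φ := fun u v huv => hmono u u.2 v v.2 huv
    have hφs : Function.Surjective φ := by
      rintro ⟨c, hc⟩
      obtain ⟨u, hu, huc⟩ := hh.exists_eq_of_mem_uIcc hp.cont₁ (a := 0) (b := 1) (c := c)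
        (min_le_of_left_le (by rw [hp.zero₁, hpk]; exact hc.1))
        (le_max_of_le_right (by rw [hp.one₁, hql]; exact hc.2)) zero_le_one
      exact ⟨⟨u, hu⟩, Subtype.ext huc⟩
    let Φ := hφ.orderIsoOfSurjective φ hφs
    have hσ : ∀ c (hc : c ∈ Icc k l),
        IccExtend hkl.le (fun c => γ (Φ.symm c)) c = γ (Φ.symm ⟨c, hc⟩) :=
      fun c hc => IccExtend_of_mem _ _ hc
    refine ⟨IccExtend hkl.le fun c => γ (Φ.symm c), ?_, ?_, ?_, ?_⟩
    · exact ((hp.cont₁.comp continuous_subtype_val).comp Φ.symm.continuous).Icc_extend'.continuousOn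
    · intro c hc
      rw [hσ c hc]
      exact congrArg Subtype.val (Φ.apply_symm_apply ⟨c, hc⟩)
    · intro u hu
      rw [hσ _ (hγr u hu)]
      have : Φ.symm ⟨h (γ u), hγr u hu⟩ = ⟨u, hu⟩ := Φ.symm_apply_apply ⟨u, hu⟩
      rw [this]
    · intro c hc
      rw [hσ c hc]
      exact ⟨_, (Φ.symm ⟨c, hc⟩).2, rfl⟩
  obtain ⟨σ₁, hc₁, hs₁, hγ₁, hm₁⟩ := key γ₁ γ₂ hp
  obtain ⟨σ₂, hc₂, hs₂, hγ₂, hm₂⟩ := key γ₂ γ₁ hp.symm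
  have hunion : ∀ r, h r ∈ Ioo k l → r = σ₁ (h r) ∨ r = σ₂ (h r) := by
    intro r hr
    have hclosed : IsClosed (γ₁ '' Icc 0 1 ∪ γ₂ '' Icc 0 1) :=
      (isCompact_Icc.image hp.cont₁).isClosed.union (isCompact_Icc.image hp.cont₂).isClosed
    have hr' : r ∈ γ₁ '' Icc 0 1 ∪ γ₂ '' Icc 0 1 := by
      refine hh.mem_of_isClosed hclosed hFfin (fun r hr hrD hrF => ?_) hr
      have hm1 := hm₁ _ (Ioo_subset_Icc_self hr)
      have hm2 := hm₂ _ (Ioo_subset_Icc_self hr)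
      rcases hrD _ _ r (hs₁ _ (Ioo_subset_Icc_self hr)) (hs₂ _ (Ioo_subset_Icc_self hr)) rfl with
        h1 | h1 | h1
      · exact absurd ⟨_, ⟨hm1, h1 ▸ hm2⟩, hs₁ _ (Ioo_subset_Icc_self hr)⟩ hrF
      · exact Or.inr (h1 ▸ hm2)
      · exact Or.inl (h1 ▸ hm1)
    rcases hr' with ⟨u, hu, rfl⟩ | ⟨u, hu, rfl⟩
    · exact Or.inl (hγ₁ u hu)
    · exact Or.inr (hγ₂ u hu)
  refine ⟨fun b => if b then σ₂ else σ₁, ?_, ?_, ?_, ?_⟩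
  · rintro (_ | _)
    · simpa using hc₁
    · simpa using hc₂
  · rintro (_ | _)
    · simpa using hs₁
    · simpa using hs₂
  · intro r hr
    rcases eq_or_lt_of_le hr.1 with h1 | h1
    · refine ⟨false, ?_⟩
      simp only [Bool.false_eq_true, if_false]
      rw [hpu r h1.symm, hpk]
      exact (hpu _ (hs₁ k ⟨le_rfl, hkl.le⟩)).symm
    rcases eq_or_lt_of_le hr.2 with h2 | h2
    · refine ⟨false, ?_⟩
      simp only [Bool.false_eq_true, if_false]
      rw [hqu r h2, hql]
      exact (hqu _ (hs₁ l ⟨hkl.le, le_rfl⟩)).symm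
    rcases hunion r ⟨h1, h2⟩ with h3 | h3
    · exact ⟨false, by simpa using h3⟩
    · exact ⟨true, by simpa using h3⟩
  · intro c hc heq
    simp only [Bool.false_eq_true, if_false, if_true] at heq
    have hc' := Ioo_subset_Icc_self hc
    refine hcons c ⟨σ₁ c, hs₁ c hc', fun r hr => ?_⟩ hc
    rcases hunion r (by rw [hr]; exact hc) with h3 | h3
    · rw [h3, hr]
    · rw [h3, hr, heq]

end IsHeight

namespace IsStrandPair

variable {h : G.Point → ℝ} {k l : ℝ} {σ : Bool → ℝ → G.Point}

/-- Near an interior point of a strand all points belong to this strand. -/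
theorem eventually_eq (hσ : IsStrandPair h k l σ) (hh : IsHeight h) (hfin : G.LocallyFinite)
    {b : Bool} {c : ℝ} (hc : c ∈ Ioo k l) :
    ∀ᶠ q in nhds (σ b c), h q ∈ Ioo k l ∧ q = σ b (h q) := by
  have := t2Space_of_locallyFinite hfin
  have hhc := hσ.section_eq b c (Ioo_subset_Icc_self hc)
  have hslab : ∀ᶠ q in nhds (σ b c), h q ∈ Ioo k l :=
    hh.lip.continuous.continuousAt.preimage_mem_nhds (by rw [hhc]; exact Ioo_mem_nhds hc.1 hc.2)
  have hne : σ b c ≠ σ (!b) c := by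
    cases b
    · exact hσ.disjoint c hc
    · exact (hσ.disjoint c hc).symm
  have hcont : ContinuousAt (fun q => σ (!b) (h q)) (σ b c) := by
    have h1 : ContinuousAt (σ (!b)) (h (σ b c)) := by
      rw [hhc]
      exact (hσ.cont (!b)).continuousAt (Icc_mem_nhds hc.1 hc.2)
    exact h1.comp hh.lip.continuous.continuousAt
  have hev : ∀ᶠ q in nhds (σ b c), q ≠ σ (!b) (h q) := by
    have := (continuousAt_id.prodMk hcont).eventually
      ((isClosed_diagonal (X := G.Point)).isOpen_compl.mem_nhds (x := (σ b c, σ (!b) (h (σ b c))))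
        (by rw [hhc]; exact hne))
    exact this
  filter_upwards [hslab, hev] with q hq1 hq2
  refine ⟨hq1, ?_⟩
  obtain ⟨b', hb'⟩ := hσ.cover q (Ioo_subset_Icc_self hq1)
  rcases eq_or_ne b' b with rfl | hbb
  · exact hb'
  · rw [Bool.eq_not.2 hbb] at hb'
    exact absurd hb' hq2

/-- The strands do not stretch distances. -/
theorem edist_le (hσ : IsStrandPair h k l σ) (hh : IsHeight h) (hfin : G.LocallyFinite)
    (hkl : k < l) (b : Bool) {s t : ℝ} (hs : s ∈ Icc k l) (ht : t ∈ Icc k l) :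
    edist (σ b s) (σ b t) ≤ edist s t := by
  have hloc : ∀ s ∈ Ioo k l, ∀ᶠ t in nhds s, edist (σ b s) (σ b t) ≤ edist s t := by
    intro c hc
    obtain ⟨r, hr, hstar⟩ := exists_star (σ b c) (finite_reps hfin _)
    obtain ⟨ε, hε, hball⟩ := EMetric.mem_nhds_iff.1 (hσ.eventually_eq hh hfin (b := b) hc)
    have hcont : ContinuousAt (σ b) c := (hσ.cont b).continuousAt (Icc_mem_nhds hc.1 hc.2)
    have hnear : ∀ᶠ t in nhds c, σ b t ∈ Metric.eball (σ b c) (min r ε) :=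
      hcont.eventually (Metric.eball_mem_nhds _ (lt_min hr hε))
    filter_upwards [hnear, Ioo_mem_nhds hc.1 hc.2] with t ht htkl
    rw [Metric.mem_eball, edist_comm] at ht
    obtain ⟨e, u, v, h1, h2, h3⟩ := hstar _ (ht.trans_le (min_le_left _ _))
    -- the height is injective on the segment of the edge that leads to the nearby point
    have hstrand : ∀ w : Icc (0 : ℝ) (G.length e), (w : ℝ) ∈ uIcc (u : ℝ) v →
        G.pt e w = σ b (h (G.pt e w)) := by
      intro w hw
      have hd : edist (σ b c) (G.pt e w) < ε := by
        rw [← h1]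
        refine (edist_pt_le e u w).trans_lt (lt_of_le_of_lt ?_ (ht.trans_le (min_le_right _ _)))
        rw [← h3, edist_dist, edist_dist]
        exact ENNReal.ofReal_le_ofReal (Real.dist_left_le_of_mem_uIcc hw)
      exact (hball (by rw [Metric.mem_eball, edist_comm]; exact hd)).2
    have hinj : InjOn (onEdge h e) (uIcc (u : ℝ) v) := by
      intro w hw z hz hwz
      have hsub : uIcc (u : ℝ) v ⊆ Icc 0 (G.length e) := uIcc_subset_Icc u.2 v.2
      rw [onEdge_of_mem h e (hsub hw), onEdge_of_mem h e (hsub hz)] at hwz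
      have hpt : G.pt e ⟨w, hsub hw⟩ = G.pt e ⟨z, hsub hz⟩ := by
        rw [hstrand ⟨w, hsub hw⟩ hw, hstrand ⟨z, hsub hz⟩ hz, hwz]
      by_contra hne
      -- otherwise the segment is a whole edge with both ends at the same point
      have hends : ∀ w z : Icc (0 : ℝ) (G.length e), G.pt e w = G.pt e z → w ≠ z →
          (w : ℝ) = 0 ∨ (w : ℝ) = G.length e := by
        intro w z hpt hne
        by_contra! hcon
        have := eq_of_pt_eq_pt_of_interior hpt (lt_of_le_of_ne w.2.1 hcon.1.symm)
          (lt_of_le_of_ne w.2.2 hcon.2)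
        cases this
        exact hne rfl
      have hwz' : (⟨w, hsub hw⟩ : Icc (0 : ℝ) (G.length e)) ≠ ⟨z, hsub hz⟩ :=
        fun h1 => hne (congrArg Subtype.val h1)
      have e1 := hends _ _ hpt hwz'
      have e2 := hends _ _ hpt.symm hwz'.symm
      have hp0 := G.length_pos e
      have hcase : ((u : ℝ) = w ∧ (v : ℝ) = z) ∨ ((u : ℝ) = z ∧ (v : ℝ) = w) := by
        dsimp only at e1 e2
        have hu := u.2
        have hv := v.2
        rw [mem_uIcc] at hw hz
        rcases e1 with e1 | e1 <;> rcases e2 with e2 | e2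
        · exact absurd (e1.trans e2.symm) hne
        · rcases hw with hw | hw <;> rcases hz with hz | hz
          · left; constructor <;> linarith [hu.1, hu.2, hv.1, hv.2]
          · exfalso; linarith [hu.1, hu.2, hv.1, hv.2]
          · exfalso; linarith [hu.1, hu.2, hv.1, hv.2]
          · right; constructor <;> linarith [hu.1, hu.2, hv.1, hv.2]
        · rcases hw with hw | hw <;> rcases hz with hz | hz
          · right; constructor <;> linarith [hu.1, hu.2, hv.1, hv.2]
          · exfalso; linarith [hu.1, hu.2, hv.1, hv.2]
          · exfalso; linarith [hu.1, hu.2, hv.1, hv.2]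
          · left; constructor <;> linarith [hu.1, hu.2, hv.1, hv.2]
        · exact absurd (e1.trans e2.symm) hne
      have huv : G.pt e u = G.pt e v := by
        rcases hcase with ⟨h4, h5⟩ | ⟨h4, h5⟩
        · rw [show u = ⟨w, hsub hw⟩ from Subtype.ext h4, show v = ⟨z, hsub hz⟩ from Subtype.ext h5,
            hpt]
        · rw [show u = ⟨z, hsub hz⟩ from Subtype.ext h4, show v = ⟨w, hsub hw⟩ from Subtype.ext h5,
            hpt]
      have hzero : edist u v = 0 := by
        rw [h3, ← h1, ← h2, huv, edist_self]
      have huv' := edist_eq_zero.1 hzero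
      rcases hcase with ⟨h4, h5⟩ | ⟨h4, h5⟩
      · exact hne (by rw [← h4, ← h5, huv'])
      · exact hne (by rw [← h4, ← h5, huv'])
    have hiso := hh.iso e u u.2 v v.2 hinj
    rw [onEdge_coe, onEdge_coe, h1, h2, hσ.section_eq b c (Ioo_subset_Icc_self hc),
      hσ.section_eq b t (Ioo_subset_Icc_self htkl)] at hiso
    rw [← h3, edist_dist, edist_dist, Subtype.dist_eq, Real.dist_eq, Real.dist_eq,
      abs_sub_comm c, hiso, abs_sub_comm (u : ℝ)]
  have hin : ∀ s ∈ Ioo k l, ∀ t ∈ Ioo k l, edist (σ b s) (σ b t) ≤ edist s t := by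
    intro s hs t ht
    have hsub : uIcc s t ⊆ Ioo k l := by
      intro u hu
      rw [mem_uIcc] at hu
      rcases hu with hu | hu
      · exact ⟨hs.1.trans_le hu.1, hu.2.trans_lt ht.2⟩
      · exact ⟨ht.1.trans_le hu.1, hu.2.trans_lt hs.2⟩
    exact edist_le_of_local (a := min s t) (b := max s t)
      (fun u hu => (hloc u (hsub hu)).filter_mono nhdsWithin_le_nhds)
      left_mem_uIcc right_mem_uIcc
  -- the bound extends to the ends by continuity
  have hcl : ∀ x ∈ Icc k l ×ˢ Icc k l, edist (σ b x.1) (σ b x.2) ≤ edist x.1 x.2 := by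
    have hdense : closure (Ioo k l ×ˢ Ioo k l) = Icc k l ×ˢ Icc k l := by
      rw [closure_prod_eq, closure_Ioo hkl.ne]
    intro x hx
    rw [← hdense] at hx
    refine le_on_closure (s := Ioo k l ×ˢ Ioo k l) (f := fun x => edist (σ b x.1) (σ b x.2))
      (g := fun x => edist x.1 x.2) (fun y hy => hin _ hy.1 _ hy.2) ?_ ?_ hx
    · rw [hdense]
      exact continuous_edist.comp_continuousOn
        (((hσ.cont b).comp continuousOn_fst fun y hy => hy.1).prodMk
          ((hσ.cont b).comp continuousOn_snd fun y hy => hy.2))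
    · exact continuous_edist.continuousOn
  exact hcl (s, t) ⟨hs, ht⟩

end IsStrandPair

end Strands

end MetricGraph

/-! ### From heights to necklaces -/

/-- A set of reals with finitely many elements between any two of its elements is enumerated in
increasing order by an interval of integers. -/
theorem exists_strictMonoOn_enumeration (K : Set ℝ) (hne : K.Nonempty)
    (hK : ∀ a ∈ K, ∀ b ∈ K, (K ∩ Icc a b).Finite) :
    ∃ (T : Set ℤ) (κ : ℤ → ℝ), T.OrdConnected ∧ StrictMonoOn κ T ∧ (∀ i ∈ T, κ i ∈ K) ∧
      ∀ k ∈ K, ∃ i ∈ T, κ i = k := by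
  classical
  obtain ⟨k₀, hk₀⟩ := hne
  have hfin : ∀ a b : K, (Icc a b).Finite := by
    intro a b
    refine Set.Finite.of_finite_image ((hK a a.2 b b.2).subset ?_) Subtype.val_injective.injOn
    rintro _ ⟨c, hc, rfl⟩
    exact ⟨c.2, hc.1, hc.2⟩
  let _ : LocallyFiniteOrder K := LocallyFiniteOrder.ofFiniteIcc hfin
  let _ : SuccOrder K := LinearLocallyFiniteOrder.succOrder K
  let _ : PredOrder K := LinearLocallyFiniteOrder.predOrder K
  let o : K := ⟨k₀, hk₀⟩
  have : Nonempty K := ⟨o⟩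
  have hsucc : ∀ c : K, ¬ IsMax c → toZ o (Order.succ c) = toZ o c + 1 := by
    intro c hc
    apply le_antisymm
    · rcases le_or_gt o c with h | h
      · have h1 := iterate_succ_toZ c h
        have h2 := toZ_iterate_succ_le (i0 := o) ((toZ o c).toNat + 1)
        rw [Function.iterate_succ', Function.comp_apply, h1] at h2
        have h3 := toZ_nonneg h
        push_cast at h2
        rwa [Int.toNat_of_nonneg h3] at h2
      · have h1 := iterate_pred_toZ c h
        have h3 := toZ_neg h
        obtain ⟨n, hn⟩ : ∃ n : ℕ, (-toZ o c).toNat = n + 1 := by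
          refine ⟨(-toZ o c).toNat - 1, ?_⟩
          omega
        rw [hn, Function.iterate_succ', Function.comp_apply] at h1
        have hmin : ¬ IsMin (Order.pred^[n] o) := by
          intro hmin
          rw [hmin.pred_eq] at h1
          have := toZ_iterate_pred_ge (i0 := o) n
          rw [h1] at this
          omega
        have h2 := toZ_iterate_pred_of_not_isMin n hmin
        rw [← h1, Order.succ_pred_of_not_isMin hmin, h2, h1]
        omega
    · exact toZ_strictMono (Order.lt_succ_of_not_isMax hc)
  refine ⟨range (toZ o), fun i => (Function.invFun (toZ o) i : K), ?_, ?_, ?_, ?_⟩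
  · refine ⟨?_⟩
    rintro _ ⟨a, rfl⟩ _ ⟨b, rfl⟩ n ⟨han, hnb⟩
    induction n, han using Int.leInduction with
    | base => exact ⟨a, rfl⟩
    | succ n han ih =>
      obtain ⟨c, rfl⟩ := ih (by omega)
      refine ⟨Order.succ c, hsucc c fun hmax => ?_⟩
      have h1 : c < b := (toZ_lt_toZ (i0 := o)).1 (by omega)
      exact hmax.not_lt h1
  · rintro _ ⟨a, rfl⟩ _ ⟨b, rfl⟩ hab
    have h1 := Function.leftInverse_invFun (injective_toZ (i0 := o))
    change ((Function.invFun (toZ o) (toZ o a) : K) : ℝ) < (Function.invFun (toZ o) (toZ o b) : K)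
    rw [h1, h1]
    have h2 : a < b := (toZ_lt_toZ (i0 := o)).1 hab
    exact h2
  · exact fun i _ => Subtype.prop _
  · intro k hk
    refine ⟨toZ o ⟨k, hk⟩, mem_range_self _, ?_⟩
    have h1 := Function.leftInverse_invFun (injective_toZ (i0 := o))
    change ((Function.invFun (toZ o) (toZ o ⟨k, hk⟩) : K) : ℝ) = k
    rw [h1]

namespace MetricGraph

section NecklaceOfHeight

variable {E : Type*} {G : MetricGraph E} {h : G.Point → ℝ}

namespace IsHeight

theorem exists_ne (hh : IsHeight h) (e : E) : ∃ p q, h p < h q := by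
  have hl := G.length_pos e
  by_contra! hcon
  have heq : ∀ p q, h p = h q := fun p q => le_antisymm (hcon q p) (hcon p q)
  have hsub : Icc 0 (G.length e) ⊆ Icc 0 (G.length e) ∩ onEdge h e ⁻¹' {onEdge h e 0} :=
    fun t ht => ⟨ht, heq _ _⟩
  have := measure_mono_null hsub (hh.null e _)
  simp [Real.volume_Icc, hl.not_ge] at this

/-- Every level lies between two different knots. -/
theorem exists_knots (hh : IsHeight h) (hfin : G.LocallyFinite) (hdc : G.DoublyConnected) (e : E)
    (p : G.Point) : ∃ k ∈ knots h, ∃ l ∈ knots h, k < l ∧ k ≤ h p ∧ h p ≤ l := by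
  have hdich : ∀ p, h p ∈ knots h ∨ ∃ k ∈ knots h, ∃ l ∈ knots h, k < h p ∧ h p < l := by
    intro p
    by_cases hp : h p ∈ knots h
    · exact Or.inl hp
    · right
      obtain ⟨q, hq, hqp⟩ : ∃ q, h q = h p ∧ q ≠ p := by
        by_contra! hcon
        exact hp ⟨p, rfl, hcon⟩
      obtain ⟨k, hk, hk'⟩ := hh.exists_knot_below hfin hdc hqp.symm hq.symm
      obtain ⟨l, hl, hl'⟩ := hh.exists_knot_above hfin hdc hqp.symm hq.symm
      exact ⟨k, hk, l, hl, hk', hl'⟩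
  obtain ⟨a, b, hab⟩ := hh.exists_ne e
  rcases hdich p with hp | ⟨k, hk, l, hl, h1, h2⟩
  swap
  · exact ⟨k, hk, l, hl, h1.trans h2, h1.le, h2.le⟩
  obtain ⟨q, hq⟩ : ∃ q, h q ≠ h p := by
    by_contra! hcon
    exact hab.ne ((hcon a).trans (hcon b).symm)
  obtain ⟨m, hm, hmp⟩ : ∃ m ∈ knots h, m ≠ h p := by
    rcases hdich q with hq' | ⟨k, hk, l, hl, h1, h2⟩
    · exact ⟨_, hq', hq⟩
    · by_cases hkp : k = h p
      · exact ⟨l, hl, fun h3 => (h1.trans h2).ne (hkp.trans h3.symm)⟩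
      · exact ⟨k, hk, hkp⟩
  rcases lt_or_gt_of_ne hmp with h1 | h1
  · exact ⟨m, hm, _, hp, h1, h1.le, le_rfl⟩
  · exact ⟨_, hp, m, hm, h1, le_rfl, h1.le⟩

/-- A doubly connected graph with a height function is a symmetric necklace: the knots are the
vertices of the necklace, and the strands are its edges. -/
theorem isSymmetricNecklace (hh : IsHeight h) (hfin : G.LocallyFinite) (hdc : G.DoublyConnected)
    (e₀ : E) : G.IsSymmetricNecklace := by
  classical
  have hKfin : ∀ a ∈ knots h, ∀ b ∈ knots h, (knots h ∩ Icc a b).Finite := by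
    rintro _ ⟨p, rfl, -⟩ _ ⟨q, rfl, -⟩
    exact hh.finite_knots_inter_Icc hdc p q
  have hKne : (knots h).Nonempty := by
    obtain ⟨p, -⟩ := hh.exists_ne e₀
    obtain ⟨k, hk, -⟩ := hh.exists_knots hfin hdc e₀ p
    exact ⟨k, hk⟩
  obtain ⟨T, κ, hT, hκ, hκK, hκs⟩ := exists_strictMonoOn_enumeration _ hKne hKfin
  have hlt : ∀ {i j}, i ∈ T → j ∈ T → κ i < κ j → i < j := fun hi hj hij =>
    (hκ.lt_iff_lt hi hj).1 hij
  let I : Set ℤ := {i | i ∈ T ∧ i + 1 ∈ T}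
  have hIpos : ∀ i : I, 0 < κ (i + 1) - κ i := fun i => sub_pos.2 (hκ i.2.1 i.2.2 (by omega))
  have hloc : ∀ p, ∃ i : I, h p ∈ Icc (κ i) (κ (i + 1)) := by
    intro p
    obtain ⟨k, hk, l, hl, hkl, h1, h2⟩ := hh.exists_knots hfin hdc e₀ p
    obtain ⟨i, hi, rfl⟩ := hκs k hk
    obtain ⟨j, hj, rfl⟩ := hκs l hl
    have hij := hlt hi hj hkl
    obtain ⟨m, ⟨hm1, hm2, hm3⟩, hmax⟩ := Int.exists_greatest_of_bdd
      (P := fun m => i ≤ m ∧ m < j ∧ κ m ≤ h p) ⟨j, fun z hz => hz.2.1.le⟩ ⟨i, le_rfl, hij, h1⟩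
    have hmT : m ∈ T := hT.out hi hj ⟨hm1, hm2.le⟩
    have hmT' : m + 1 ∈ T := hT.out hi hj ⟨by omega, by omega⟩
    refine ⟨⟨m, hmT, hmT'⟩, hm3, ?_⟩
    by_contra! hcon
    have hmj : m + 1 < j := by
      refine lt_of_le_of_ne (by omega) fun h3 => ?_
      dsimp only at hcon
      rw [h3] at hcon
      exact hcon.not_ge h2
    have := hmax (m + 1) ⟨by omega, hmj, hcon.le⟩
    omega
  have hstrands : ∀ i : I, ∃ σ, IsStrandPair h (κ i) (κ (i + 1)) σ := by
    intro i
    refine hh.exists_isStrandPair hfin hdc (hκK _ i.2.1) (hκK _ i.2.2) (sub_pos.1 (hIpos i)) ?_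
    rintro m hm ⟨h1, h2⟩
    obtain ⟨j, hj, rfl⟩ := hκs m hm
    have := hlt i.2.1 hj h1
    have := hlt hj i.2.2 h2
    omega
  choose σ hσ using hstrands
  let N : MetricGraph (I × Bool) := necklace I (fun i => κ (i + 1) - κ i) hIpos
  have hκt : ∀ (i : I) (b : Bool) (t : Icc (0 : ℝ) (N.length (i, b))),
      κ i + t ∈ Icc (κ i) (κ (i + 1)) := by
    intro i b t
    have h1 : (t : ℝ) ≤ κ (i + 1) - κ i := t.2.2
    exact ⟨by linarith [t.2.1], by linarith⟩
  let f : N.EdgeSpace → G.Point := fun x => σ x.1.1 x.1.2 (κ x.1.1 + x.2)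
  have hf : ∀ x, h (f x) = κ x.1.1 + x.2 := fun x =>
    (hσ x.1.1).section_eq _ _ (hκt x.1.1 x.1.2 x.2)
  -- a knot has a single point
  have huniq : ∀ {i p q}, i ∈ T → h p = κ i → h q = κ i → p = q := by
    intro i p q hi hp hq
    obtain ⟨r, -, hr⟩ := hκK i hi
    rw [hr p hp, hr q hq]
  have hend : ∀ a : (I × Bool) × Bool,
      (a.1.1 : ℤ) + (if a.2 then 1 else 0) ∈ T ∧
      h (f (N.endpoint a)) = κ ((a.1.1 : ℤ) + if a.2 then 1 else 0) := by
    rintro ⟨⟨i, b⟩, _ | _⟩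
    · refine ⟨by simpa using i.2.1, ?_⟩
      rw [hf]
      simp [MetricGraph.endpoint]
    · refine ⟨by simpa using i.2.2, ?_⟩
      rw [hf]
      simp [MetricGraph.endpoint, N, necklace]
  have hglue : ∀ x y, N.pointSetoid x y → f x = f y := by
    rintro x y (rfl | ⟨a, b, rfl, rfl, hab⟩)
    · rfl
    · have hab' : (a.1.1 : ℤ) + (if a.2 then 1 else 0) = (b.1.1 : ℤ) + if b.2 then 1 else 0 := hab
      refine huniq (hend a).1 (hend a).2 ?_
      rw [hab']
      exact (hend b).2
  let Ψ : N.Point → G.Point := Quotient.lift f hglue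
  have hΨ : ∀ i b t, Ψ (N.pt (i, b) t) = σ i b (κ i + t) := fun i b t => rfl
  have hinj : Function.Injective Ψ := by
    have hle : ∀ (i j : I) (b b' : Bool) (t : Icc (0 : ℝ) (N.length (i, b)))
        (t' : Icc (0 : ℝ) (N.length (j, b'))), (i : ℤ) ≤ j →
        f ⟨(i, b), t⟩ = f ⟨(j, b'), t'⟩ → N.pt (i, b) t = N.pt (j, b') t' := by
      intro i j b b' t t' hij heq
      have hlev : κ i + t = κ j + t' := by rw [← hf ⟨(i, b), t⟩, heq, hf]
      have ht0 := t.2.1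
      have ht0' := t'.2.1
      have ht : (t : ℝ) ≤ κ (i + 1) - κ i := t.2.2
      have ht' : (t' : ℝ) ≤ κ (j + 1) - κ j := t'.2.2
      rcases eq_or_lt_of_le hij with hij' | hij'
      · obtain rfl : i = j := Subtype.ext hij'
        have htt : (t : ℝ) = t' := by linarith
        by_cases hbb : b = b'
        · subst hbb
          rw [Subtype.ext htt]
        · rcases eq_or_lt_of_le ht0 with h1 | h1
          · refine Quotient.sound (Or.inr ⟨((i, b), false), ((i, b'), false), ?_, ?_, ?_⟩)
            · rw [show t = ⟨0, le_rfl, (N.length_pos _).le⟩ from Subtype.ext h1.symm]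
              rfl
            · rw [show t' = ⟨0, le_rfl, (N.length_pos _).le⟩ from
                Subtype.ext (htt.symm.trans h1.symm)]
              rfl
            · rfl
          rcases eq_or_lt_of_le ht with h2 | h2
          · refine Quotient.sound (Or.inr ⟨((i, b), true), ((i, b'), true), ?_, ?_, ?_⟩)
            · rw [show t = ⟨N.length (i, b), (N.length_pos _).le, le_rfl⟩ from Subtype.ext h2]
              rfl
            · rw [show t' = ⟨N.length (i, b'), (N.length_pos _).le, le_rfl⟩ from
                Subtype.ext (htt.symm.trans h2)]
              rfl
            · rfl
          have hdisj := (hσ i).disjoint (κ i + t) ⟨by linarith, by linarith⟩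
          have heq' : σ i b (κ i + t) = σ i b' (κ i + t) := by
            refine Eq.trans heq ?_
            change σ i b' (κ i + t') = _
            rw [htt]
          cases b <;> cases b'
          · exact absurd rfl hbb
          · exact absurd heq' hdisj
          · exact absurd heq'.symm hdisj
          · exact absurd rfl hbb
      · have hmono : κ (i + 1) ≤ κ j := (hκ.le_iff_le i.2.2 j.2.1).2 (by omega)
        have hκeq : κ (i + 1) = κ j := by linarith
        have hij2 : (i : ℤ) + 1 = j := hκ.injOn i.2.2 j.2.1 hκeq
        have h2 : (t : ℝ) = κ (i + 1) - κ i := by linarith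
        have h1 : (t' : ℝ) = 0 := by linarith
        refine Quotient.sound (Or.inr ⟨((i, b), true), ((j, b'), false), ?_, ?_, ?_⟩)
        · rw [show t = ⟨N.length (i, b), (N.length_pos _).le, le_rfl⟩ from Subtype.ext h2]
          rfl
        · rw [show t' = ⟨0, le_rfl, (N.length_pos _).le⟩ from Subtype.ext h1]
          rfl
        · change (i : ℤ) + (if true then 1 else 0) = (j : ℤ) + if false then 1 else 0
          simpa using hij2
    intro x y hxy
    obtain ⟨⟨i, b⟩, t, rfl⟩ := exists_pt_eq x
    obtain ⟨⟨j, b'⟩, t', rfl⟩ := exists_pt_eq y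
    rcases le_total (i : ℤ) j with hij | hij
    · exact hle i j b b' t t' hij hxy
    · exact (hle j i b' b t' t hij hxy.symm).symm
  have hrep : ∀ (i : I) (b : Bool) (q : G.Point), h q ∈ Icc (κ i) (κ (i + 1)) →
      q = σ i b (h q) → ∃ t : Icc (0 : ℝ) (N.length (i, b)),
        Ψ (N.pt (i, b) t) = q ∧ (t : ℝ) = h q - κ i := by
    intro i b q hq hqσ
    refine ⟨⟨h q - κ i, by linarith [hq.1], by
      change h q - κ i ≤ κ (i + 1) - κ i
      linarith [hq.2]⟩, ?_, rfl⟩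
    rw [hΨ]
    simp only [add_sub_cancel]
    exact hqσ.symm
  have hsurj : Function.Surjective Ψ := by
    intro q
    obtain ⟨i, hi⟩ := hloc q
    obtain ⟨b, hb⟩ := (hσ i).cover q hi
    obtain ⟨t, ht, -⟩ := hrep i b q hi hb
    exact ⟨_, ht⟩
  let Φ : N.Point ≃ G.Point := Equiv.ofBijective Ψ ⟨hinj, hsurj⟩
  have hΨlip : LipschitzWith 1 Ψ := by
    refine lipschitzWith_one_of_edges ?_
    rintro ⟨i, b⟩ s t
    rw [hΨ, hΨ]
    refine ((hσ i).edist_le hh hfin (sub_pos.1 (hIpos i)) b (hκt i b s) (hκt i b t)).trans ?_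
    rw [edist_add_left]
    exact le_rfl
  -- on each strand the inverse does not stretch the distances of the levels
  have hsame : ∀ (i : I) (b : Bool) (p q : G.Point), h p ∈ Icc (κ i) (κ (i + 1)) →
      h q ∈ Icc (κ i) (κ (i + 1)) → p = σ i b (h p) → q = σ i b (h q) →
      edist (Φ.symm p) (Φ.symm q) ≤ edist (h p) (h q) := by
    intro i b p q hp hq hpσ hqσ
    obtain ⟨s, hs, hs'⟩ := hrep i b p hp hpσ
    obtain ⟨t, ht, ht'⟩ := hrep i b q hq hqσ
    have h1 : Φ.symm p = N.pt (i, b) s := by rw [Equiv.symm_apply_eq]; exact hs.symm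
    have h2 : Φ.symm q = N.pt (i, b) t := by rw [Equiv.symm_apply_eq]; exact ht.symm
    rw [h1, h2]
    refine (edist_pt_le _ s t).trans (le_of_eq ?_)
    rw [Subtype.edist_eq, hs', ht', edist_sub_right]
  have hnear : ∀ p, ∀ᶠ q in nhds p, edist (Φ.symm p) (Φ.symm q) ≤ edist (h p) (h q) := by
    intro p
    by_cases hp : h p ∈ knots h
    · obtain ⟨m, hm, hmp⟩ := hκs _ hp
      have hhc : ContinuousAt h p := hh.lip.continuous.continuousAt
      have hup : ∀ᶠ q in nhds p, m + 1 ∈ T → h q < κ (m + 1) := by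
        by_cases hmT : m + 1 ∈ T
        · have : h p < κ (m + 1) := by rw [← hmp]; exact hκ hm hmT (by omega)
          filter_upwards [hhc.eventually (gt_mem_nhds this)] with q hq _ using hq
        · exact Filter.Eventually.of_forall fun q h1 => absurd h1 hmT
      have hdown : ∀ᶠ q in nhds p, m - 1 ∈ T → κ (m - 1) < h q := by
        by_cases hmT : m - 1 ∈ T
        · have : κ (m - 1) < h p := by rw [← hmp]; exact hκ hmT hm (by omega)
          filter_upwards [hhc.eventually (lt_mem_nhds this)] with q hq _ using hq
        · exact Filter.Eventually.of_forall fun q h1 => absurd h1 hmT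
      filter_upwards [hup, hdown] with q hq1 hq2
      obtain ⟨i, hi⟩ := hloc q
      obtain ⟨b, hb⟩ := (hσ i).cover q hi
      have hi1 : (i : ℤ) ≤ m := by
        by_contra! hcon
        have hmT : m + 1 ∈ T := hT.out hm i.2.1 ⟨by omega, by omega⟩
        have := (hκ.le_iff_le hmT i.2.1).2 (by omega)
        linarith [hq1 hmT, hi.1]
      have hi2 : m ≤ (i : ℤ) + 1 := by
        by_contra! hcon
        have hmT : m - 1 ∈ T := hT.out i.2.2 hm ⟨by omega, by omega⟩
        have := (hκ.le_iff_le i.2.2 hmT).2 (by omega)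
        linarith [hq2 hmT, hi.2]
      have hmi : h p ∈ Icc (κ i) (κ (i + 1)) := by
        rw [← hmp]
        exact ⟨(hκ.le_iff_le i.2.1 hm).2 hi1, (hκ.le_iff_le hm i.2.2).2 hi2⟩
      refine hsame i b p q hmi hi ?_ hb
      exact huniq hm hmp.symm (((hσ i).section_eq b _ hmi).trans hmp.symm)
    · obtain ⟨i, hi⟩ := hloc p
      obtain ⟨b, hb⟩ := (hσ i).cover p hi
      have hi' : h p ∈ Ioo (κ i) (κ (i + 1)) := by
        refine ⟨lt_of_le_of_ne hi.1 fun h1 => hp ?_, lt_of_le_of_ne hi.2 fun h1 => hp ?_⟩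
        · rw [← h1]; exact hκK _ i.2.1
        · rw [h1]; exact hκK _ i.2.2
      have hev := (hσ i).eventually_eq hh hfin (b := b) hi'
      rw [← hb] at hev
      filter_upwards [hev] with q hq
      exact hsame i b p q hi (Ioo_subset_Icc_self hq.1) hb hq.2
  have hΘlip : LipschitzWith 1 Φ.symm := by
    refine lipschitzWith_one_of_edges fun e s t => ?_
    have hl := (G.length_pos e).le
    let π : ℝ → G.Point := IccExtend hl (G.pt e)
    have hπ : ∀ u (hu : u ∈ Icc 0 (G.length e)), π u = G.pt e ⟨u, hu⟩ := fun u hu =>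
      IccExtend_of_mem _ _ hu
    have hπc : Continuous π := (continuous_pt e).Icc_extend'
    have := edist_le_of_local (γ := fun u => Φ.symm (π u)) (a := 0) (b := G.length e) ?_ s.2 t.2
    · rw [hπ s s.2, hπ t t.2] at this
      exact this
    · intro u hu
      have h1 := hπc.continuousAt.eventually (hnear (π u))
      filter_upwards [h1.filter_mono nhdsWithin_le_nhds, self_mem_nhdsWithin] with v hv hv'
      refine hv.trans ?_
      have h2 := hh.lip (π u) (π v)
      rw [ENNReal.coe_one, one_mul] at h2
      refine h2.trans ?_
      rw [hπ u hu, hπ v hv']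
      exact edist_pt_le e _ _
  have hiso : Isometry Φ := by
    intro x y
    apply le_antisymm
    · have := hΨlip x y
      rwa [ENNReal.coe_one, one_mul] at this
    · have := hΘlip (Φ x) (Φ y)
      simpa using this
  refine ⟨I, fun i => κ (i + 1) - κ i, hIpos, ?_, ?_, ⟨(⟨Φ, hiso⟩ : N.Point ≃ᵢ G.Point).symm⟩⟩
  · obtain ⟨p, -⟩ := hh.exists_ne e₀
    obtain ⟨i, -⟩ := hloc p
    exact ⟨i, i.2⟩
  · refine ⟨fun i hi j hj m hm => ⟨hT.out hi.1 hj.1 hm, hT.out hi.2 hj.2 ⟨?_, ?_⟩⟩⟩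
    · linarith [hm.1]
    · linarith [hm.2]

end IsHeight

end NecklaceOfHeight

end MetricGraph

/-! ### The coarea inequality on an interval -/

/-- An increasing reparametrisation with density `ρ` turns the measure with density `ρ` into
Lebesgue measure. -/
theorem volume_image_primitive {ρ : ℝ → ℝ} (hρ : ∀ a b, IntervalIntegrable ρ volume a b)
    {ε : ℝ} (hε : 0 < ε) (hρε : ∀ t, ε ≤ ρ t) {B : Set ℝ} (hB : MeasurableSet B) :
    volume ((fun t => ∫ s in (0 : ℝ)..t, ρ s) '' B) = ∫⁻ s in B, ENNReal.ofReal (ρ s) := by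
  set v : ℝ → ℝ := fun t => ∫ s in (0 : ℝ)..t, ρ s with hv
  have hvc : Continuous v := intervalIntegral.continuous_primitive hρ 0
  have hvsub : ∀ s t, v t - v s = ∫ r in s..t, ρ r := fun s t =>
    intervalIntegral.integral_interval_sub_left (hρ _ _) (hρ _ _)
  have hgrow : ∀ s t, s ≤ t → ε * (t - s) ≤ v t - v s := by
    intro s t hst
    rw [hvsub]
    have := intervalIntegral.integral_mono_on hst (f := fun _ => ε) (g := ρ)
      intervalIntegrable_const (hρ s t) (fun r _ => hρε r)
    simpa [mul_comm] using this
  have hmono : StrictMono v := fun s t hst => by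
    have := hgrow s t hst.le
    have : 0 < ε * (t - s) := mul_pos hε (sub_pos.2 hst)
    linarith
  have hv0 : v 0 = 0 := by simp [hv]
  have hsurj : Function.Surjective v := by
    intro c
    have h1 : v (-(|c| / ε)) ≤ c := by
      have := hgrow (-(|c| / ε)) 0 (by simp; positivity)
      have h2 : ε * (0 - -(|c| / ε)) = |c| := by field_simp; ring
      rw [h2, hv0] at this
      linarith [neg_abs_le c]
    have h2 : c ≤ v (|c| / ε) := by
      have := hgrow 0 (|c| / ε) (by positivity)
      have h2 : ε * (|c| / ε - 0) = |c| := by field_simp; ring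
      rw [h2, hv0] at this
      linarith [le_abs_self c]
    exact mem_range_of_exists_le_of_exists_ge hvc ⟨_, h1⟩ ⟨_, h2⟩
  have hmap : (volume : Measure ℝ) =
      (volume.withDensity fun s => ENNReal.ofReal (ρ s)).map v := by
    refine Real.measure_ext_Ioo_rat fun a b => ?_
    obtain ⟨s, hs⟩ := hsurj a
    obtain ⟨t, ht⟩ := hsurj b
    rw [← hs, ← ht, Measure.map_apply hvc.measurable measurableSet_Ioo]
    have hpre : v ⁻¹' Ioo (v s) (v t) = Ioo s t := by
      ext r
      simp [hmono.lt_iff_lt]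
    rw [hpre, withDensity_apply _ measurableSet_Ioo, Real.volume_Ioo, hvsub]
    rcases le_or_gt s t with hst | hst
    · rw [intervalIntegral.integral_of_le hst, integral_Ioc_eq_integral_Ioo,
        ofReal_integral_eq_lintegral_ofReal]
      · exact ((hρ s t).1).mono_set Ioo_subset_Ioc_self
      · exact Filter.Eventually.of_forall fun r => (hε.le.trans (hρε r))
    · rw [Ioo_eq_empty (not_lt.2 hst.le), ← hvsub, ENNReal.ofReal_of_nonpos]
      · simp
      · linarith [hmono hst]
  have hBm : MeasurableSet (v '' B) :=
    hB.image_of_continuousOn_injOn hvc.continuousOn hmono.injective.injOn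
  rw [show volume (v '' B) = _ from congrArg (fun m : Measure ℝ => m (v '' B)) hmap,
    Measure.map_apply hvc.measurable hBm, preimage_image_eq _ hmono.injective,
    withDensity_apply _ hB]

/-- An absolutely continuous function does not enlarge sets beyond the integral of its slope. -/
theorem AbsolutelyContinuousOnInterval.volume_image_le {F : ℝ → ℝ} {l : ℝ} (hl : 0 ≤ l)
    (hF : AbsolutelyContinuousOnInterval F 0 l) {B : Set ℝ} (hB : MeasurableSet B)
    (hBl : B ⊆ Icc 0 l) : volume (F '' B) ≤ ∫⁻ s in B, ‖deriv F s‖ₑ := by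
  have hint := hF.intervalIntegrable_deriv
  -- the slope, cut off outside the interval
  let ρ₀ : ℝ → ℝ := (Icc 0 l).indicator fun s => |deriv F s|
  have hρ₀ : Integrable ρ₀ := by
    refine IntegrableOn.integrable_indicator ?_ measurableSet_Icc
    rw [integrableOn_Icc_iff_integrableOn_Ioc]
    exact hint.1.abs
  have hρ₀nn : ∀ s, 0 ≤ ρ₀ s := fun s => indicator_nonneg (fun _ _ => abs_nonneg _) s
  have key : ∀ ε : ℝ, 0 < ε → volume (F '' B) ≤
      (∫⁻ s in B, ‖deriv F s‖ₑ) + ENNReal.ofReal ε * volume (Icc 0 l) := by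
    intro ε hε
    have hρ : ∀ a b, IntervalIntegrable (fun s => ρ₀ s + ε) volume a b := fun a b =>
      hρ₀.intervalIntegrable.add intervalIntegrable_const
    set v : ℝ → ℝ := fun t => ∫ s in (0 : ℝ)..t, (ρ₀ s + ε) with hv
    have hvsub : ∀ s t, v t - v s = ∫ r in s..t, (ρ₀ r + ε) := fun s t =>
      intervalIntegral.integral_interval_sub_left (hρ _ _) (hρ _ _)
    have hle : ∀ s ∈ Icc 0 l, ∀ t ∈ Icc 0 l, s ≤ t → |F t - F s| ≤ v t - v s := by
      intro s hs t ht hst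
      have hsub : uIcc s t ⊆ uIcc 0 l := by
        rw [uIcc_of_le hst, uIcc_of_le hl]
        exact Icc_subset_Icc hs.1 ht.2
      have hFst := hF.mono hsub
      rw [← hFst.integral_deriv_eq_sub, hvsub]
      refine (intervalIntegral.abs_integral_le_integral_abs hst).trans ?_
      refine intervalIntegral.integral_mono_on hst hFst.intervalIntegrable_deriv.abs (hρ s t) ?_
      intro r hr
      have : ρ₀ r = |deriv F r| := indicator_of_mem
        (show r ∈ Icc 0 l from ⟨hs.1.trans hr.1, hr.2.trans ht.2⟩) _
      linarith
    have hle' : ∀ s ∈ Icc 0 l, ∀ t ∈ Icc 0 l, |F s - F t| ≤ |v s - v t| := by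
      intro s hs t ht
      rcases le_total s t with h | h
      · rw [abs_sub_comm, abs_sub_comm (v s)]
        exact (hle s hs t ht h).trans (le_abs_self _)
      · exact (hle t ht s hs h).trans (le_abs_self _)
    -- `F` factors through the reparametrisation by a map that stretches no distances
    obtain ⟨ψ, hψ⟩ : ∃ ψ : ℝ → ℝ, ∀ s ∈ B, ψ (v s) = F s := by
      refine ⟨fun c => F (Function.invFunOn v B c), fun s hs => ?_⟩
      have h1 := Function.invFunOn_mem (f := v) (mem_image_of_mem v hs)
      have h2 := Function.invFunOn_eq (f := v) (mem_image_of_mem v hs)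
      have h3 := hle' _ (hBl h1) _ (hBl hs)
      rw [h2, sub_self, abs_zero] at h3
      have := abs_nonpos_iff.1 h3
      exact sub_eq_zero.1 this
    have hψlip : LipschitzOnWith 1 ψ (v '' B) := by
      rintro _ ⟨s, hs, rfl⟩ _ ⟨t, ht, rfl⟩
      rw [hψ s hs, hψ t ht, ENNReal.coe_one, one_mul, edist_dist, edist_dist, Real.dist_eq,
        Real.dist_eq]
      exact ENNReal.ofReal_le_ofReal (hle' s (hBl hs) t (hBl ht))
    have him : F '' B = ψ '' (v '' B) := by
      rw [image_image]
      exact image_congr fun s hs => (hψ s hs).symm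
    have h1 := hψlip.hausdorffMeasure_image_le zero_le_one
    rw [hausdorffMeasure_real, ← him, hv, volume_image_primitive hρ hε
      (fun t => by linarith [hρ₀nn t]) hB] at h1
    simp only [ENNReal.coe_one, ENNReal.one_rpow, one_mul] at h1
    refine h1.trans ?_
    calc ∫⁻ s in B, ENNReal.ofReal (ρ₀ s + ε)
        = ∫⁻ s in B, (‖deriv F s‖ₑ + ENNReal.ofReal ε) := by
          refine setLIntegral_congr_fun hB fun s hs => ?_
          have : ρ₀ s = |deriv F s| := indicator_of_mem (hBl hs) _
          rw [this, ENNReal.ofReal_add (abs_nonneg _) hε.le, ← Real.enorm_eq_ofReal_abs]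
      _ = (∫⁻ s in B, ‖deriv F s‖ₑ) + ENNReal.ofReal ε * volume B := by
          rw [lintegral_add_right _ measurable_const, setLIntegral_const]
      _ ≤ _ := by gcongr
  refine ge_of_tendsto (x := nhdsWithin 0 (Ioi 0))
    (f := fun ε => (∫⁻ s in B, ‖deriv F s‖ₑ) + ENNReal.ofReal ε * volume (Icc 0 l)) ?_
    (by filter_upwards [self_mem_nhdsWithin] with ε hε using key ε hε)
  have h1 : Filter.Tendsto (fun ε : ℝ => ENNReal.ofReal ε * volume (Icc 0 l))
      (nhdsWithin 0 (Ioi 0)) (nhds (0 * volume (Icc 0 l))) := by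
    refine ENNReal.Tendsto.mul_const ?_ (Or.inr (by simp [Real.volume_Icc]))
    have := (ENNReal.continuous_ofReal.tendsto 0).mono_left
      (nhdsWithin_le_nhds (s := Ioi (0 : ℝ)))
    simpa using this
  simpa using tendsto_const_nhds.add h1

/-- The coarea inequality on an interval. -/
theorem AbsolutelyContinuousOnInterval.lintegral_image_le {F : ℝ → ℝ} {l : ℝ} (hl : 0 ≤ l)
    (hF : AbsolutelyContinuousOnInterval F 0 l) (hFc : Continuous F) {A : Set ℝ}
    (hA : MeasurableSet A) (hAl : A ⊆ Icc 0 l) {w : ℝ → ℝ≥0∞} (hw : Measurable w) :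
    ∫⁻ c in F '' A, w c ≤ ∫⁻ s in A, w (F s) * ‖deriv F s‖ₑ := by
  have hmeas : (volume.restrict (F '' A) : Measure ℝ) ≤
      ((volume.restrict A).withDensity fun s => ‖deriv F s‖ₑ).map F := by
    refine Measure.le_iff.2 fun S hS => ?_
    have hpre : MeasurableSet (F ⁻¹' S) := hFc.measurable hS
    rw [Measure.restrict_apply hS, Measure.map_apply hFc.measurable hS, withDensity_apply _ hpre,
      Measure.restrict_restrict hpre, inter_comm S, ← image_inter_preimage, inter_comm (F ⁻¹' S)]
    exact hF.volume_image_le hl (hA.inter hpre) (inter_subset_left.trans hAl)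
  refine (lintegral_mono' hmeas le_rfl).trans ?_
  rw [lintegral_map hw hFc.measurable, lintegral_withDensity_eq_lintegral_mul _
    (measurable_deriv F).enorm
    (show Measurable fun s => w (F s) from hw.comp hFc.measurable)]
  refine le_of_eq (lintegral_congr fun s => ?_)
  simp [mul_comm]

namespace MetricGraph

/-! ### Integration over a metric graph and the coarea inequality -/

section Measure

variable {E : Type*} (G : MetricGraph E)

/-- The length measure of a metric graph, on the disjoint union of real lines that carry the
coordinates of the edges. -/
noncomputable def lengthMeasure : Measure (Σ _ : E, ℝ) :=
  Measure.sum fun e => (volume.restrict (Ioc 0 (G.length e))).map (Sigma.mk e)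

variable {G}

/-- A function on the graph, in the coordinates of the edges. -/
noncomputable def val (f : G.Point → ℝ) (x : Σ _ : E, ℝ) : ℝ := onEdge f x.1 x.2

/-- The edgewise derivative of a function on the graph, in the coordinates of the edges. -/
noncomputable def der (f : G.Point → ℝ) (x : Σ _ : E, ℝ) : ℝ := edgeDeriv f x.1 x.2

theorem measurable_sigma_iff {Y : Type*} [MeasurableSpace Y] {f : (Σ _ : E, ℝ) → Y} :
    Measurable f ↔ ∀ e, Measurable fun t => f ⟨e, t⟩ := by
  constructor
  · intro hf e S hS
    have := hf hS
    rw [Sigma.instMeasurableSpace, MeasurableSpace.measurableSet_iInf] at this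
    exact this e
  · intro hf S hS
    rw [Sigma.instMeasurableSpace, MeasurableSpace.measurableSet_iInf]
    exact fun e => hf e hS

theorem measurable_mk (e : E) : Measurable (@Sigma.mk E (fun _ => ℝ) e) :=
  measurable_sigma_iff.1 measurable_id e

theorem measurable_val {f : G.Point → ℝ} (hf : Continuous f) : Measurable (val f) :=
  measurable_sigma_iff.2 fun e => (continuous_onEdge hf e).measurable

theorem measurable_der (f : G.Point → ℝ) : Measurable (der f) :=
  measurable_sigma_iff.2 fun e => measurable_deriv (onEdge f e)

theorem measurableEmbedding_mk (e : E) : MeasurableEmbedding (@Sigma.mk E (fun _ => ℝ) e) where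
  injective := sigma_mk_injective
  measurable := measurable_mk e
  measurableSet_image' := by
    intro S hS
    rw [Sigma.instMeasurableSpace, MeasurableSpace.measurableSet_iInf]
    intro e'
    change MeasurableSet (@Sigma.mk E (fun _ => ℝ) e' ⁻¹' (@Sigma.mk E (fun _ => ℝ) e '' S))
    by_cases h : e' = e
    · subst h
      rwa [preimage_image_eq _ sigma_mk_injective]
    · rw [preimage_image_sigmaMk_of_ne h]
      exact MeasurableSet.empty

theorem lintegral_lengthMeasure (g : (Σ _ : E, ℝ) → ℝ≥0∞) :
    ∫⁻ x, g x ∂G.lengthMeasure = ∑' e, ∫⁻ t in Ioc 0 (G.length e), g ⟨e, t⟩ := by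
  rw [lengthMeasure, lintegral_sum_measure]
  exact tsum_congr fun e => (measurableEmbedding_mk e).lintegral_map _

theorem ae_lengthMeasure_iff [Countable E] {p : (Σ _ : E, ℝ) → Prop} :
    (∀ᵐ x ∂G.lengthMeasure, p x) ↔
      ∀ e, ∀ᵐ t ∂(volume.restrict (Ioc 0 (G.length e))), p ⟨e, t⟩ := by
  rw [lengthMeasure, Measure.ae_sum_iff]
  exact forall_congr' fun e => (measurableEmbedding_mk e).ae_map_iff

/-- The number of pieces of the subdivision of the edges at mesh `1 / n` on which the function `f`
takes the value `c`. -/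
noncomputable def pieceCount (f : G.Point → ℝ) (n : ℕ) (c : ℝ) : ℝ≥0∞ :=
  ∑' x : E × ℤ, (onEdge f x.1 '' (Icc 0 (G.length x.1) ∩ {s | ⌊n * s⌋ = x.2})).indicator 1 c

/-- The number of representatives of the points of the level `c`, obtained by counting the pieces of
finer and finer subdivisions. -/
noncomputable def crossings (f : G.Point → ℝ) (c : ℝ) : ℝ≥0∞ :=
  Filter.liminf (fun n => pieceCount f n c) Filter.atTop

theorem ordConnected_piece (l : ℝ) (n : ℕ) (j : ℤ) :
    (Icc 0 l ∩ {s : ℝ | ⌊n * s⌋ = j}).OrdConnected := by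
  refine ordConnected_Icc.inter ⟨?_⟩
  rintro a ha b hb s ⟨h1, h2⟩
  have h3 : ⌊(n : ℝ) * a⌋ ≤ ⌊(n : ℝ) * s⌋ := Int.floor_mono (by gcongr)
  have h4 : ⌊(n : ℝ) * s⌋ ≤ ⌊(n : ℝ) * b⌋ := Int.floor_mono (by gcongr)
  change ⌊(n : ℝ) * a⌋ = j at ha
  change ⌊(n : ℝ) * b⌋ = j at hb
  change ⌊(n : ℝ) * s⌋ = j
  omega

theorem measurable_pieceCount [Countable E] {f : G.Point → ℝ} (hf : Continuous f) (n : ℕ) :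
    Measurable (pieceCount f n) := by
  refine Measurable.tsum fun x => measurable_one.indicator ?_
  exact (((ordConnected_piece _ n x.2).isPreconnected.image _
    (continuous_onEdge hf x.1).continuousOn).ordConnected).measurableSet

theorem measurable_crossings [Countable E] {f : G.Point → ℝ} (hf : Continuous f) :
    Measurable (crossings f) :=
  Measurable.liminf fun n => measurable_pieceCount hf n

/-- The coarea inequality on a metric graph. -/
theorem lintegral_crossings_le [Countable E] {f : G.Point → ℝ} (hf : Continuous f)
    (hac : ∀ e, AbsolutelyContinuousOnInterval (onEdge f e) 0 (G.length e)) {w : ℝ → ℝ≥0∞}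
    (hw : Measurable w) :
    ∫⁻ c, w c * crossings f c ≤ ∫⁻ x, w (val f x) * ‖der f x‖ₑ ∂G.lengthMeasure := by
  have hpiece : ∀ n, ∫⁻ c, w c * pieceCount f n c ≤
      ∫⁻ x, w (val f x) * ‖der f x‖ₑ ∂G.lengthMeasure := by
    intro n
    have hm : ∀ (e : E) (j : ℤ), MeasurableSet (Icc 0 (G.length e) ∩ {s : ℝ | ⌊n * s⌋ = j}) :=
      fun e j => (ordConnected_piece _ n j).measurableSet
    have hmi : ∀ x : E × ℤ, MeasurableSet
        (onEdge f x.1 '' (Icc 0 (G.length x.1) ∩ {s | ⌊n * s⌋ = x.2})) := fun x =>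
      (((ordConnected_piece _ n x.2).isPreconnected.image _
        (continuous_onEdge hf x.1).continuousOn).ordConnected).measurableSet
    calc ∫⁻ c, w c * pieceCount f n c
        = ∑' x : E × ℤ, ∫⁻ c in onEdge f x.1 '' (Icc 0 (G.length x.1) ∩ {s | ⌊n * s⌋ = x.2}),
            w c := by
          simp_rw [pieceCount, ← ENNReal.tsum_mul_left]
          rw [lintegral_tsum (f := fun (x : E × ℤ) c => w c * (onEdge f x.1 ''
            (Icc 0 (G.length x.1) ∩ {s | ⌊n * s⌋ = x.2})).indicator 1 c)
            fun x => (hw.mul (measurable_one.indicator (hmi x))).aemeasurable]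
          refine tsum_congr fun x => ?_
          rw [← lintegral_indicator (hmi x)]
          refine lintegral_congr fun c => ?_
          by_cases hc : c ∈ onEdge f x.1 '' (Icc 0 (G.length x.1) ∩ {s | ⌊n * s⌋ = x.2})
          · simp [indicator_of_mem hc]
          · simp [indicator_of_notMem hc]
      _ ≤ ∑' x : E × ℤ, ∫⁻ s in Icc 0 (G.length x.1) ∩ {s | ⌊n * s⌋ = x.2},
            w (onEdge f x.1 s) * ‖edgeDeriv f x.1 s‖ₑ :=
          ENNReal.tsum_le_tsum fun x => (hac x.1).lintegral_image_le (G.length_pos x.1).le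
            (continuous_onEdge hf x.1) (hm x.1 x.2) inter_subset_left hw
      _ = ∫⁻ x, w (val f x) * ‖der f x‖ₑ ∂G.lengthMeasure := by
          rw [lintegral_lengthMeasure, ENNReal.tsum_prod (f := fun e j =>
            ∫⁻ s in Icc 0 (G.length e) ∩ {s | ⌊n * s⌋ = j},
              w (onEdge f e s) * ‖edgeDeriv f e s‖ₑ)]
          refine tsum_congr fun e => ?_
          rw [← lintegral_iUnion (hm e)]
          · rw [← inter_iUnion]
            have : (⋃ j : ℤ, {s : ℝ | ⌊n * s⌋ = j}) = univ :=
              eq_univ_of_forall fun s => mem_iUnion.2 ⟨_, rfl⟩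
            rw [this, inter_univ]
            exact setLIntegral_congr Ioc_ae_eq_Icc.symm
          · intro i j hij
            refine Set.disjoint_left.2 fun s hs hs' => hij ?_
            exact hs.2.symm.trans hs'.2
  calc ∫⁻ c, w c * crossings f c
      ≤ ∫⁻ c, Filter.liminf (fun n => w c * pieceCount f n c) Filter.atTop := by
        refine lintegral_mono fun c => ?_
        have := ENNReal.le_liminf_mul (f := Filter.atTop) (u := fun _ : ℕ => w c)
          (v := fun n => pieceCount f n c)
        rwa [Filter.liminf_const] at this
    _ ≤ Filter.liminf (fun n => ∫⁻ c, w c * pieceCount f n c) Filter.atTop :=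
        lintegral_liminf_le fun n => hw.mul (measurable_pieceCount hf n)
    _ ≤ _ := Filter.liminf_le_of_le (by isBoundedDefault) fun b hb => by
        obtain ⟨n, hn⟩ := hb.exists
        exact hn.trans (hpiece n)

/-- Different representatives of points at the level `c` are all counted. -/
theorem card_le_crossings {f : G.Point → ℝ} {c : ℝ} (R : Finset G.EdgeSpace)
    (hR : ∀ x ∈ R, f (G.pt x.1 x.2) = c) : (R.card : ℝ≥0∞) ≤ crossings f c := by
  classical
  refine Filter.le_liminf_of_le (by isBoundedDefault) ?_
  -- a fine subdivision separates the representatives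
  have hsep : ∀ᶠ n : ℕ in Filter.atTop, ∀ x ∈ R, ∀ y ∈ R,
      (x.1, ⌊n * (x.2 : ℝ)⌋) = (y.1, ⌊n * (y.2 : ℝ)⌋) → x = y := by
    refine (Filter.eventually_all_finset R).2 fun x _ => (Filter.eventually_all_finset R).2
      fun y _ => ?_
    by_cases hxy : x = y
    · exact Filter.Eventually.of_forall fun _ _ => hxy
    obtain ⟨e, s⟩ := x
    obtain ⟨e', t⟩ := y
    by_cases hee : e = e'
    · subst hee
      have hst : (s : ℝ) ≠ t := fun h => hxy (by rw [Subtype.ext h])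
      have hpos : 0 < |(s : ℝ) - t| := abs_pos.2 (sub_ne_zero.2 hst)
      obtain ⟨m, hm⟩ := exists_nat_gt (1 / |(s : ℝ) - t|)
      filter_upwards [Filter.eventually_ge_atTop m] with n hn heq
      exfalso
      have h1 : ⌊(n : ℝ) * s⌋ = ⌊(n : ℝ) * t⌋ := congrArg Prod.snd heq
      have h2 := Int.abs_sub_lt_one_of_floor_eq_floor h1
      rw [← mul_sub, abs_mul, Nat.abs_cast] at h2
      have h3 : 1 < m * |(s : ℝ) - t| := (div_lt_iff₀ hpos).1 hm
      have h4 : (m : ℝ) * |(s : ℝ) - t| ≤ n * |(s : ℝ) - t| := by gcongr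
      linarith
    · exact Filter.Eventually.of_forall fun n heq => absurd (congrArg Prod.fst heq) hee
  filter_upwards [hsep] with n hn
  let φ : G.EdgeSpace → E × ℤ := fun x => (x.1, ⌊n * (x.2 : ℝ)⌋)
  have hcard : (R.image φ).card = R.card := Finset.card_image_of_injOn fun x hx y hy => hn x hx y hy
  calc (R.card : ℝ≥0∞) = ∑ _y ∈ R.image φ, 1 := by simp [hcard]
    _ ≤ ∑ y ∈ R.image φ,
          (onEdge f y.1 '' (Icc 0 (G.length y.1) ∩ {s | ⌊n * s⌋ = y.2})).indicator 1 c := by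
        refine Finset.sum_le_sum fun y hy => ?_
        obtain ⟨x, hx, rfl⟩ := Finset.mem_image.1 hy
        rw [indicator_of_mem]
        · rfl
        · exact ⟨x.2, ⟨x.2.2, rfl⟩, by rw [onEdge_coe]; exact hR x hx⟩
    _ ≤ pieceCount f n c := ENNReal.sum_le_tsum _

/-- A continuous function on a doubly connected graph takes almost every value between two of its
values at least twice. -/
theorem two_le_crossings (hdc : G.DoublyConnected) {f : G.Point → ℝ} (hf : Continuous f)
    (x y : G.Point) : ∀ᵐ c : ℝ, c ∈ Ioo (f x) (f y) → 2 ≤ crossings f c := by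
  classical
  by_cases hxy : x = y
  · subst hxy
    simp
  obtain ⟨γ, δ, hp⟩ := hdc.exists_isPathPair hxy
  have hnull : ∀ᵐ c : ℝ, c ∉ f '' (γ '' Icc 0 1 ∩ δ '' Icc 0 1) :=
    (hp.fin.image f).countable.ae_notMem _
  filter_upwards [hnull] with c hc hcxy
  obtain ⟨u, hu, huc⟩ := intermediate_value_Icc zero_le_one (hf.comp hp.cont₁).continuousOn
    (show c ∈ Icc _ _ from ⟨by simpa [hp.zero₁] using hcxy.1.le, by simpa [hp.one₁] using hcxy.2.le⟩)
  obtain ⟨v, hv, hvc⟩ := intermediate_value_Icc zero_le_one (hf.comp hp.cont₂).continuousOn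
    (show c ∈ Icc _ _ from ⟨by simpa [hp.zero₂] using hcxy.1.le, by simpa [hp.one₂] using hcxy.2.le⟩)
  have hne : γ u ≠ δ v := fun h1 => hc ⟨γ u, ⟨⟨u, hu, rfl⟩, ⟨v, hv, h1.symm⟩⟩, huc⟩
  obtain ⟨e, s, hs⟩ := exists_pt_eq (γ u)
  obtain ⟨e', t, ht⟩ := exists_pt_eq (δ v)
  have hne' : (⟨e, s⟩ : G.EdgeSpace) ≠ ⟨e', t⟩ := by
    intro h1
    cases h1
    exact hne (hs.symm.trans ht)
  have := card_le_crossings (f := f) (c := c) {(⟨e, s⟩ : G.EdgeSpace), ⟨e', t⟩} (by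
    intro x hx
    rw [Finset.mem_insert, Finset.mem_singleton] at hx
    rcases hx with rfl | rfl
    · rw [hs]; exact huc
    · rw [ht]; exact hvc)
  rw [Finset.card_pair hne'] at this
  exact_mod_cast this

/-- A continuous function on a doubly connected graph takes almost every value between its extreme
values at least twice. -/
theorem ae_two_le_crossings (hdc : G.DoublyConnected) {f : G.Point → ℝ} (hf : Continuous f) :
    ∀ᵐ c : ℝ, (∃ x, f x < c) → (∃ y, c < f y) → 2 ≤ crossings f c := by
  classical
  have h1 : ∀ q r : ℚ, ∀ᵐ c : ℝ, (∃ x, f x < q) → (∃ y, r < f y) → (q : ℝ) < c → c < r →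
      2 ≤ crossings f c := by
    intro q r
    by_cases hx : ∃ x, f x < q
    · by_cases hy : ∃ y, r < f y
      · obtain ⟨x, hx⟩ := hx
        obtain ⟨y, hy⟩ := hy
        filter_upwards [two_le_crossings hdc hf x y] with c hc _ _ hq hr
        exact hc ⟨hx.trans hq, hr.trans hy⟩
      · exact Filter.Eventually.of_forall fun c _ h => absurd h hy
    · exact Filter.Eventually.of_forall fun c h => absurd h hx
  filter_upwards [ae_all_iff.2 fun q => ae_all_iff.2 (h1 q)] with c hc
  rintro ⟨x, hx⟩ ⟨y, hy⟩
  obtain ⟨q, hq, hq'⟩ := exists_rat_btwn hx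
  obtain ⟨r, hr, hr'⟩ := exists_rat_btwn hy
  exact hc q r ⟨x, hq⟩ ⟨y, hr'⟩ hq' hr

end Measure

end MetricGraph

/-! ### Wirtinger's inequality -/

section Wirtinger

variable {g : ℝ → ℝ} {C L : ℝ}

theorem abs_primitive_le (hg : ∀ s, |g s| ≤ C) (a b : ℝ) : |∫ s in a..b, g s| ≤ C * |b - a| := by
  have := intervalIntegral.norm_integral_le_of_norm_le_const (a := a) (b := b) (f := g) (C := C)
    (fun s _ => hg s)
  simpa using this

/-- Completing the square with the cotangent: on an interval inside `(0, L)` the defect in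
Wirtinger's inequality is the integral of a square plus boundary terms. -/
theorem integral_sq_sub_cot (hgi : ∀ a b, IntervalIntegrable g volume a b)
    (hg : ∀ s, |g s| ≤ C) (hL : 0 < L) {p q : ℝ} (hp : 0 < p) (hpq : p ≤ q) (hq : q < L) :
    IntervalIntegrable (fun s => (g s - Real.pi / L * (∫ r in (0 : ℝ)..s, g r) *
      (Real.cos (Real.pi / L * s) / Real.sin (Real.pi / L * s))) ^ 2) volume p q ∧
    ∫ s in p..q, (g s ^ 2 - (Real.pi / L) ^ 2 * (∫ r in (0 : ℝ)..s, g r) ^ 2) =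
    (∫ s in p..q, (g s - Real.pi / L * (∫ r in (0 : ℝ)..s, g r) *
      (Real.cos (Real.pi / L * s) / Real.sin (Real.pi / L * s))) ^ 2) +
    Real.pi / L * ((∫ r in (0 : ℝ)..q, g r) ^ 2 *
      (Real.cos (Real.pi / L * q) / Real.sin (Real.pi / L * q)) -
      (∫ r in (0 : ℝ)..p, g r) ^ 2 *
      (Real.cos (Real.pi / L * p) / Real.sin (Real.pi / L * p))) := by
  set a := Real.pi / L with ha
  have hapos : 0 < a := div_pos Real.pi_pos hL
  have haL : a * L = Real.pi := by rw [ha]; field_simp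
  set S : ℝ → ℝ := fun s => ∫ r in (0 : ℝ)..s, g r with hS
  set k : ℝ → ℝ := fun s => Real.cos (a * s) / Real.sin (a * s) with hk
  have hsin : ∀ s ∈ Icc p q, Real.sin (a * s) ≠ 0 := by
    intro s hs
    refine (Real.sin_pos_of_pos_of_lt_pi (mul_pos hapos (hp.trans_le hs.1)) ?_).ne'
    rw [← haL]
    exact mul_lt_mul_of_pos_left (hs.2.trans_lt hq) hapos
  have hu : uIcc p q = Icc p q := uIcc_of_le hpq
  have hSc : Continuous S := intervalIntegral.continuous_primitive hgi 0
  have hSac : AbsolutelyContinuousOnInterval S p q := by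
    have h1 : AbsolutelyContinuousOnInterval S 0 q :=
      (hgi 0 q).absolutelyContinuousOnInterval_intervalIntegral left_mem_uIcc
    refine h1.mono ?_
    rw [hu, uIcc_of_le (hp.le.trans hpq)]
    exact Icc_subset_Icc hp.le le_rfl
  have hkd : ∀ s ∈ Icc p q, HasDerivAt k (-a * (1 + k s ^ 2)) s := by
    intro s hs
    have h1 : HasDerivAt (fun s : ℝ => a * s) a s := by
      simpa using (hasDerivAt_id s).const_mul a
    have h2 := (h1.cos).div (h1.sin) (hsin s hs)
    refine h2.congr_deriv ?_
    have := hsin s hs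
    simp only [hk]
    field_simp
    ring
  have hkcd : ContDiffOn ℝ 1 k (uIcc p q) := by
    rw [hu]
    refine ContDiffOn.div ?_ ?_ hsin
    · exact (Real.contDiff_cos.comp (contDiff_const.mul contDiff_id)).contDiffOn
    · exact (Real.contDiff_sin.comp (contDiff_const.mul contDiff_id)).contDiffOn
  have hkac := hkcd.absolutelyContinuousOnInterval
  have hkc : ContinuousOn k (uIcc p q) := hkcd.continuousOn
  have hH := (hSac.mul hSac).mul hkac
  have hftc := hH.integral_deriv_eq_sub
  have hSd : ∀ᵐ s, s ∈ uIcc p q → HasDerivAt S (g s) s := by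
    filter_upwards [(hgi 0 q).ae_hasDerivAt_integral] with s hs hsm
    refine hs ?_ 0 left_mem_uIcc
    rw [hu] at hsm
    rw [uIcc_of_le (hp.le.trans hpq)]
    exact ⟨hp.le.trans hsm.1, hsm.2⟩
  have hderiv : ∀ᵐ s, s ∈ uIcc p q → deriv (S * S * k) s =
      2 * S s * g s * k s - a * S s ^ 2 * (1 + k s ^ 2) := by
    filter_upwards [hSd] with s hs hsm
    have h1 := ((hs hsm).mul (hs hsm)).mul (hkd s (hu ▸ hsm))
    rw [h1.deriv]
    simp only [Pi.mul_apply]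
    ring
  -- products of bounded functions are integrable
  have hgb : ∀ {φ : ℝ → ℝ}, ContinuousOn φ (uIcc p q) →
      IntervalIntegrable (fun s => g s * φ s) volume p q := fun hφ =>
    (hgi p q).mul_continuousOn hφ
  have hg2 : IntervalIntegrable (fun s => g s ^ 2) volume p q := by
    have h1 := (hgi p q).1
    refine ⟨?_, ?_⟩
    · refine (h1.bdd_mul (c := C) h1.aestronglyMeasurable
        (Filter.Eventually.of_forall fun s => by simpa using hg s)).congr ?_
      exact Filter.Eventually.of_forall fun s => (sq (g s)).symm
    · rw [Ioc_eq_empty (not_lt.2 hpq)]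
      exact integrableOn_empty
  have hcont1 : ContinuousOn (fun s => S s * k s) (uIcc p q) := hSc.continuousOn.mul hkc
  have hi1 : IntervalIntegrable (fun s => g s * (S s * k s)) volume p q := hgb hcont1
  have hi2 : IntervalIntegrable (fun s => (S s * k s) ^ 2) volume p q :=
    (hcont1.pow 2).intervalIntegrable
  have hi3 : IntervalIntegrable (fun s => S s ^ 2) volume p q :=
    (hSc.pow 2).intervalIntegrable _ _
  have hsq : ∀ s, (g s - a * S s * k s) ^ 2 =
      g s ^ 2 - 2 * a * (g s * (S s * k s)) + a ^ 2 * (S s * k s) ^ 2 := fun s => by ring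
  have hint : IntervalIntegrable (fun s => (g s - a * S s * k s) ^ 2) volume p q := by
    simp_rw [hsq]
    exact (hg2.sub (hi1.const_mul (2 * a))).add (hi2.const_mul (a ^ 2))
  refine ⟨hint, ?_⟩
  have hd : ∫ s in p..q, (2 * S s * g s * k s - a * S s ^ 2 * (1 + k s ^ 2)) =
      S q ^ 2 * k q - S p ^ 2 * k p := by
    rw [show S q ^ 2 * k q - S p ^ 2 * k p = (S * S * k) q - (S * S * k) p by
      simp only [Pi.mul_apply]; ring, ← hftc]
    refine intervalIntegral.integral_congr_ae ?_
    filter_upwards [hderiv] with s hs hsm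
    exact (hs (uIoc_subset_uIcc hsm)).symm
  have hdi : IntervalIntegrable (fun s => 2 * S s * g s * k s - a * S s ^ 2 * (1 + k s ^ 2))
      volume p q := by
    have : (fun s => 2 * S s * g s * k s - a * S s ^ 2 * (1 + k s ^ 2)) = fun s =>
        2 * (g s * (S s * k s)) - (a * S s ^ 2 + a * (S s * k s) ^ 2) := by
      funext s; ring
    rw [this]
    exact (hi1.const_mul 2).sub ((hi3.const_mul a).add (hi2.const_mul a))
  change ∫ s in p..q, (g s ^ 2 - a ^ 2 * S s ^ 2) =
    (∫ s in p..q, (g s - a * S s * k s) ^ 2) + a * (S q ^ 2 * k q - S p ^ 2 * k p)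
  rw [← hd, ← intervalIntegral.integral_const_mul, ← intervalIntegral.integral_add hint
    (hdi.const_mul a)]
  refine intervalIntegral.integral_congr fun s _ => ?_
  ring

theorem mul_cot_le_one {x : ℝ} (hx : 0 < x) (hx2 : x < Real.pi / 2) :
    x * (Real.cos x / Real.sin x) ≤ 1 := by
  have h1 := (Real.lt_tan hx hx2).le
  have hc : 0 < Real.cos x := Real.cos_pos_of_mem_Ioo ⟨by linarith, hx2⟩
  have hs : 0 < Real.sin x := Real.sin_pos_of_pos_of_lt_pi hx (by linarith [Real.pi_pos])
  rw [Real.tan_eq_sin_div_cos, le_div_iff₀ hc] at h1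
  rw [mul_div_assoc', div_le_one hs]
  exact h1

/-- Wirtinger's inequality for the primitive of a bounded function of mean zero, with the integral of
the completed square as a lower bound for the defect. -/
theorem integral_cot_sq_le (hgi : ∀ a b, IntervalIntegrable g volume a b)
    (hg : ∀ s, |g s| ≤ C) (hL : 0 < L) (h0 : ∫ s in (0 : ℝ)..L, g s = 0) {δ : ℝ} (hδ : 0 < δ)
    (hδL : δ < L / 2) :
    ∫ s in δ..(L - δ), (g s - Real.pi / L * (∫ r in (0 : ℝ)..s, g r) *
      (Real.cos (Real.pi / L * s) / Real.sin (Real.pi / L * s))) ^ 2 ≤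
    ∫ s in (0 : ℝ)..L, (g s ^ 2 - (Real.pi / L) ^ 2 * (∫ r in (0 : ℝ)..s, g r) ^ 2) := by
  have hapos : 0 < Real.pi / L := div_pos Real.pi_pos hL
  have hC : 0 ≤ C := (abs_nonneg _).trans (hg 0)
  have haL : Real.pi / L * L = Real.pi := by field_simp
  have hgisq : ∀ a b, IntervalIntegrable (fun s => g s ^ 2) volume a b := by
    intro a b
    constructor
    all_goals
      refine (Integrable.bdd_mul (c := C) (f := g) (g := g) ?_ ?_
        (Filter.Eventually.of_forall fun s => by simpa using hg s)).congr
        (Filter.Eventually.of_forall fun s => (sq (g s)).symm)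
    · exact (hgi a b).1
    · exact (hgi a b).1.aestronglyMeasurable
    · exact (hgi a b).2
    · exact (hgi a b).2.aestronglyMeasurable
  have hSc : Continuous fun s => ∫ r in (0 : ℝ)..s, g r := intervalIntegral.continuous_primitive hgi 0
  have hDi : ∀ a b, IntervalIntegrable
      (fun s => g s ^ 2 - (Real.pi / L) ^ 2 * (∫ r in (0 : ℝ)..s, g r) ^ 2) volume a b := fun a b =>
    (hgisq a b).sub (((hSc.pow 2).intervalIntegrable a b).const_mul _)
  have key : ∀ ε, 0 < ε → ε ≤ δ →
      ∫ s in δ..(L - δ), (g s - Real.pi / L * (∫ r in (0 : ℝ)..s, g r) *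
        (Real.cos (Real.pi / L * s) / Real.sin (Real.pi / L * s))) ^ 2 ≤
      (∫ s in ε..(L - ε), (g s ^ 2 - (Real.pi / L) ^ 2 * (∫ r in (0 : ℝ)..s, g r) ^ 2)) +
        2 * C ^ 2 * ε := by
    intro ε hε hεδ
    obtain ⟨hint, heq⟩ := integral_sq_sub_cot hgi hg hL hε (q := L - ε) (by linarith) (by linarith)
    have hmono : ∫ s in δ..(L - δ), (g s - Real.pi / L * (∫ r in (0 : ℝ)..s, g r) *
        (Real.cos (Real.pi / L * s) / Real.sin (Real.pi / L * s))) ^ 2 ≤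
        ∫ s in ε..(L - ε), (g s - Real.pi / L * (∫ r in (0 : ℝ)..s, g r) *
        (Real.cos (Real.pi / L * s) / Real.sin (Real.pi / L * s))) ^ 2 := by
      refine intervalIntegral.integral_mono_interval hεδ (by linarith) (by linarith) ?_ hint
      exact Filter.Eventually.of_forall fun s => sq_nonneg _
    -- the boundary terms are small, as the primitive vanishes linearly at both ends
    have hS1 : (∫ r in (0 : ℝ)..ε, g r) ^ 2 ≤ C ^ 2 * ε ^ 2 := by
      have := abs_primitive_le hg 0 ε
      rw [sub_zero, abs_of_pos hε] at this
      rw [← mul_pow, ← sq_abs]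
      exact pow_le_pow_left₀ (abs_nonneg _) this 2
    have hS2 : (∫ r in (0 : ℝ)..(L - ε), g r) ^ 2 ≤ C ^ 2 * ε ^ 2 := by
      have h1 := intervalIntegral.integral_add_adjacent_intervals (hgi 0 (L - ε)) (hgi (L - ε) L)
      have h2 := abs_primitive_le hg (L - ε) L
      rw [sub_sub_cancel, abs_of_pos hε] at h2
      have h3 : ∫ r in (0 : ℝ)..(L - ε), g r = -∫ r in (L - ε)..L, g r := by linarith
      rw [h3, neg_sq, ← mul_pow, ← sq_abs]
      exact pow_le_pow_left₀ (abs_nonneg _) h2 2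
    have hcot : Real.cos (Real.pi / L * (L - ε)) / Real.sin (Real.pi / L * (L - ε)) =
        -(Real.cos (Real.pi / L * ε) / Real.sin (Real.pi / L * ε)) := by
      rw [mul_sub, haL, Real.cos_pi_sub, Real.sin_pi_sub, neg_div]
    have haε : Real.pi / L * ε < Real.pi / 2 := by
      have : Real.pi / L * ε < Real.pi / L * (L / 2) :=
        mul_lt_mul_of_pos_left (by linarith) hapos
      linarith [mul_div_assoc (Real.pi / L) L 2]
    have hc1 := mul_cot_le_one (mul_pos hapos hε) haε
    have hc0 : 0 ≤ Real.cos (Real.pi / L * ε) / Real.sin (Real.pi / L * ε) := by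
      refine div_nonneg (Real.cos_nonneg_of_mem_Icc ⟨?_, haε.le⟩)
        (Real.sin_nonneg_of_nonneg_of_le_pi (mul_pos hapos hε).le (by linarith [Real.pi_pos]))
      linarith [Real.pi_pos, mul_pos hapos hε]
    rw [hcot] at heq
    set c := Real.cos (Real.pi / L * ε) / Real.sin (Real.pi / L * ε)
    have hb : Real.pi / L * c * ((∫ r in (0 : ℝ)..(L - ε), g r) ^ 2 +
        (∫ r in (0 : ℝ)..ε, g r) ^ 2) ≤ 2 * C ^ 2 * ε := by
      calc _ ≤ Real.pi / L * c * (C ^ 2 * ε ^ 2 + C ^ 2 * ε ^ 2) := by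
            have : 0 ≤ Real.pi / L * c := mul_nonneg hapos.le hc0
            gcongr
        _ = (Real.pi / L * ε * c) * (2 * C ^ 2 * ε) := by ring
        _ ≤ 1 * (2 * C ^ 2 * ε) := by
            refine mul_le_mul_of_nonneg_right hc1 (by positivity)
        _ = _ := one_mul _
    rw [heq]
    linarith
  -- let `ε` tend to zero
  have hD := hDi 0 1
  set D : ℝ → ℝ := fun s => g s ^ 2 - (Real.pi / L) ^ 2 * (∫ r in (0 : ℝ)..s, g r) ^ 2 with hDdef
  have hPc : Continuous fun s => ∫ r in (0 : ℝ)..s, D r := intervalIntegral.continuous_primitive hDi 0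
  have hsplit : ∀ ε, ∫ s in ε..(L - ε), D s =
      (∫ s in (0 : ℝ)..(L - ε), D s) - ∫ s in (0 : ℝ)..ε, D s := fun ε =>
    (intervalIntegral.integral_interval_sub_left (hDi _ _) (hDi _ _)).symm
  have hlim : Filter.Tendsto (fun ε => (∫ s in ε..(L - ε), D s) + 2 * C ^ 2 * ε)
      (nhdsWithin 0 (Ioi 0)) (nhds (∫ s in (0 : ℝ)..L, D s)) := by
    have hcont : Continuous fun ε => (∫ s in ε..(L - ε), D s) + 2 * C ^ 2 * ε := by
      simp_rw [hsplit]
      exact ((hPc.comp (continuous_const.sub continuous_id)).sub hPc).add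
        (continuous_const.mul continuous_id)
    have := (hcont.tendsto 0).mono_left (nhdsWithin_le_nhds (s := Ioi (0 : ℝ)))
    simpa using this
  refine ge_of_tendsto hlim ?_
  filter_upwards [Ioc_mem_nhdsGT hδ] with ε hε using key ε hε.1 hε.2

/-- The case of equality in Wirtinger's inequality. -/
theorem primitive_eq_sin_of_integral_eq_zero (hgi : ∀ a b, IntervalIntegrable g volume a b)
    (hg : ∀ s, |g s| ≤ C) (hL : 0 < L) (h0 : ∫ s in (0 : ℝ)..L, g s = 0)
    (hzero : ∫ s in (0 : ℝ)..L, (g s ^ 2 - (Real.pi / L) ^ 2 * (∫ r in (0 : ℝ)..s, g r) ^ 2) ≤ 0) :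
    ∃ B, ∀ s ∈ Ioo 0 L, ∫ r in (0 : ℝ)..s, g r = B * Real.sin (Real.pi / L * s) := by
  set a := Real.pi / L with ha
  have hapos : 0 < a := div_pos Real.pi_pos hL
  have haL : a * L = Real.pi := by rw [ha]; field_simp
  set S : ℝ → ℝ := fun s => ∫ r in (0 : ℝ)..s, g r with hS
  have hsinpos : ∀ s ∈ Ioo 0 L, 0 < Real.sin (a * s) := by
    intro s hs
    refine Real.sin_pos_of_pos_of_lt_pi (mul_pos hapos hs.1) ?_
    rw [← haL]
    exact mul_lt_mul_of_pos_left hs.2 hapos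
  have key : ∀ δ, 0 < δ → δ < L / 2 → ∃ B, ∀ s ∈ Icc δ (L - δ), S s / Real.sin (a * s) = B := by
    intro δ hδ hδL
    have hle : δ ≤ L - δ := by linarith
    have hu : uIcc δ (L - δ) = Icc δ (L - δ) := uIcc_of_le hle
    have hsub : Icc δ (L - δ) ⊆ Ioo 0 L := fun s hs => ⟨hδ.trans_le hs.1, by linarith [hs.2]⟩
    have h1 := integral_cot_sq_le hgi hg hL h0 hδ hδL
    obtain ⟨hint, -⟩ := integral_sq_sub_cot hgi hg hL hδ hle (by linarith : L - δ < L)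
    have h2 : ∫ s in δ..(L - δ), (g s - a * S s * (Real.cos (a * s) / Real.sin (a * s))) ^ 2 = 0 :=
      le_antisymm (h1.trans hzero)
        (intervalIntegral.integral_nonneg hle fun s _ => sq_nonneg _)
    rw [intervalIntegral.integral_of_le hle, setIntegral_eq_zero_iff_of_nonneg_ae
      (Filter.Eventually.of_forall fun s => sq_nonneg _) hint.1] at h2
    have h3 : ∀ᵐ s, s ∈ Ioc δ (L - δ) →
        g s = a * S s * (Real.cos (a * s) / Real.sin (a * s)) := by
      rw [Filter.EventuallyEq, ae_restrict_iff' measurableSet_Ioc] at h2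
      filter_upwards [h2] with s hs hsm
      have := pow_eq_zero_iff (two_ne_zero) |>.1 (hs hsm)
      linarith
    have hSac : AbsolutelyContinuousOnInterval S δ (L - δ) := by
      have h1 : AbsolutelyContinuousOnInterval S 0 L :=
        (hgi 0 L).absolutelyContinuousOnInterval_intervalIntegral left_mem_uIcc
      refine h1.mono ?_
      rw [hu, uIcc_of_le hL.le]
      exact hsub.trans Ioo_subset_Icc_self
    have hinv : ContDiffOn ℝ 1 (fun s => (Real.sin (a * s))⁻¹) (uIcc δ (L - δ)) := by
      rw [hu]
      exact ContDiffOn.inv (Real.contDiff_sin.comp (contDiff_const.mul contDiff_id)).contDiffOn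
        fun s hs => (hsinpos s (hsub hs)).ne'
    have hR := hSac.mul hinv.absolutelyContinuousOnInterval
    have hSd := (hgi 0 L).ae_hasDerivAt_integral
    obtain ⟨B, hB⟩ := hR.const_of_ae_hasDerivAt_zero (by
      have hδne : ∀ᵐ s : ℝ, s ≠ δ := by simp [ae_iff, measure_singleton]
      filter_upwards [h3, hSd, hδne] with s hs hs' hsδ hsm
      rw [hu] at hsm
      have hd : HasDerivAt S (g s) s := hs' (by
        rw [uIcc_of_le hL.le]
        exact Ioo_subset_Icc_self (hsub hsm)) 0 left_mem_uIcc
      have hsin := (hsinpos s (hsub hsm)).ne'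
      have h4 : HasDerivAt (fun s : ℝ => a * s) a s := by
        simpa using (hasDerivAt_id s).const_mul a
      have h5 := hd.mul (h4.sin.inv hsin)
      refine h5.congr_deriv ?_
      rw [hs ⟨lt_of_le_of_ne hsm.1 hsδ.symm, hsm.2⟩]
      simp only [Pi.inv_apply]
      field_simp
      ring)
    refine ⟨B, fun s hs => ?_⟩
    rw [div_eq_mul_inv]
    exact hB s (hu ▸ hs)
  refine ⟨S (L / 2) / Real.sin (a * (L / 2)), fun s hs => ?_⟩
  have hδ : 0 < min (min s (L - s)) (L / 4) :=
    lt_min (lt_min hs.1 (sub_pos.2 hs.2)) (by linarith)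
  have h1 := min_le_right (min s (L - s)) (L / 4)
  have h2 := (min_le_left (min s (L - s)) (L / 4)).trans (min_le_left _ _)
  have h3 := (min_le_left (min s (L - s)) (L / 4)).trans (min_le_right _ _)
  obtain ⟨B, hB⟩ := key _ hδ (by linarith)
  have hs' := hB s ⟨h2, by linarith⟩
  have hL' := hB (L / 2) ⟨by linarith, by linarith⟩
  rw [hL', ← hs', div_mul_cancel₀ _ (hsinpos s hs).ne']

end Wirtinger

/-! ### Distributions on the line and their quantile functions -/

section Distribution

/-- The decreasing quantile function of a finite measure on `[-C, C]`. -/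
noncomputable def quantile (ν : Measure ℝ) (C s : ℝ) : ℝ :=
  sSup {t | t ∈ Icc (-C) C ∧ (t = -C ∨ ENNReal.ofReal s < ν (Ioi t))}

/-- The integral of the identity over the values above `t`. It is replaced by `0` at the countably
many atoms `t`, which makes it a lower bound for the primitive of the quantile function. -/
noncomputable def tailIntegral (ν : Measure ℝ) (t : ℝ) : ℝ :=
  open Classical in if ν {t} = 0 then ∫ u in Ioi t, u ∂ν else 0

/-- A measure of total mass `L` and mean zero on the interval `[-C, C]`. -/
structure IsCentered (ν : Measure ℝ) (C L : ℝ) : Prop where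
  nonneg : 0 ≤ C
  pos : 0 < L
  mass : ν univ = ENNReal.ofReal L
  supp : ν (Icc (-C) C)ᶜ = 0
  mean : ∫ u, u ∂ν = 0

namespace IsCentered

variable {ν : Measure ℝ} {C L : ℝ}

theorem isFiniteMeasure (h : IsCentered ν C L) : IsFiniteMeasure ν :=
  ⟨by rw [h.mass]; exact ENNReal.ofReal_lt_top⟩

theorem ae_mem (h : IsCentered ν C L) : ∀ᵐ u ∂ν, u ∈ Icc (-C) C := h.supp

theorem quantile_mem (h : IsCentered ν C L) (s : ℝ) : quantile ν C s ∈ Icc (-C) C := by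
  have hmem : -C ∈ {t | t ∈ Icc (-C) C ∧ (t = -C ∨ ENNReal.ofReal s < ν (Ioi t))} :=
    ⟨⟨le_rfl, by linarith [h.nonneg]⟩, Or.inl rfl⟩
  exact ⟨le_csSup ⟨C, fun t ht => ht.1.2⟩ hmem, csSup_le ⟨_, hmem⟩ fun t ht => ht.1.2⟩

theorem abs_quantile_le (h : IsCentered ν C L) (s : ℝ) : |quantile ν C s| ≤ C :=
  abs_le.2 (h.quantile_mem s)

theorem antitone_quantile (h : IsCentered ν C L) : Antitone (quantile ν C) := by
  intro s s' hs
  refine csSup_le_csSup ⟨C, fun t ht => ht.1.2⟩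
    ⟨-C, ⟨le_rfl, by linarith [h.nonneg]⟩, Or.inl rfl⟩ ?_
  rintro t ⟨h1, h2⟩
  exact ⟨h1, h2.imp id fun h3 => (ENNReal.ofReal_le_ofReal hs).trans_lt h3⟩

theorem intervalIntegrable_quantile (h : IsCentered ν C L) (a b : ℝ) :
    IntervalIntegrable (quantile ν C) volume a b := h.antitone_quantile.intervalIntegrable

theorem real_Ioi_le (h : IsCentered ν C L) (t : ℝ) : ν.real (Ioi t) ≤ L := by
  have := h.isFiniteMeasure
  have h1 : ν.real (Ioi t) ≤ ν.real univ := measureReal_mono (subset_univ _)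
  rwa [measureReal_def, measureReal_def, h.mass, ENNReal.toReal_ofReal h.pos.le] at h1

theorem lt_quantile_iff (h : IsCentered ν C L) {s : ℝ} (hs : s ∈ Ico 0 L) (t : ℝ) :
    t < quantile ν C s ↔ s < ν.real (Ioi t) := by
  have := h.isFiniteMeasure
  have hreal : ∀ t, ENNReal.ofReal s < ν (Ioi t) ↔ s < ν.real (Ioi t) := fun t =>
    ENNReal.ofReal_lt_iff_lt_toReal hs.1 (measure_ne_top _ _)
  rw [← hreal]
  have hbdd : BddAbove {t | t ∈ Icc (-C) C ∧ (t = -C ∨ ENNReal.ofReal s < ν (Ioi t))} :=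
    ⟨C, fun t ht => ht.1.2⟩
  constructor
  · intro hlt
    rcases lt_or_ge t (-C) with htC | htC
    · have h1 : ν (Ioi t)ᶜ = 0 := measure_mono_null
        (compl_subset_compl.2 fun u hu => htC.trans_le hu.1) h.supp
      rw [(measure_eq_measure_of_null_sdiff (subset_univ _) (by rwa [← compl_eq_univ_sdiff]) :
        ν (Ioi t) = ν univ), h.mass]
      exact (ENNReal.ofReal_lt_ofReal_iff h.pos).2 hs.2
    · obtain ⟨t', ⟨h1, h2⟩, h3⟩ := exists_lt_of_lt_csSup (s := {t | t ∈ Icc (-C) C ∧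
        (t = -C ∨ ENNReal.ofReal s < ν (Ioi t))})
        ⟨-C, ⟨le_rfl, by linarith [h.nonneg]⟩, Or.inl rfl⟩ hlt
      rcases h2 with rfl | h2
      · exact absurd h3 (not_lt.2 htC)
      · exact h2.trans_le (measure_mono (Ioi_subset_Ioi h3.le))
  · intro hlt
    rcases lt_or_ge t (-C) with htC | htC
    · exact htC.trans_le (h.quantile_mem s).1
    -- the mass above `t` is the limit of the masses above larger values
    have hun : Ioi t = ⋃ n : ℕ, Ioi (t + 1 / (n + 1 : ℝ)) := by
      ext u
      simp only [mem_Ioi, mem_iUnion]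
      constructor
      · intro hu
        obtain ⟨n, hn⟩ := exists_nat_one_div_lt (sub_pos.2 hu)
        exact ⟨n, by linarith⟩
      · rintro ⟨n, hn⟩
        have : (0 : ℝ) < 1 / (n + 1 : ℝ) := by positivity
        linarith
    have hmono : Monotone fun n : ℕ => Ioi (t + 1 / (n + 1 : ℝ)) := by
      intro m n hmn
      refine Ioi_subset_Ioi ?_
      gcongr
    rw [hun, hmono.measure_iUnion] at hlt
    obtain ⟨n, hn⟩ := lt_iSup_iff.1 hlt
    have hpos : (0 : ℝ) < 1 / (n + 1 : ℝ) := by positivity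
    set t' := t + 1 / (n + 1 : ℝ) with ht'
    have ht'C : t' ≤ C := by
      by_contra! hcon
      have : ν (Ioi t') = 0 := by
        refine measure_mono_null ?_ h.supp
        intro u hu hmem
        exact (hcon.trans hu).not_ge hmem.2
      rw [this] at hn
      exact not_lt_zero hn
    have : t' ≤ quantile ν C s := le_csSup hbdd ⟨⟨by linarith, ht'C⟩, Or.inr hn⟩
    linarith

theorem measurable_quantile (h : IsCentered ν C L) : Measurable (quantile ν C) :=
  h.antitone_quantile.measurable

theorem preimage_Ioi_inter (h : IsCentered ν C L) (t : ℝ) :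
    quantile ν C ⁻¹' Ioi t ∩ Ioo 0 L = Ioo 0 (ν.real (Ioi t)) := by
  ext s
  constructor
  · rintro ⟨h1, h2⟩
    exact ⟨h2.1, (h.lt_quantile_iff ⟨h2.1.le, h2.2⟩ t).1 h1⟩
  · rintro ⟨h1, h2⟩
    have h3 := h2.trans_le (h.real_Ioi_le t)
    exact ⟨(h.lt_quantile_iff ⟨h1.le, h3⟩ t).2 h2, h1, h3⟩

/-- The quantile function transports Lebesgue measure to the given measure. -/
theorem map_quantile (h : IsCentered ν C L) :
    (volume.restrict (Ioo 0 L)).map (quantile ν C) = ν := by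
  have := h.isFiniteMeasure
  have hfin : IsFiniteMeasure ((volume.restrict (Ioo 0 L)).map (quantile ν C)) := by
    infer_instance
  have huniv : (volume.restrict (Ioo 0 L)).map (quantile ν C) univ = ν univ := by
    rw [Measure.map_apply h.measurable_quantile MeasurableSet.univ, h.mass]
    simp
  refine Measure.ext_of_Iic _ _ fun t => ?_
  have hIoi : (volume.restrict (Ioo 0 L)).map (quantile ν C) (Ioi t) = ν (Ioi t) := by
    rw [Measure.map_apply h.measurable_quantile measurableSet_Ioi,
      Measure.restrict_apply (h.measurable_quantile measurableSet_Ioi), h.preimage_Ioi_inter,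
      Real.volume_Ioo, sub_zero, ofReal_measureReal]
  rw [← compl_Ioi, measure_compl measurableSet_Ioi (measure_ne_top _ _),
    measure_compl measurableSet_Ioi (measure_ne_top _ _), hIoi, huniv]

theorem integral_eq (h : IsCentered ν C L) {φ : ℝ → ℝ} (hφ : Measurable φ) :
    ∫ u, φ u ∂ν = ∫ s in Ioo 0 L, φ (quantile ν C s) := by
  conv_lhs => rw [← h.map_quantile]
  exact integral_map h.measurable_quantile.aemeasurable hφ.aestronglyMeasurable

theorem ae_iff (h : IsCentered ν C L) {p : ℝ → Prop} (hp : MeasurableSet {u | p u}) :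
    (∀ᵐ u ∂ν, p u) ↔ ∀ᵐ s ∂(volume.restrict (Ioo 0 L)), p (quantile ν C s) := by
  conv_lhs => rw [← h.map_quantile]
  exact ae_map_iff h.measurable_quantile.aemeasurable hp

theorem setIntegral_Ioi_eq (h : IsCentered ν C L) (t : ℝ) :
    ∫ u in Ioi t, u ∂ν = ∫ s in (0 : ℝ)..(ν.real (Ioi t)), quantile ν C s := by
  conv_lhs => rw [← h.map_quantile]
  rw [setIntegral_map (f := fun u : ℝ => u) measurableSet_Ioi
    measurable_id.aestronglyMeasurable h.measurable_quantile.aemeasurable,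
    Measure.restrict_restrict (h.measurable_quantile measurableSet_Ioi), h.preimage_Ioi_inter,
    intervalIntegral.integral_of_le measureReal_nonneg, integral_Ioc_eq_integral_Ioo]

theorem integral_quantile (h : IsCentered ν C L) : ∫ s in (0 : ℝ)..L, quantile ν C s = 0 := by
  rw [intervalIntegral.integral_of_le h.pos.le, integral_Ioc_eq_integral_Ioo,
    ← h.integral_eq (φ := fun u => u) measurable_id]
  exact h.mean

/-- The primitive of the quantile function is nonnegative, since the function is decreasing and has
mean zero. -/
theorem primitive_nonneg (h : IsCentered ν C L) {s : ℝ} (hs : s ∈ Icc 0 L) :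
    0 ≤ ∫ r in (0 : ℝ)..s, quantile ν C r := by
  rcases le_total 0 (quantile ν C s) with h0 | h0
  · exact intervalIntegral.integral_nonneg hs.1 fun r hr => h0.trans (h.antitone_quantile hr.2)
  · have h1 := intervalIntegral.integral_add_adjacent_intervals
      (h.intervalIntegrable_quantile 0 s) (h.intervalIntegrable_quantile s L)
    have h2 : ∫ r in s..L, quantile ν C r ≤ 0 := by
      have := intervalIntegral.integral_mono_on hs.2 (h.intervalIntegrable_quantile s L)
        (intervalIntegrable_const (c := (0 : ℝ))) fun r hr => (h.antitone_quantile hr.1).trans h0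
      simpa using this
    have h3 := h.integral_quantile
    linarith

theorem tailIntegral_nonneg (h : IsCentered ν C L) (t : ℝ) : 0 ≤ tailIntegral ν t := by
  unfold tailIntegral
  split_ifs
  · rw [h.setIntegral_Ioi_eq]
    exact h.primitive_nonneg ⟨measureReal_nonneg, h.real_Ioi_le t⟩
  · exact le_rfl

theorem tailIntegral_quantile_le (h : IsCentered ν C L) {s : ℝ} (hs : s ∈ Ioo 0 L) :
    tailIntegral ν (quantile ν C s) ≤ ∫ r in (0 : ℝ)..s, quantile ν C r := by
  unfold tailIntegral
  split_ifs with h0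
  · -- without an atom there is no plateau of the quantile function on the left of `s`
    have hle : ν.real (Ioi (quantile ν C s)) ≤ s := by
      by_contra! hcon
      exact ((h.lt_quantile_iff ⟨hs.1.le, hs.2⟩ _).2 hcon).false
    have heq : ν.real (Ioi (quantile ν C s)) = s := by
      refine hle.antisymm (not_lt.1 fun hlt => ?_)
      have hsub : Ioo (ν.real (Ioi (quantile ν C s))) s ⊆
          quantile ν C ⁻¹' {quantile ν C s} ∩ Ioo 0 L := by
        intro r hr
        have hr0 : 0 < r := measureReal_nonneg.trans_lt hr.1
        have hrL : r < L := hr.2.trans hs.2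
        refine ⟨le_antisymm ?_ (h.antitone_quantile hr.2.le), hr0, hrL⟩
        by_contra! hcon
        exact ((h.lt_quantile_iff ⟨hr0.le, hrL⟩ _).1 hcon).not_gt hr.1
      rw [← h.map_quantile, Measure.map_apply h.measurable_quantile (measurableSet_singleton _),
        Measure.restrict_apply (h.measurable_quantile (measurableSet_singleton _)),
        h.map_quantile] at h0
      have := measure_mono_null hsub h0
      rw [Real.volume_Ioo, ENNReal.ofReal_eq_zero] at this
      linarith
    rw [h.setIntegral_Ioi_eq, heq]
  · exact h.primitive_nonneg (Ioo_subset_Icc_self hs)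

theorem countable_atoms (h : IsCentered ν C L) : {t | ν {t} ≠ 0}.Countable := by
  have := h.isFiniteMeasure
  have h1 := Measure.countable_meas_pos_of_disjoint_iUnion (μ := ν) (As := fun t : ℝ => {t})
    (fun t => measurableSet_singleton t) fun s t hst => by simpa [Function.onFun] using hst
  simpa only [pos_iff_ne_zero] using h1

theorem tailIntegral_ae_eq (h : IsCentered ν C L) :
    tailIntegral ν =ᵐ[volume] fun t => ∫ u in Ioi t, u ∂ν := by
  filter_upwards [h.countable_atoms.ae_notMem volume] with t ht
  exact if_pos (not_not.1 ht)

theorem measurable_tailIntegral (h : IsCentered ν C L) : Measurable (tailIntegral ν) := by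
  have := h.isFiniteMeasure
  have hanti : Antitone fun t => ν.real (Ioi t) := fun s t hst =>
    measureReal_mono (Ioi_subset_Ioi hst)
  have hm : Measurable fun t => ∫ u in Ioi t, u ∂ν := by
    simp_rw [h.setIntegral_Ioi_eq]
    exact (intervalIntegral.continuous_primitive h.intervalIntegrable_quantile 0).measurable.comp
      hanti.measurable
  have hset : MeasurableSet {t : ℝ | ν {t} = 0} := by
    have := h.countable_atoms.measurableSet.compl
    convert this using 1
    ext t
    simp
  exact Measurable.ite hset hm measurable_const

/-- Above the tail integral there is mass on both sides. -/
theorem measure_ne_zero_of_tailIntegral_ne_zero (h : IsCentered ν C L) {t : ℝ}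
    (ht : tailIntegral ν t ≠ 0) : ν (Ioi t) ≠ 0 ∧ ν (Iio t) ≠ 0 := by
  unfold tailIntegral at ht
  split_ifs at ht with h0
  · refine ⟨fun h1 => ht ?_, fun h1 => ht ?_⟩
    · rw [Measure.restrict_eq_zero.2 h1, integral_zero_measure]
    · rw [← h.mean]
      refine setIntegral_eq_integral_of_ae_compl_eq_zero ?_
      have h2 : ν (Iic t) = 0 := by
        rw [← Iio_union_right]
        exact measure_union_null h1 h0
      filter_upwards [measure_eq_zero_iff_ae_notMem.1 h2] with u hu hu'
      have h3 : u ≤ t := by simpa using hu'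
      exact absurd h3 hu
  · exact absurd rfl ht

theorem integrable_id (h : IsCentered ν C L) : Integrable (fun u : ℝ => u) ν := by
  have := h.isFiniteMeasure
  refine Integrable.of_bound (C := C) aestronglyMeasurable_id ?_
  filter_upwards [h.ae_mem] with u hu
  exact abs_le.2 hu

/-- The layer cake formula for the second moment. -/
theorem lintegral_tailIntegral (h : IsCentered ν C L) :
    ∫⁻ t, ENNReal.ofReal (tailIntegral ν t) = ENNReal.ofReal (∫ u, u ^ 2 ∂ν) := by
  have := h.isFiniteMeasure
  let D : Set (ℝ × ℝ) := {p | p.2 < p.1}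
  have hD : MeasurableSet D := measurableSet_lt measurable_snd measurable_fst
  have hint : Integrable (Function.uncurry fun u t : ℝ => D.indicator (fun p => p.1) (u, t))
      (ν.prod (volume.restrict (Ioc (-C) C))) := by
    have h1 : Integrable (fun p : ℝ × ℝ => p.1) (ν.prod (volume.restrict (Ioc (-C) C))) :=
      h.integrable_id.comp_fst _
    exact h1.indicator hD
  have hswap := integral_integral_swap hint
  have hl : ∫ u, ∫ t in Ioc (-C) C, D.indicator (fun p => p.1) (u, t) ∂volume ∂ν =
      ∫ u, u ^ 2 ∂ν := by
    have h1 : ∫ u, ∫ t in Ioc (-C) C, D.indicator (fun p => p.1) (u, t) ∂volume ∂ν =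
        ∫ u, (u ^ 2 + C * u) ∂ν := by
      refine integral_congr_ae ?_
      filter_upwards [h.ae_mem] with u hu
      have h2 : (fun t => D.indicator (fun p : ℝ × ℝ => p.1) (u, t)) =
          (Iio u).indicator fun _ => u := by
        funext t
        simp only [indicator, D, mem_ofPred_eq, mem_Iio]
      rw [h2, setIntegral_indicator measurableSet_Iio, setIntegral_const]
      have h3 : Ioc (-C) C ∩ Iio u = Ioo (-C) u := by
        ext t
        exact ⟨fun ht => ⟨ht.1.1, ht.2⟩, fun ht => ⟨⟨ht.1, ht.2.le.trans hu.2⟩, ht.2⟩⟩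
      rw [h3, Real.volume_real_Ioo_of_le hu.1, smul_eq_mul]
      ring
    rw [h1, integral_add, integral_const_mul, h.mean]
    · simp
    · refine Integrable.of_bound (C := C ^ 2)
        (measurable_id.pow_const 2 : Measurable fun u : ℝ => u ^ 2).aestronglyMeasurable ?_
      filter_upwards [h.ae_mem] with u hu
      rw [norm_pow]
      exact pow_le_pow_left₀ (abs_nonneg _) (abs_le.2 hu) 2
    · exact h.integrable_id.const_mul C
  have hr : ∀ t, ∫ u, D.indicator (fun p : ℝ × ℝ => p.1) (u, t) ∂ν = ∫ u in Ioi t, u ∂ν := by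
    intro t
    rw [← integral_indicator measurableSet_Ioi]
    rfl
  have hint2 := hint.integral_prod_right
  simp only [Function.uncurry, hr] at hint2 hswap
  rw [hl] at hswap
  rw [hswap, ofReal_integral_eq_lintegral_ofReal hint2]
  · rw [← setLIntegral_eq_of_support_subset (s := Ioc (-C) C ∪ {-C})]
    · rw [union_singleton, setLIntegral_congr (insert_ae_eq_self (-C) (Ioc (-C) C))]
      refine lintegral_congr_ae (ae_restrict_of_ae ?_)
      filter_upwards [h.tailIntegral_ae_eq] with t ht
      rw [ht]
    · intro t ht
      have ht' : tailIntegral ν t ≠ 0 := fun h0 => ht (by simp [h0])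
      obtain ⟨h1, h2⟩ := h.measure_ne_zero_of_tailIntegral_ne_zero ht'
      have h3 : t ≤ C := by
        by_contra! hcon
        refine h1 (measure_mono_null ?_ h.supp)
        intro u hu hmem
        exact (hcon.trans hu).not_ge hmem.2
      have h4 : -C ≤ t := by
        by_contra! hcon
        refine h2 (measure_mono_null ?_ h.supp)
        intro u hu hmem
        exact (lt_trans hu hcon).not_ge hmem.1
      rcases eq_or_lt_of_le h4 with h5 | h5
      · exact Or.inr h5.symm
      · exact Or.inl ⟨h5, h3⟩
  · refine ae_restrict_of_ae ?_
    filter_upwards [h.tailIntegral_ae_eq] with t ht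
    rw [← ht]
    exact h.tailIntegral_nonneg t

theorem integrableOn_primitive_sq (h : IsCentered ν C L) :
    IntegrableOn (fun s => (∫ r in (0 : ℝ)..s, quantile ν C r) ^ 2) (Ioo 0 L) :=
  (((intervalIntegral.continuous_primitive h.intervalIntegrable_quantile 0).pow 2).integrableOn_Icc
    (a := 0) (b := L)).mono_set Ioo_subset_Icc_self

theorem integrableOn_tail_sq (h : IsCentered ν C L) :
    IntegrableOn (fun s => tailIntegral ν (quantile ν C s) ^ 2) (Ioo 0 L) := by
  refine Integrable.mono' h.integrableOn_primitive_sq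
    ((h.measurable_tailIntegral.comp h.measurable_quantile).pow_const 2).aestronglyMeasurable ?_
  filter_upwards [ae_restrict_mem measurableSet_Ioo] with s hs
  rw [norm_pow]
  refine pow_le_pow_left₀ (norm_nonneg _) ?_ 2
  rw [Real.norm_of_nonneg (h.tailIntegral_nonneg _)]
  exact h.tailIntegral_quantile_le hs

theorem integrable_tail_sq (h : IsCentered ν C L) :
    Integrable (fun u => tailIntegral ν u ^ 2) ν := by
  rw [← h.map_quantile]
  refine (integrable_map_measure ?_ h.measurable_quantile.aemeasurable).2 ?_
  · rw [h.map_quantile]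
    exact (h.measurable_tailIntegral.pow_const 2).aestronglyMeasurable
  · rw [h.map_quantile]
    exact h.integrableOn_tail_sq

theorem integral_tail_sq_le_primitive (h : IsCentered ν C L) :
    ∫ u, tailIntegral ν u ^ 2 ∂ν ≤
      ∫ s in Ioo 0 L, (∫ r in (0 : ℝ)..s, quantile ν C r) ^ 2 := by
  rw [h.integral_eq (h.measurable_tailIntegral.pow_const 2)]
  refine setIntegral_mono_on h.integrableOn_tail_sq h.integrableOn_primitive_sq measurableSet_Ioo
    fun s hs => ?_
  exact pow_le_pow_left₀ (h.tailIntegral_nonneg _) (h.tailIntegral_quantile_le hs) 2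

theorem integral_defect (h : IsCentered ν C L) :
    ∫ s in (0 : ℝ)..L, (quantile ν C s ^ 2 -
      (Real.pi / L) ^ 2 * (∫ r in (0 : ℝ)..s, quantile ν C r) ^ 2) =
    (∫ u, u ^ 2 ∂ν) -
      (Real.pi / L) ^ 2 * ∫ s in Ioo 0 L, (∫ r in (0 : ℝ)..s, quantile ν C r) ^ 2 := by
  rw [intervalIntegral.integral_of_le h.pos.le, integral_Ioc_eq_integral_Ioo, integral_sub,
    integral_const_mul, h.integral_eq (φ := fun u => u ^ 2) (measurable_id.pow_const 2)]
  · refine Integrable.of_bound (C := C ^ 2)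
      (h.measurable_quantile.pow_const 2).aestronglyMeasurable ?_
    refine Filter.Eventually.of_forall fun s => ?_
    rw [norm_pow]
    exact pow_le_pow_left₀ (abs_nonneg _) (h.abs_quantile_le s) 2
  · exact h.integrableOn_primitive_sq.const_mul _

/-- Wirtinger's inequality for the primitive of the quantile function, which dominates the tail
integral. -/
theorem integral_tail_sq_le (h : IsCentered ν C L) :
    ∫ u, tailIntegral ν u ^ 2 ∂ν ≤ (L / Real.pi) ^ 2 * ∫ u, u ^ 2 ∂ν := by
  have hL := h.pos
  have h1 := integral_cot_sq_le h.intervalIntegrable_quantile h.abs_quantile_le h.pos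
    h.integral_quantile (δ := L / 4) (by linarith) (by linarith)
  have h2 := (intervalIntegral.integral_nonneg (by linarith : L / 4 ≤ L - L / 4)
    fun s _ => sq_nonneg _).trans h1
  rw [h.integral_defect] at h2
  have hpi := Real.pi_pos
  calc ∫ u, tailIntegral ν u ^ 2 ∂ν
      ≤ ∫ s in Ioo 0 L, (∫ r in (0 : ℝ)..s, quantile ν C r) ^ 2 := h.integral_tail_sq_le_primitive
    _ = (L / Real.pi) ^ 2 * ((Real.pi / L) ^ 2 *
        ∫ s in Ioo 0 L, (∫ r in (0 : ℝ)..s, quantile ν C r) ^ 2) := by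
        field_simp
    _ ≤ _ := by
        refine mul_le_mul_of_nonneg_left (by linarith) (by positivity)

/-- In the case of equality the distribution is the arcsine distribution on an interval `[-A, A]`. -/
theorem exists_amplitude (h : IsCentered ν C L) (hpos : 0 < ∫ u, u ^ 2 ∂ν)
    (heq : (L / Real.pi) ^ 2 * ∫ u, u ^ 2 ∂ν ≤ ∫ u, tailIntegral ν u ^ 2 ∂ν) :
    ∃ A : ℝ, 0 < A ∧ (∀ᵐ u ∂ν, |u| ≤ A) ∧
      (∀ᵐ u ∂ν, tailIntegral ν u = L / Real.pi * √(A ^ 2 - u ^ 2)) ∧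
      (∀ t, ν {t} = 0) ∧ ∀ t ∈ Ioo (-A) A, 0 < tailIntegral ν t := by
  have hL := h.pos
  have hpi := Real.pi_pos
  set a := Real.pi / L with ha
  have hapos : 0 < a := div_pos hpi hL
  have haL : a * L = Real.pi := by rw [ha]; field_simp
  have hLa : L / Real.pi = 1 / a := by rw [ha]; field_simp
  rw [hLa] at heq ⊢
  set S : ℝ → ℝ := fun s => ∫ r in (0 : ℝ)..s, quantile ν C r with hS
  have hle := h.integral_tail_sq_le_primitive
  have hdef := h.integral_defect
  rw [← ha] at hdef
  have hSle : ∫ s in Ioo 0 L, S s ^ 2 ≤ (1 / a) ^ 2 * ∫ u, u ^ 2 ∂ν := by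
    have h1 := integral_cot_sq_le h.intervalIntegrable_quantile h.abs_quantile_le h.pos
      h.integral_quantile (δ := L / 4) (by linarith) (by linarith)
    have h2 := (intervalIntegral.integral_nonneg (by linarith : L / 4 ≤ L - L / 4)
      fun s _ => sq_nonneg _).trans h1
    rw [h.integral_defect, ← ha] at h2
    calc ∫ s in Ioo 0 L, S s ^ 2 = (1 / a) ^ 2 * (a ^ 2 * ∫ s in Ioo 0 L, S s ^ 2) := by
          field_simp
      _ ≤ _ := mul_le_mul_of_nonneg_left (by linarith) (by positivity)
  have hSeq : ∫ s in Ioo 0 L, S s ^ 2 = (1 / a) ^ 2 * ∫ u, u ^ 2 ∂ν :=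
    le_antisymm hSle (heq.trans hle)
  have hTeq : ∫ u, tailIntegral ν u ^ 2 ∂ν = ∫ s in Ioo 0 L, S s ^ 2 :=
    le_antisymm hle (hSle.trans heq)
  obtain ⟨B, hB⟩ := primitive_eq_sin_of_integral_eq_zero h.intervalIntegrable_quantile
    h.abs_quantile_le h.pos h.integral_quantile (by
      rw [h.integral_defect, ← ha]
      change _ - a ^ 2 * ∫ s in Ioo 0 L, S s ^ 2 ≤ 0
      rw [hSeq]
      apply le_of_eq
      field_simp
      ring)
  rw [← ha] at hB
  change ∀ s ∈ Ioo 0 L, S s = B * Real.sin (a * s) at hB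
  have hsin : ∀ s ∈ Ioo 0 L, 0 < Real.sin (a * s) := by
    intro s hs
    refine Real.sin_pos_of_pos_of_lt_pi (mul_pos hapos hs.1) ?_
    rw [← haL]
    exact mul_lt_mul_of_pos_left hs.2 hapos
  have hmid : L / 2 ∈ Ioo 0 L := ⟨by linarith, by linarith⟩
  have hBpos : 0 < B := by
    have hB0 : 0 ≤ B := by
      have h1 := h.primitive_nonneg (Ioo_subset_Icc_self hmid)
      change 0 ≤ S (L / 2) at h1
      rw [hB _ hmid] at h1
      exact nonneg_of_mul_nonneg_left h1 (hsin _ hmid)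
    refine lt_of_le_of_ne hB0 fun hB1 => ?_
    have h2 : ∫ s in Ioo 0 L, S s ^ 2 = 0 := by
      rw [setIntegral_congr_fun measurableSet_Ioo (g := fun _ => 0)
        fun s hs => by simp [hB s hs, ← hB1]]
      simp
    rw [h2] at hSeq
    have : 0 < (1 / a) ^ 2 * ∫ u, u ^ 2 ∂ν := by positivity
    linarith
  -- differentiating the primitive gives the quantile function
  have hq : ∀ᵐ s ∂(volume.restrict (Ioo 0 L)), quantile ν C s = B * a * Real.cos (a * s) := by
    rw [ae_restrict_iff' measurableSet_Ioo]
    filter_upwards [(h.intervalIntegrable_quantile 0 L).ae_hasDerivAt_integral] with s hs hsm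
    have h1 : HasDerivAt S (quantile ν C s) s := hs (by
      rw [uIcc_of_le hL.le]; exact Ioo_subset_Icc_self hsm) 0 left_mem_uIcc
    have h2 : HasDerivAt (fun s : ℝ => B * Real.sin (a * s)) (B * (Real.cos (a * s) * a)) s := by
      have h4 : HasDerivAt (fun s : ℝ => a * s) a s := by
        simpa using (hasDerivAt_id s).const_mul a
      exact h4.sin.const_mul B
    have h3 : S =ᶠ[nhds s] fun s => B * Real.sin (a * s) := by
      filter_upwards [Ioo_mem_nhds hsm.1 hsm.2] with r hr using hB r hr
    have := h1.unique (h2.congr_of_eventuallyEq h3)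
    rw [this]
    ring
  have hT : ∀ᵐ s ∂(volume.restrict (Ioo 0 L)), tailIntegral ν (quantile ν C s) = S s := by
    have h1 : ∫ s in Ioo 0 L, (S s ^ 2 - tailIntegral ν (quantile ν C s) ^ 2) = 0 := by
      rw [integral_sub h.integrableOn_primitive_sq h.integrableOn_tail_sq,
        ← h.integral_eq (h.measurable_tailIntegral.pow_const 2), hTeq, sub_self]
    have hint : IntegrableOn (fun s => S s ^ 2 - tailIntegral ν (quantile ν C s) ^ 2) (Ioo 0 L) :=
      h.integrableOn_primitive_sq.sub h.integrableOn_tail_sq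
    rw [setIntegral_eq_zero_iff_of_nonneg_ae ?_ hint] at h1
    · filter_upwards [h1, ae_restrict_mem measurableSet_Ioo] with s hs hsm
      have h2 : S s ^ 2 = tailIntegral ν (quantile ν C s) ^ 2 := sub_eq_zero.1 hs
      exact ((pow_left_inj₀ (h.primitive_nonneg (Ioo_subset_Icc_self hsm))
        (h.tailIntegral_nonneg _) two_ne_zero).1 h2).symm
    · filter_upwards [ae_restrict_mem measurableSet_Ioo] with s hs
      exact sub_nonneg.2 (pow_le_pow_left₀ (h.tailIntegral_nonneg _)
        (h.tailIntegral_quantile_le hs) 2)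
  have hApos : 0 < B * a := mul_pos hBpos hapos
  have hatoms : ∀ t, ν {t} = 0 := by
    intro t
    have hm : MeasurableSet {u : ℝ | u ≠ t} := (measurableSet_singleton t).compl
    have hsub : ∀ᵐ s ∂(volume.restrict (Ioo 0 L)), B * a * Real.cos (a * s) ≠ t := by
      rw [ae_restrict_iff' measurableSet_Ioo]
      have hs : {s | s ∈ Ioo 0 L ∧ B * a * Real.cos (a * s) = t}.Subsingleton := by
        rintro s ⟨hs, hs'⟩ r ⟨hr, hr'⟩
        have h1 : Real.cos (a * s) = Real.cos (a * r) :=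
          mul_left_cancel₀ hApos.ne' (hs'.trans hr'.symm)
        have hIcc : ∀ s ∈ Ioo 0 L, a * s ∈ Icc 0 Real.pi := fun s hs =>
          ⟨(mul_pos hapos hs.1).le, by rw [← haL]; exact (mul_lt_mul_of_pos_left hs.2 hapos).le⟩
        exact mul_left_cancel₀ hapos.ne' (Real.injOn_cos (hIcc s hs) (hIcc r hr) h1)
      filter_upwards [hs.countable.ae_notMem volume] with s hs hsm heq
      exact hs ⟨hsm, heq⟩
    have h1 : ∀ᵐ u ∂ν, u ≠ t := by
      rw [h.ae_iff hm]
      filter_upwards [hsub, hq] with s hs hs'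
      rwa [hs']
    have h2 := MeasureTheory.ae_iff.1 h1
    simpa using h2
  refine ⟨B * a, hApos, ?_, ?_, hatoms, ?_⟩
  · rw [h.ae_iff (measurableSet_le measurable_abs measurable_const)]
    filter_upwards [hq] with s hs
    rw [hs, abs_mul, abs_of_pos hApos]
    exact mul_le_of_le_one_right hApos.le (Real.abs_cos_le_one _)
  · rw [h.ae_iff (measurableSet_eq_fun h.measurable_tailIntegral (by fun_prop))]
    filter_upwards [hq, hT, ae_restrict_mem measurableSet_Ioo] with s hs hs' hsm
    rw [hs', hs, hB s hsm]
    have h1 : (B * a) ^ 2 - (B * a * Real.cos (a * s)) ^ 2 = (B * a * Real.sin (a * s)) ^ 2 := by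
      have := Real.sin_sq_add_cos_sq (a * s)
      linear_combination (-(B * a) ^ 2) * this
    rw [h1, Real.sqrt_sq (mul_pos hApos (hsin s hsm)).le]
    field_simp
  · intro t ht
    unfold tailIntegral
    rw [if_pos (hatoms t), h.setIntegral_Ioi_eq]
    -- the mass above `t` lies strictly between `0` and `L`
    have hcont : Continuous fun s => B * a * Real.cos (a * s) := by fun_prop
    have hS0 : 0 < ν.real (Ioi t) := by
      have hnb : ∀ᶠ s in nhds (0 : ℝ), t < B * a * Real.cos (a * s) :=
        hcont.continuousAt.eventually (lt_mem_nhds (by simpa using ht.2))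
      obtain ⟨ε, hε, hball⟩ := Metric.eventually_nhds_iff.1 hnb
      have hδ : 0 < min ε L := lt_min hε hL
      by_contra! hcon
      rw [ae_restrict_iff' measurableSet_Ioo] at hq
      have hnull : volume (Ioo 0 (min ε L)) = 0 := by
        refine measure_mono_null ?_ (MeasureTheory.ae_iff.1 hq)
        intro s hs hgood
        have hsL : s ∈ Ioo 0 L := ⟨hs.1, hs.2.trans_le (min_le_right _ _)⟩
        have h1 := hball (y := s) (by
          rw [Real.dist_eq, sub_zero, abs_of_pos hs.1]; exact hs.2.trans_le (min_le_left _ _))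
        rw [← hgood hsL] at h1
        have h2 := (h.lt_quantile_iff ⟨hsL.1.le, hsL.2⟩ t).1 h1
        linarith [hs.1]
      rw [Real.volume_Ioo, ENNReal.ofReal_eq_zero] at hnull
      linarith
    have hSL : ν.real (Ioi t) < L := by
      have hnb : ∀ᶠ s in nhds L, B * a * Real.cos (a * s) < t :=
        hcont.continuousAt.eventually (gt_mem_nhds (by simpa [haL] using ht.1))
      obtain ⟨ε, hε, hball⟩ := Metric.eventually_nhds_iff.1 hnb
      have hδ : 0 < min ε L := lt_min hε hL
      by_contra! hcon
      rw [ae_restrict_iff' measurableSet_Ioo] at hq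
      have hnull : volume (Ioo (L - min ε L) L) = 0 := by
        refine measure_mono_null ?_ (MeasureTheory.ae_iff.1 hq)
        intro s hs hgood
        have h3 := min_le_left ε L
        have h4 := min_le_right ε L
        have hsL : s ∈ Ioo 0 L := ⟨by linarith [hs.1], hs.2⟩
        have h1 := hball (y := s) (by
          rw [Real.dist_eq, abs_sub_comm, abs_of_pos (sub_pos.2 hs.2)]; linarith [hs.1])
        rw [← hgood hsL] at h1
        have h2 := (h.lt_quantile_iff ⟨hsL.1.le, hsL.2⟩ t).2 (hsL.2.trans_le hcon)
        linarith
      rw [Real.volume_Ioo, ENNReal.ofReal_eq_zero] at hnull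
      linarith
    change 0 < S (ν.real (Ioi t))
    rw [hB _ ⟨hS0, hSL⟩]
    exact mul_pos hBpos (hsin _ ⟨hS0, hSL⟩)

end IsCentered

end Distribution

namespace MetricGraph

/-! ### Square integrable functions on a metric graph -/

section SquareIntegrable

variable {E : Type*} {G : MetricGraph E}

theorem lengthMeasure_univ {L : ℝ} (hlen : HasSum G.length L) :
    G.lengthMeasure univ = ENNReal.ofReal L := by
  rw [← lintegral_one, lintegral_lengthMeasure]
  simp only [lintegral_one, Measure.restrict_apply MeasurableSet.univ, univ_inter, Real.volume_Ioc,
    sub_zero]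
  rw [← hlen.tsum_eq, ENNReal.ofReal_tsum_of_nonneg (fun e => (G.length_pos e).le) hlen.summable]

theorem isFiniteMeasure_lengthMeasure {L : ℝ} (hlen : HasSum G.length L) :
    IsFiniteMeasure G.lengthMeasure :=
  ⟨by rw [lengthMeasure_univ hlen]; exact ENNReal.ofReal_lt_top⟩

theorem nonempty_of_hasSum_length {L : ℝ} (hL : 0 < L) (hlen : HasSum G.length L) : Nonempty E := by
  by_contra! hE
  exact hL.ne' (hlen.unique hasSum_empty)

theorem hasSum_integral_lengthMeasure {g : (Σ _ : E, ℝ) → ℝ} (hg : Integrable g G.lengthMeasure) :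
    HasSum (fun e => ∫ t in (0 : ℝ)..(G.length e), g ⟨e, t⟩) (∫ x, g x ∂G.lengthMeasure) := by
  have h := hasSum_integral_measure hg
  have h1 : ∀ e, ∫ x, g x ∂(volume.restrict (Ioc 0 (G.length e))).map (Sigma.mk e) =
      ∫ t in (0 : ℝ)..(G.length e), g ⟨e, t⟩ := fun e => by
    rw [(measurableEmbedding_mk e).integral_map,
      intervalIntegral.integral_of_le (G.length_pos e).le]
  simp only [h1] at h
  exact h

variable [Countable E]

theorem memL2_iff_memLp {w : E → ℝ → ℝ} :
    G.MemL2 w ↔ MemLp (fun x : Σ _ : E, ℝ => w x.1 x.2) 2 G.lengthMeasure := by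
  have hae : AEStronglyMeasurable (fun x : Σ _ : E, ℝ => w x.1 x.2) G.lengthMeasure ↔
      ∀ e, AEStronglyMeasurable (w e) (volume.restrict (Ioc 0 (G.length e))) := by
    rw [lengthMeasure, aestronglyMeasurable_sum_measure_iff]
    exact forall_congr' fun e => (measurableEmbedding_mk e).aestronglyMeasurable_map_iff
  have hint : Integrable (fun x : Σ _ : E, ℝ => w x.1 x.2 ^ 2) G.lengthMeasure ↔
      (∀ e, Integrable (fun t => w e t ^ 2) (volume.restrict (Ioc 0 (G.length e)))) ∧
      Summable fun e => ∫ t in (0 : ℝ)..(G.length e), w e t ^ 2 := by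
    rw [lengthMeasure, integrable_sum_measure_iff]
    refine and_congr (forall_congr' fun e => (measurableEmbedding_mk e).integrable_map_iff) ?_
    refine summable_congr fun e => ?_
    rw [(measurableEmbedding_mk e).integral_map,
      intervalIntegral.integral_of_le (G.length_pos e).le]
    simp
  constructor
  · intro h
    have h1 := hae.2 fun e => (h.memLp e).1
    exact (memLp_two_iff_integrable_sq h1).2
      (hint.2 ⟨fun e => (memLp_two_iff_integrable_sq (h.memLp e).1).1 (h.memLp e), h.summable⟩)
  · intro h
    have h1 := hae.1 h.1
    have h2 := hint.1 ((memLp_two_iff_integrable_sq h.1).1 h)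
    exact ⟨fun e => (memLp_two_iff_integrable_sq (h1 e)).2 (h2.1 e), h2.2⟩

theorem innerL2_eq_integral {w v : E → ℝ → ℝ} (hw : G.MemL2 w) (hv : G.MemL2 v) :
    G.innerL2 w v = ∫ x, w x.1 x.2 * v x.1 x.2 ∂G.lengthMeasure :=
  (hasSum_integral_lengthMeasure
    ((memL2_iff_memLp.1 hw).integrable_mul (memL2_iff_memLp.1 hv))).tsum_eq

variable {f : G.Point → ℝ}

theorem MemH1.memLp_val (hf : MemH1 f) : MemLp (val f) 2 G.lengthMeasure :=
  memL2_iff_memLp.1 hf.memL2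

theorem MemH1.memLp_der (hf : MemH1 f) : MemLp (der f) 2 G.lengthMeasure :=
  memL2_iff_memLp.1 hf.memL2_deriv

/-- The oscillation is at most half the total variation, because every level is crossed twice. -/
theorem two_mul_abs_sub_le (hdc : G.DoublyConnected) (hc : Continuous f)
    (hac : ∀ e, AbsolutelyContinuousOnInterval (onEdge f e) 0 (G.length e))
    (hint : Integrable (der f) G.lengthMeasure) (x y : G.Point) :
    2 * |f x - f y| ≤ ∫ z, |der f z| ∂G.lengthMeasure := by
  wlog hxy : f x ≤ f y generalizing x y
  · rw [abs_sub_comm]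
    exact this y x (le_of_not_ge hxy)
  have h1 := lintegral_crossings_le hc hac (w := fun _ => 1) measurable_const
  simp only [one_mul] at h1
  have h2 : ∫⁻ c in Ioo (f x) (f y), 2 ≤ ∫⁻ c, crossings f c := by
    refine le_trans (lintegral_mono_ae ?_) (setLIntegral_le_lintegral (Ioo (f x) (f y)) _)
    rw [ae_restrict_iff' measurableSet_Ioo]
    filter_upwards [ae_two_le_crossings hdc hc] with c hcc hm
    exact hcc ⟨x, hm.1⟩ ⟨y, hm.2⟩
  rw [setLIntegral_const, Real.volume_Ioo] at h2
  have h3 : ∫⁻ z, ‖der f z‖ₑ ∂G.lengthMeasure =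
      ENNReal.ofReal (∫ z, |der f z| ∂G.lengthMeasure) := by
    rw [ofReal_integral_eq_lintegral_ofReal hint.abs (Filter.Eventually.of_forall fun _ => abs_nonneg _)]
    refine lintegral_congr fun z => ?_
    rw [← Real.norm_eq_abs, ofReal_norm]
  rw [h3] at h1
  have h4 := h2.trans h1
  rw [← ENNReal.ofReal_ofNat, ← ENNReal.ofReal_mul (by norm_num),
    ENNReal.ofReal_le_ofReal_iff (integral_nonneg fun _ => abs_nonneg _)] at h4
  rw [abs_sub_comm, abs_of_nonneg (sub_nonneg.2 hxy)]
  exact h4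

theorem ae_le_of_forall_le {C : ℝ} (hf : ∀ p, |f p| ≤ C) : ∀ᵐ x ∂G.lengthMeasure, |val f x| ≤ C := by
  rw [ae_lengthMeasure_iff]
  refine fun e => (ae_restrict_mem measurableSet_Ioc).mono fun t ht => ?_
  change |onEdge f e t| ≤ C
  rw [onEdge_of_mem f e (Ioc_subset_Icc_self ht)]
  exact hf _

theorem isCentered_map_val {C L : ℝ} (hL : 0 < L) (hlen : HasSum G.length L) (hc : Continuous f)
    (hC0 : 0 ≤ C) (hC : ∀ p, |f p| ≤ C) (hmean : ∫ x, val f x ∂G.lengthMeasure = 0) :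
    IsCentered (G.lengthMeasure.map (val f)) C L where
  nonneg := hC0
  pos := hL
  mass := by
    rw [Measure.map_apply (measurable_val hc) MeasurableSet.univ, preimage_univ,
      lengthMeasure_univ hlen]
  supp := by
    rw [Measure.map_apply (measurable_val hc) measurableSet_Icc.compl]
    refine measure_mono_null ?_ (ae_iff.1 (ae_le_of_forall_le hC))
    intro x hx hx'
    exact hx (abs_le.1 hx')
  mean := by
    rw [integral_map (f := fun u : ℝ => u) (measurable_val hc).aemeasurable
      measurable_id.aestronglyMeasurable]
    exact hmean

end SquareIntegrable

/-! ### The lower bound for the Rayleigh quotient -/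

section Bound

variable {E : Type*} {G : MetricGraph E} {f : G.Point → ℝ} {C L : ℝ}

/-- The data of the variational estimate: a continuous function of mean zero with square integrable
derivative, bounded by `C`, on a doubly connected metric graph of length `L`. -/
structure IsTrial (f : G.Point → ℝ) (C L : ℝ) : Prop where
  memH1 : MemH1 f
  connected : G.DoublyConnected
  centered : IsCentered (G.lengthMeasure.map (val f)) C L

namespace IsTrial

theorem memLp_tail (h : IsTrial f C L) :
    MemLp (fun x => tailIntegral (G.lengthMeasure.map (val f)) (val f x)) 2 G.lengthMeasure := by
  have hm := h.centered.measurable_tailIntegral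
  have hv := measurable_val h.memH1.continuous
  refine (memLp_two_iff_integrable_sq (hm.comp hv).aestronglyMeasurable).2 ?_
  exact (integrable_map_measure (g := fun u => tailIntegral (G.lengthMeasure.map (val f)) u ^ 2)
    (hm.pow_const 2).aestronglyMeasurable hv.aemeasurable).1
    h.centered.integrable_tail_sq

theorem integral_tail_sq (h : IsTrial f C L) :
    ∫ u, tailIntegral (G.lengthMeasure.map (val f)) u ^ 2 ∂(G.lengthMeasure.map (val f)) =
    ∫ x, tailIntegral (G.lengthMeasure.map (val f)) (val f x) ^ 2 ∂G.lengthMeasure :=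
  integral_map (f := fun u => tailIntegral (G.lengthMeasure.map (val f)) u ^ 2)
    (measurable_val h.memH1.continuous).aemeasurable
    (h.centered.measurable_tailIntegral.pow_const 2).aestronglyMeasurable

theorem integral_sq (h : IsTrial f C L) :
    ∫ u, u ^ 2 ∂(G.lengthMeasure.map (val f)) = ∫ x, val f x ^ 2 ∂G.lengthMeasure :=
  integral_map (f := fun u => u ^ 2) (measurable_val h.memH1.continuous).aemeasurable
    (measurable_id.pow_const 2 : Measurable fun u : ℝ => u ^ 2).aestronglyMeasurable

end IsTrial

variable [Countable E]

/-- Almost every level at which the tail integral does not vanish is crossed at least twice. -/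
theorem ae_tailIntegral_mul_two_le (hdc : G.DoublyConnected) (hc : Continuous f)
    (hν : IsCentered (G.lengthMeasure.map (val f)) C L) :
    ∀ᵐ c : ℝ, ENNReal.ofReal (tailIntegral (G.lengthMeasure.map (val f)) c) * 2 ≤
      ENNReal.ofReal (tailIntegral (G.lengthMeasure.map (val f)) c) * crossings f c := by
  filter_upwards [ae_two_le_crossings hdc hc] with c hcc
  rcases eq_or_ne (tailIntegral (G.lengthMeasure.map (val f)) c) 0 with h0 | h0
  · simp [h0]
  · obtain ⟨h2, h3⟩ := hν.measure_ne_zero_of_tailIntegral_ne_zero h0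
    have hex : ∀ S : Set ℝ, MeasurableSet S → G.lengthMeasure.map (val f) S ≠ 0 →
        ∃ p, f p ∈ S := by
      intro S hS hne
      rw [Measure.map_apply (measurable_val hc) hS] at hne
      by_contra! hno
      refine hne ((measure_eq_zero_iff_ae_notMem).2 ?_)
      rw [ae_lengthMeasure_iff]
      refine fun e => (ae_restrict_mem measurableSet_Ioc).mono fun t ht => ?_
      change ¬ onEdge f e t ∈ S
      rw [onEdge_of_mem f e (Ioc_subset_Icc_self ht)]
      exact hno _
    obtain ⟨p, hp⟩ := hex _ measurableSet_Ioi h2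
    obtain ⟨q, hq⟩ := hex _ measurableSet_Iio h3
    gcongr
    exact hcc ⟨q, hq⟩ ⟨p, hp⟩

/-- The second moment is estimated by the layer cake formula, weighted with the crossings. -/
theorem two_mul_integral_sq_le (hdc : G.DoublyConnected) (hc : Continuous f)
    (hν : IsCentered (G.lengthMeasure.map (val f)) C L) :
    2 * ENNReal.ofReal (∫ x, val f x ^ 2 ∂G.lengthMeasure) ≤
      ∫⁻ c, ENNReal.ofReal (tailIntegral (G.lengthMeasure.map (val f)) c) * crossings f c := by
  have h1 := hν.lintegral_tailIntegral
  rw [integral_map (f := fun u : ℝ => u ^ 2) (measurable_val hc).aemeasurable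
    (measurable_id.pow_const 2 : Measurable fun u : ℝ => u ^ 2).aestronglyMeasurable] at h1
  rw [← h1, mul_comm, ← lintegral_mul_const' _ _ (by norm_num)]
  exact lintegral_mono_ae (ae_tailIntegral_mul_two_le hdc hc hν)

namespace IsTrial

theorem lintegral_tail_mul (h : IsTrial f C L) :
    ∫⁻ x, ENNReal.ofReal (tailIntegral (G.lengthMeasure.map (val f)) (val f x)) * ‖der f x‖ₑ
      ∂G.lengthMeasure =
    ENNReal.ofReal (∫ x, tailIntegral (G.lengthMeasure.map (val f)) (val f x) * |der f x|
      ∂G.lengthMeasure) := by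
  rw [ofReal_integral_eq_lintegral_ofReal]
  · refine lintegral_congr fun x => ?_
    rw [ENNReal.ofReal_mul (h.centered.tailIntegral_nonneg _), ← Real.norm_eq_abs, ofReal_norm]
  · exact h.memLp_tail.integrable_mul h.memH1.memLp_der.abs
  · exact Filter.Eventually.of_forall fun x =>
      mul_nonneg (h.centered.tailIntegral_nonneg _) (abs_nonneg _)

theorem lintegral_tail_mul_crossings_le (h : IsTrial f C L) :
    ∫⁻ c, ENNReal.ofReal (tailIntegral (G.lengthMeasure.map (val f)) c) * crossings f c ≤
    ENNReal.ofReal (∫ x, tailIntegral (G.lengthMeasure.map (val f)) (val f x) * |der f x|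
      ∂G.lengthMeasure) := by
  rw [← h.lintegral_tail_mul]
  exact lintegral_crossings_le h.memH1.continuous h.memH1.absolutelyContinuous
    h.centered.measurable_tailIntegral.ennreal_ofReal

theorem two_mul_integral_sq_le_integral (h : IsTrial f C L) :
    2 * ∫ x, val f x ^ 2 ∂G.lengthMeasure ≤
      ∫ x, tailIntegral (G.lengthMeasure.map (val f)) (val f x) * |der f x| ∂G.lengthMeasure := by
  have h1 := (two_mul_integral_sq_le h.connected h.memH1.continuous h.centered).trans
    h.lintegral_tail_mul_crossings_le
  rwa [← ENNReal.ofReal_ofNat, ← ENNReal.ofReal_mul (by norm_num),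
    ENNReal.ofReal_le_ofReal_iff (integral_nonneg fun x =>
      mul_nonneg (h.centered.tailIntegral_nonneg _) (abs_nonneg _))] at h1

theorem integral_defect_sq (h : IsTrial f C L) (β : ℝ) :
    ∫ x, (β * tailIntegral (G.lengthMeasure.map (val f)) (val f x) - |der f x|) ^ 2
      ∂G.lengthMeasure =
    β ^ 2 * ∫ x, tailIntegral (G.lengthMeasure.map (val f)) (val f x) ^ 2 ∂G.lengthMeasure
    - 2 * β * ∫ x, tailIntegral (G.lengthMeasure.map (val f)) (val f x) * |der f x| ∂G.lengthMeasure
    + ∫ x, der f x ^ 2 ∂G.lengthMeasure := by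
  have i1 := (h.memLp_tail.integrable_sq).const_mul (β ^ 2)
  have i2 : Integrable (fun x => 2 * β *
      (tailIntegral (G.lengthMeasure.map (val f)) (val f x) * |der f x|)) G.lengthMeasure :=
    (h.memLp_tail.integrable_mul h.memH1.memLp_der.abs).const_mul (2 * β)
  have i3 := h.memH1.memLp_der.integrable_sq
  rw [← integral_const_mul, ← integral_const_mul, ← integral_sub i1 i2,
    ← integral_add (show Integrable (fun x => β ^ 2 *
        tailIntegral (G.lengthMeasure.map (val f)) (val f x) ^ 2 - 2 * β *
        (tailIntegral (G.lengthMeasure.map (val f)) (val f x) * |der f x|)) G.lengthMeasure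
      from i1.sub i2) i3]
  refine integral_congr_ae (Filter.Eventually.of_forall fun x => ?_)
  have := sq_abs (der f x)
  linear_combination this

/-- The excess of `∫ |f'|²` over `(2 π / L)² ∫ f²` controls the defect of the Cauchy–Schwarz
inequality for `|f'|` and the tail integral at the values of `f`. -/
theorem integral_defect_sq_le (h : IsTrial f C L) :
    ∫ x, (2 * Real.pi ^ 2 / L ^ 2 * tailIntegral (G.lengthMeasure.map (val f)) (val f x)
      - |der f x|) ^ 2 ∂G.lengthMeasure ≤
    (∫ x, der f x ^ 2 ∂G.lengthMeasure) -
      4 * Real.pi ^ 2 / L ^ 2 * ∫ x, val f x ^ 2 ∂G.lengthMeasure := by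
  have hL := h.centered.pos
  have hpi := Real.pi_pos
  have h1 := h.two_mul_integral_sq_le_integral
  have h2 := h.centered.integral_tail_sq_le
  rw [h.integral_tail_sq, h.integral_sq] at h2
  rw [h.integral_defect_sq]
  set V := ∫ x, val f x ^ 2 ∂G.lengthMeasure
  set T := ∫ x, tailIntegral (G.lengthMeasure.map (val f)) (val f x) ^ 2 ∂G.lengthMeasure
  set I := ∫ x, tailIntegral (G.lengthMeasure.map (val f)) (val f x) * |der f x| ∂G.lengthMeasure
  have h3 : (2 * Real.pi ^ 2 / L ^ 2) ^ 2 * T ≤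
      (2 * Real.pi ^ 2 / L ^ 2) ^ 2 * ((L / Real.pi) ^ 2 * V) :=
    mul_le_mul_of_nonneg_left h2 (by positivity)
  have h4 : 2 * (2 * Real.pi ^ 2 / L ^ 2) * (2 * V) ≤ 2 * (2 * Real.pi ^ 2 / L ^ 2) * I :=
    mul_le_mul_of_nonneg_left h1 (by positivity)
  have h5 : (2 * Real.pi ^ 2 / L ^ 2) ^ 2 * ((L / Real.pi) ^ 2 * V) =
      4 * Real.pi ^ 2 / L ^ 2 * V := by
    field_simp
    ring
  have h6 : 2 * (2 * Real.pi ^ 2 / L ^ 2) * (2 * V) = 2 * (4 * Real.pi ^ 2 / L ^ 2 * V) := by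
    ring
  linarith

/-- The lower bound for the Rayleigh quotient of a function of mean zero. -/
theorem mul_integral_sq_le (h : IsTrial f C L) :
    4 * Real.pi ^ 2 / L ^ 2 * ∫ x, val f x ^ 2 ∂G.lengthMeasure ≤
      ∫ x, der f x ^ 2 ∂G.lengthMeasure :=
  sub_nonneg.1 ((integral_nonneg fun _ => sq_nonneg _).trans h.integral_defect_sq_le)

/-- In the case of equality `f` solves the eikonal equation `|f'| = (2 π / L) √(A² - f²)`, has no
plateaus, and takes almost every value at most twice. -/
theorem exists_eikonal (h : IsTrial f C L) (hpos : 0 < ∫ x, val f x ^ 2 ∂G.lengthMeasure)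
    (heq : ∫ x, der f x ^ 2 ∂G.lengthMeasure ≤
      4 * Real.pi ^ 2 / L ^ 2 * ∫ x, val f x ^ 2 ∂G.lengthMeasure) :
    ∃ A : ℝ, 0 < A ∧ (∀ᵐ x ∂G.lengthMeasure, |val f x| ≤ A) ∧
      (∀ᵐ x ∂G.lengthMeasure, |der f x| = 2 * Real.pi / L * √(A ^ 2 - val f x ^ 2)) ∧
      (∀ c, ∀ᵐ x ∂G.lengthMeasure, val f x ≠ c) ∧
      ∀ᵐ c : ℝ, c ∈ Ioo (-A) A → crossings f c ≤ 2 := by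
  have hL := h.centered.pos
  have hpi := Real.pi_pos
  have hv := measurable_val h.memH1.continuous
  have hd := h.integral_defect_sq_le
  have h1 := h.two_mul_integral_sq_le_integral
  have hTle := h.centered.integral_tail_sq_le
  rw [h.integral_tail_sq, h.integral_sq] at hTle
  have hid := h.integral_defect_sq (2 * Real.pi ^ 2 / L ^ 2)
  have hzero : ∫ x, (2 * Real.pi ^ 2 / L ^ 2 * tailIntegral (G.lengthMeasure.map (val f)) (val f x)
      - |der f x|) ^ 2 ∂G.lengthMeasure = 0 :=
    le_antisymm (by linarith) (integral_nonneg fun _ => sq_nonneg _)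
  have hae : ∀ᵐ x ∂G.lengthMeasure,
      |der f x| = 2 * Real.pi ^ 2 / L ^ 2 *
        tailIntegral (G.lengthMeasure.map (val f)) (val f x) := by
    have hint : Integrable (fun x => (2 * Real.pi ^ 2 / L ^ 2 *
        tailIntegral (G.lengthMeasure.map (val f)) (val f x) - |der f x|) ^ 2) G.lengthMeasure :=
      ((h.memLp_tail.const_mul _).sub h.memH1.memLp_der.abs).integrable_sq
    rw [integral_eq_zero_iff_of_nonneg (fun _ => sq_nonneg _) hint] at hzero
    filter_upwards [hzero] with x hx
    have := pow_eq_zero_iff (two_ne_zero) |>.1 hx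
    linarith
  rw [hzero] at hid
  set V := ∫ x, val f x ^ 2 ∂G.lengthMeasure with hV
  set T := ∫ x, tailIntegral (G.lengthMeasure.map (val f)) (val f x) ^ 2 ∂G.lengthMeasure with hT
  set I := ∫ x, tailIntegral (G.lengthMeasure.map (val f)) (val f x) * |der f x| ∂G.lengthMeasure
  set D := ∫ x, der f x ^ 2 ∂G.lengthMeasure
  set β := 2 * Real.pi ^ 2 / L ^ 2 with hβ
  have hβpos : 0 < β := by positivity
  have hk : 4 * Real.pi ^ 2 / L ^ 2 = 2 * β := by rw [hβ]; ring
  have hq : (L / Real.pi) ^ 2 = 2 / β := by rw [hβ]; field_simp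
  rw [hk] at heq hd
  rw [hq] at hTle
  have hTge : 2 / β * V ≤ T := by
    have h4 : 2 * β * (2 * V) ≤ 2 * β * I := mul_le_mul_of_nonneg_left h1 (by positivity)
    have h5 : 2 * β * V ≤ β ^ 2 * T := by linarith
    rw [div_mul_eq_mul_div, div_le_iff₀ hβpos]
    nlinarith
  have hI : I ≤ 2 * V := by
    have h4 : β ^ 2 * T ≤ β ^ 2 * (2 / β * V) := mul_le_mul_of_nonneg_left hTle (by positivity)
    have h5 : β ^ 2 * (2 / β * V) = 2 * β * V := by field_simp
    have h6 : 2 * β * I ≤ 2 * β * (2 * V) := by linarith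
    exact le_of_mul_le_mul_left h6 (by positivity)
  obtain ⟨A, hA, hle, htail, hatom, htpos⟩ := h.centered.exists_amplitude
    (by rw [h.integral_sq]; exact hpos) (by rw [h.integral_sq, h.integral_tail_sq, hq]; exact hTge)
  refine ⟨A, hA, ae_of_ae_map hv.aemeasurable hle, ?_, ?_, ?_⟩
  · filter_upwards [hae, ae_of_ae_map hv.aemeasurable htail] with x hx hx'
    rw [hx, hx', hβ]
    field_simp
  · intro c
    have h2 := hatom c
    rw [Measure.map_apply hv (measurableSet_singleton c)] at h2
    filter_upwards [measure_eq_zero_iff_ae_notMem.1 h2] with x hx using hx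
  · -- the coarea inequality leaves no room for a third crossing
    have hup : ∫⁻ c, ENNReal.ofReal (tailIntegral (G.lengthMeasure.map (val f)) c) *
        crossings f c ≤ ∫⁻ c, ENNReal.ofReal (tailIntegral (G.lengthMeasure.map (val f)) c) * 2 := by
      rw [lintegral_mul_const' _ _ (by norm_num), h.centered.lintegral_tailIntegral, h.integral_sq,
        ← ENNReal.ofReal_ofNat, ← ENNReal.ofReal_mul hpos.le]
      exact h.lintegral_tail_mul_crossings_le.trans (ENNReal.ofReal_le_ofReal (by linarith))
    have hlow := ae_tailIntegral_mul_two_le h.connected h.memH1.continuous h.centered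
    have hfin : ∫⁻ c, ENNReal.ofReal (tailIntegral (G.lengthMeasure.map (val f)) c) * 2 ≠ ⊤ := by
      rw [lintegral_mul_const' _ _ (by norm_num), h.centered.lintegral_tailIntegral]
      exact ENNReal.mul_ne_top ENNReal.ofReal_ne_top (by norm_num)
    have hcr := ae_eq_of_ae_le_of_lintegral_le hlow hfin
      (h.centered.measurable_tailIntegral.ennreal_ofReal.mul
        (measurable_crossings h.memH1.continuous)).aemeasurable hup
    filter_upwards [hcr] with c hc hm
    have h2 := htpos c hm
    exact ((ENNReal.mul_right_inj (ENNReal.ofReal_pos.2 h2).ne' ENNReal.ofReal_ne_top).1 hc).ge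

end IsTrial

end Bound

end MetricGraph

/-! ### Solutions of the eikonal equation are heights -/

theorem AbsolutelyContinuousOnInterval.comp_lipschitzOnWith {F g : ℝ → ℝ} {a b : ℝ} {S : Set ℝ}
    {K : NNReal} (hF : AbsolutelyContinuousOnInterval F a b) (hg : LipschitzOnWith K g S)
    (hS : MapsTo F (uIcc a b) S) : AbsolutelyContinuousOnInterval (fun x => g (F x)) a b := by
  rw [absolutelyContinuousOnInterval_iff] at hF ⊢
  intro ε hε
  have hK : (0 : ℝ) < K + 1 := by positivity
  obtain ⟨δ, hδ, h⟩ := hF (ε / (K + 1)) (by positivity)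
  refine ⟨δ, hδ, fun I hI hsum => ?_⟩
  have h1 := h I hI hsum
  have h2 : ∑ i ∈ Finset.range I.1, dist (g (F (I.2 i).1)) (g (F (I.2 i).2)) ≤
      ∑ i ∈ Finset.range I.1, (K + 1 : ℝ) * dist (F (I.2 i).1) (F (I.2 i).2) := by
    refine Finset.sum_le_sum fun i hi => ?_
    obtain ⟨h3, h4⟩ := hI.1 i hi
    refine (hg.dist_le_mul _ (hS h3) _ (hS h4)).trans ?_
    gcongr
    linarith
  rw [← Finset.mul_sum] at h2
  calc _ ≤ _ := h2
    _ < (K + 1) * (ε / (K + 1)) := by gcongr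
    _ = ε := by field_simp

/-- On `[0, l]`, the function `F` is an absolutely continuous solution of `|F'| = κ √(A² - F²)` with
values in `[-A, A]` and without plateaus. Its phase is `arccos (F / A) / κ`. -/
structure IsEikonal (F : ℝ → ℝ) (A κ l : ℝ) : Prop where
  amp : 0 < A
  freq : 0 < κ
  len : 0 < l
  ac : AbsolutelyContinuousOnInterval F 0 l
  bound : ∀ t ∈ Icc 0 l, |F t| ≤ A
  eq : ∀ᵐ t : ℝ, t ∈ Ioc 0 l → |deriv F t| = κ * √(A ^ 2 - F t ^ 2)
  null : ∀ c, ∀ᵐ t : ℝ, t ∈ Ioc 0 l → F t ≠ c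

namespace IsEikonal

variable {F : ℝ → ℝ} {A κ l : ℝ}

theorem div_mem (h : IsEikonal F A κ l) {t : ℝ} (ht : t ∈ Icc 0 l) : F t / A ∈ Icc (-1 : ℝ) 1 := by
  have h1 := abs_le.1 (h.bound t ht)
  have hA := h.amp
  exact ⟨by rw [le_div_iff₀ hA]; linarith, by rw [div_le_iff₀ hA]; linarith⟩

/-- The phase contracts the distances. The argument of the arc cosine is scaled by a factor `c < 1`
first, because the arc cosine is not Lipschitz continuous at the ends of its domain. -/
theorem abs_arccos_sub_le (h : IsEikonal F A κ l) {s t : ℝ} (hs : s ∈ Icc 0 l) (ht : t ∈ Icc 0 l) :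
    |Real.arccos (F t / A) / κ - Real.arccos (F s / A) / κ| ≤ |t - s| := by
  have hA := h.amp
  have hκ := h.freq
  have key : ∀ c ∈ Ioo (0 : ℝ) 1,
      |Real.arccos (c * (F t / A)) / κ - Real.arccos (c * (F s / A)) / κ| ≤ |t - s| := by
    intro c hc
    have hsub : uIcc s t ⊆ Icc 0 l := uIcc_subset_Icc hs ht
    have hrange : ∀ u ∈ Icc (-A) A, c * (u / A) ∈ Ioo (-1 : ℝ) 1 := by
      intro u hu
      have h1 : u / A ≤ 1 := by rw [div_le_iff₀ hA]; linarith [hu.2]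
      have h2 : -1 ≤ u / A := by rw [le_div_iff₀ hA]; linarith [hu.1]
      constructor <;> nlinarith [hc.1, hc.2]
    have hg : ∃ K, LipschitzOnWith K (fun u => Real.arccos (c * (u / A)) / κ) (Icc (-A) A) := by
      refine ContDiffOn.exists_lipschitzOnWith (n := 1) ?_ (by decide) (convex_Icc _ _)
        isCompact_Icc
      intro u hu
      have h1 := hrange u hu
      have h2 : ContDiffAt ℝ 1 (fun u : ℝ => c * (u / A)) u := by fun_prop
      exact (((Real.contDiffAt_arccos h1.1.ne' h1.2.ne).comp u h2).div_const κ).contDiffWithinAt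
    obtain ⟨K, hK⟩ := hg
    have hac := (h.ac.mono (c := s) (d := t) (by rwa [uIcc_of_le h.len.le])).comp_lipschitzOnWith hK
      fun u hu => abs_le.1 (h.bound u (hsub hu))
    rw [← hac.integral_deriv_eq_sub]
    have := intervalIntegral.norm_integral_le_of_norm_le_const_ae (a := s) (b := t) (C := 1)
      (f := deriv fun x => Real.arccos (c * (F x / A)) / κ) ?_
    · rwa [one_mul, Real.norm_eq_abs] at this
    filter_upwards [h.eq, h.ac.ae_differentiableAt, measure_eq_zero_iff_ae_notMem.1
      (measure_singleton (μ := volume) (0 : ℝ))] with u hu hdiff hu0 hmem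
    have humem : u ∈ Icc 0 l := hsub (uIoc_subset_uIcc hmem)
    have hu' : u ∈ Ioc 0 l := ⟨lt_of_le_of_ne humem.1 (Ne.symm hu0), humem.2⟩
    have hd := (hdiff (by rwa [uIcc_of_le h.len.le])).hasDerivAt
    have hb := abs_le.1 (h.bound u humem)
    have h1 := hrange (F u) hb
    have h2 : HasDerivAt (fun x => Real.arccos (c * (F x / A)) / κ)
        (-(1 / √(1 - (c * (F u / A)) ^ 2)) * (c * (deriv F u / A)) / κ) u := by
      have h3 : HasDerivAt (fun x => c * (F x / A)) (c * (deriv F u / A)) u :=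
        (hd.div_const A).const_mul c
      exact ((Real.hasDerivAt_arccos h1.1.ne' h1.2.ne).comp u h3).div_const κ
    rw [h2.deriv, Real.norm_eq_abs]
    have hpos : 0 < 1 - (c * (F u / A)) ^ 2 := by nlinarith [h1.1, h1.2]
    have hsq : √(A ^ 2 - F u ^ 2) ≤ A * √(1 - (c * (F u / A)) ^ 2) := by
      rw [← Real.sqrt_sq hA.le, ← Real.sqrt_mul (sq_nonneg A), Real.sqrt_sq hA.le]
      refine Real.sqrt_le_sqrt ?_
      have h5 : A ^ 2 * (1 - (c * (F u / A)) ^ 2) = A ^ 2 - c ^ 2 * F u ^ 2 := by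
        field_simp
      rw [h5]
      have h6 : c ^ 2 ≤ 1 := by nlinarith [hc.1, hc.2]
      nlinarith [sq_nonneg (F u)]
    have hsp := Real.sqrt_pos.2 hpos
    rw [abs_div, abs_mul, abs_neg, abs_mul, abs_div (deriv F u), hu hu', abs_of_pos hc.1,
      abs_of_pos hA, abs_of_pos hκ, abs_of_pos (one_div_pos.2 hsp)]
    rw [div_le_one hκ, one_div, inv_mul_le_iff₀ hsp]
    calc c * (κ * √(A ^ 2 - F u ^ 2) / A)
        ≤ 1 * (κ * (A * √(1 - (c * (F u / A)) ^ 2)) / A) := by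
          gcongr
          exact hc.2.le
      _ = _ := by field_simp
  have hlim : Filter.Tendsto (fun c : ℝ =>
      |Real.arccos (c * (F t / A)) / κ - Real.arccos (c * (F s / A)) / κ|) (nhdsWithin 1 (Iio 1))
      (nhds |Real.arccos (1 * (F t / A)) / κ - Real.arccos (1 * (F s / A)) / κ|) := by
    refine (Continuous.tendsto ?_ 1).mono_left nhdsWithin_le_nhds
    have := Real.continuous_arccos
    fun_prop
  rw [one_mul, one_mul] at hlim
  refine le_of_tendsto hlim ?_
  filter_upwards [Ioo_mem_nhdsLT (show (0 : ℝ) < 1 by norm_num)] with c hc using key c hc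

/-- On an interval on which it is monotone, the phase is an isometry. The sign `ε` covers increasing
and decreasing phases. -/
theorem arccos_sub_eq_of_monotoneOn (h : IsEikonal F A κ l) {s t : ℝ} (hs : s ∈ Icc 0 l)
    (ht : t ∈ Icc 0 l) (hst : s ≤ t) {ε : ℝ} (hε : |ε| = 1)
    (hm : MonotoneOn (fun u => ε * (Real.arccos (F u / A) / κ)) (Icc s t)) :
    ε * (Real.arccos (F t / A) / κ) - ε * (Real.arccos (F s / A) / κ) = t - s := by
  have hA := h.amp
  have hκ := h.freq
  have hsub : Icc s t ⊆ Icc 0 l := Icc_subset_Icc hs.1 ht.2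
  have hlip : LipschitzOnWith 1 (fun u => ε * (Real.arccos (F u / A) / κ)) (uIcc s t) := by
    refine LipschitzOnWith.of_dist_le_mul fun u hu v hv => ?_
    rw [uIcc_of_le hst] at hu hv
    rw [Real.dist_eq, Real.dist_eq, ← mul_sub, abs_mul, hε, NNReal.coe_one]
    rw [one_mul, one_mul]
    exact h.abs_arccos_sub_le (hsub hv) (hsub hu)
  rw [← hlip.absolutelyContinuousOnInterval.integral_deriv_eq_sub]
  have hone : ∫ u in s..t, deriv (fun u => ε * (Real.arccos (F u / A) / κ)) u = ∫ u in s..t, 1 := by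
    refine intervalIntegral.integral_congr_ae ?_
    filter_upwards [h.eq, h.ac.ae_differentiableAt, h.null A, h.null (-A),
      measure_eq_zero_iff_ae_notMem.1 (measure_singleton (μ := volume) s),
      measure_eq_zero_iff_ae_notMem.1 (measure_singleton (μ := volume) t)]
      with u hu hdiff huA huA' hus hut hmem
    rw [uIoc_of_le hst] at hmem
    have humem : u ∈ Icc 0 l := hsub (Ioc_subset_Icc_self hmem)
    have hu' : u ∈ Ioc 0 l := ⟨hs.1.trans_lt hmem.1, humem.2⟩
    have hd := (hdiff (by rwa [uIcc_of_le h.len.le])).hasDerivAt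
    have hb := abs_le.1 (h.bound u humem)
    have hlt1 : F u < A := lt_of_le_of_ne hb.2 (huA hu')
    have hlt2 : -A < F u := lt_of_le_of_ne hb.1 (Ne.symm (huA' hu'))
    have h1 : F u / A ∈ Ioo (-1 : ℝ) 1 :=
      ⟨by rw [lt_div_iff₀ hA]; linarith, by rw [div_lt_iff₀ hA]; linarith⟩
    have h2 : HasDerivAt (fun x => ε * (Real.arccos (F x / A) / κ))
        (ε * (-(1 / √(1 - (F u / A) ^ 2)) * (deriv F u / A) / κ)) u := by
      have h3 : HasDerivAt (fun x => F x / A) (deriv F u / A) u := hd.div_const A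
      exact (((Real.hasDerivAt_arccos h1.1.ne' h1.2.ne).comp u h3).div_const κ).const_mul ε
    have hpos : 0 < 1 - (F u / A) ^ 2 := by nlinarith [h1.1, h1.2]
    have hsq : √(A ^ 2 - F u ^ 2) = A * √(1 - (F u / A) ^ 2) := by
      rw [← Real.sqrt_sq hA.le, ← Real.sqrt_mul (sq_nonneg A), Real.sqrt_sq hA.le]
      congr 1
      field_simp
    have hsp := Real.sqrt_pos.2 hpos
    have habs : |ε * (-(1 / √(1 - (F u / A) ^ 2)) * (deriv F u / A) / κ)| = 1 := by
      rw [abs_mul, hε, abs_div, abs_mul, abs_neg, abs_div (deriv F u), hu hu', abs_of_pos hA,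
        abs_of_pos hκ, abs_of_pos (one_div_pos.2 hsp), hsq]
      generalize √(1 - (F u / A) ^ 2) = r at hsp
      field_simp
    have hnn : 0 ≤ deriv (fun u => ε * (Real.arccos (F u / A) / κ)) u := by
      have hopen : Icc s t ∈ nhds u := Icc_mem_nhds hmem.1 (lt_of_le_of_ne hmem.2 hut)
      rw [← derivWithin_of_mem_nhds hopen]
      exact hm.derivWithin_nonneg
    rw [h2.deriv] at hnn ⊢
    rwa [abs_of_nonneg hnn] at habs
  rw [hone]
  simp

theorem abs_arccos_sub_eq (h : IsEikonal F A κ l) {s t : ℝ} (hs : s ∈ Icc 0 l) (ht : t ∈ Icc 0 l)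
    (hinj : InjOn (fun u => Real.arccos (F u / A) / κ) (uIcc s t)) :
    |Real.arccos (F t / A) / κ - Real.arccos (F s / A) / κ| = |t - s| := by
  wlog hst : s ≤ t generalizing s t
  · rw [abs_sub_comm, abs_sub_comm t]
    exact this ht hs (by rwa [uIcc_comm]) (le_of_not_ge hst)
  rw [uIcc_of_le hst] at hinj
  have hsub : Icc s t ⊆ Icc 0 l := Icc_subset_Icc hs.1 ht.2
  have hcont : ContinuousOn (fun u => Real.arccos (F u / A) / κ) (Icc s t) := by
    have h1 := h.ac.continuousOn
    rw [uIcc_of_le h.len.le] at h1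
    exact (Real.continuous_arccos.comp_continuousOn ((h1.mono hsub).div_const A)).div_const κ
  rcases hcont.strictMonoOn_of_injOn_Icc' hst hinj with hm | hm
  · have := h.arccos_sub_eq_of_monotoneOn hs ht hst (ε := 1) abs_one
      (by simpa using hm.monotoneOn)
    rw [one_mul, one_mul] at this
    rw [this]
  · have := h.arccos_sub_eq_of_monotoneOn hs ht hst (ε := -1) (by simp)
      (by simpa using hm.antitoneOn.neg)
    rw [abs_sub_comm, ← this]
    congr 1
    ring

end IsEikonal

namespace MetricGraph

section Height

variable {E : Type*} {G : MetricGraph E} [Countable E] {f : G.Point → ℝ} {A κ : ℝ}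

theorem isEikonal_onEdge (hf : Continuous f)
    (hac : ∀ e, AbsolutelyContinuousOnInterval (onEdge f e) 0 (G.length e)) (hA : 0 < A)
    (hκ : 0 < κ) (hb : ∀ᵐ x ∂G.lengthMeasure, |val f x| ≤ A)
    (heq : ∀ᵐ x ∂G.lengthMeasure, |der f x| = κ * √(A ^ 2 - val f x ^ 2))
    (hnull : ∀ c, ∀ᵐ x ∂G.lengthMeasure, val f x ≠ c) (e : E) :
    IsEikonal (onEdge f e) A κ (G.length e) where
  amp := hA
  freq := hκ
  len := G.length_pos e
  ac := hac e
  bound := by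
    have h1 := ae_lengthMeasure_iff.1 hb e
    have h2 : Icc 0 (G.length e) ⊆ {t | |onEdge f e t| ≤ A} := by
      rw [← closure_Ioo (G.length_pos e).ne]
      refine closure_minimal ?_ (isClosed_le (continuous_onEdge hf e).abs continuous_const)
      intro t ht
      -- the exceptional set is open and null in the open edge, hence empty there
      by_contra hcon
      have hopen : IsOpen (Ioo 0 (G.length e) ∩ {t | A < |onEdge f e t|}) :=
        isOpen_Ioo.inter (isOpen_lt continuous_const (continuous_onEdge hf e).abs)
      refine (hopen.measure_pos volume ⟨t, ht, (not_le.1 hcon : A < _)⟩).ne' ?_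
      rw [ae_restrict_iff' measurableSet_Ioc] at h1
      refine measure_mono_null ?_ (ae_iff.1 h1)
      intro u hu hgood
      exact absurd (hgood (Ioo_subset_Ioc_self hu.1)) (not_le.2 hu.2)
    exact h2
  eq := (ae_restrict_iff' measurableSet_Ioc).1 (ae_lengthMeasure_iff.1 heq e)
  null c := (ae_restrict_iff' measurableSet_Ioc).1 (ae_lengthMeasure_iff.1 (hnull c) e)

/-- The phase of a solution of the eikonal equation with at most two points on almost every level is a
height. -/
theorem isHeight_arccos (hf : Continuous f)
    (hac : ∀ e, AbsolutelyContinuousOnInterval (onEdge f e) 0 (G.length e)) (hA : 0 < A)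
    (hκ : 0 < κ) (hb : ∀ᵐ x ∂G.lengthMeasure, |val f x| ≤ A)
    (heq : ∀ᵐ x ∂G.lengthMeasure, |der f x| = κ * √(A ^ 2 - val f x ^ 2))
    (hnull : ∀ c, ∀ᵐ x ∂G.lengthMeasure, val f x ≠ c)
    (hcr : ∀ᵐ c : ℝ, c ∈ Ioo (-A) A → crossings f c ≤ 2) :
    IsHeight fun p => Real.arccos (f p / A) / κ := by
  have hE := isEikonal_onEdge hf hac hA hκ hb heq hnull
  have hedge : ∀ e t, onEdge (fun p => Real.arccos (f p / A) / κ) e t =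
      Real.arccos (onEdge f e t / A) / κ := fun e t => rfl
  have hbd : ∀ p, f p / A ∈ Icc (-1 : ℝ) 1 := by
    intro p
    obtain ⟨e, s, rfl⟩ := exists_pt_eq p
    rw [← onEdge_coe f]
    exact (hE e).div_mem s.2
  have hinv : ∀ {p : G.Point} {c : ℝ}, Real.arccos (f p / A) / κ = c →
      f p = A * Real.cos (κ * c) := by
    rintro p c rfl
    rw [mul_div_cancel₀ _ hκ.ne', Real.cos_arccos (hbd p).1 (hbd p).2]
    field_simp
  refine ⟨?_, ?_, ?_, ?_⟩
  · refine lipschitzWith_one_of_edges fun e s t => ?_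
    rw [edist_dist, edist_dist]
    refine ENNReal.ofReal_le_ofReal ?_
    have := (hE e).abs_arccos_sub_le t.2 s.2
    rw [onEdge_coe, onEdge_coe] at this
    exact this
  · intro e s hs t ht hinj
    exact (hE e).abs_arccos_sub_eq hs ht hinj
  · intro e c
    have h1 := (hE e).null (A * Real.cos (κ * c))
    refine measure_mono_null (t := {0} ∪ {t | ¬(t ∈ Ioc 0 (G.length e) →
      onEdge f e t ≠ A * Real.cos (κ * c))}) ?_ (measure_union_null (measure_singleton 0) h1)
    rintro t ⟨ht, htc⟩
    rcases eq_or_lt_of_le ht.1 with h0 | h0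
    · exact Or.inl h0.symm
    · refine Or.inr fun hne => hne ⟨h0, ht.2⟩ ?_
      have h2 : Real.arccos (onEdge f e t / A) / κ = c := htc
      rw [onEdge_of_mem f e ht] at h2 ⊢
      exact hinv h2
  · have hthin : ∀ c, crossings f (A * Real.cos (κ * c)) ≤ 2 →
        c ∈ thinLevels fun p => Real.arccos (f p / A) / κ := by
      classical
      intro c hc p q r hp hq hr
      obtain ⟨ep, sp, rfl⟩ := exists_pt_eq p
      obtain ⟨eq, sq, rfl⟩ := exists_pt_eq q
      obtain ⟨er, sr, rfl⟩ := exists_pt_eq r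
      by_contra! hne
      obtain ⟨h1, h2, h3⟩ := hne
      have hpt : ∀ {e e' : E} {s : Icc 0 (G.length e)} {s' : Icc 0 (G.length e')},
          G.pt e s ≠ G.pt e' s' → (⟨e, s⟩ : G.EdgeSpace) ≠ ⟨e', s'⟩ := by
        rintro e e' s s' hne heq
        exact hne (congrArg (fun x : G.EdgeSpace => G.pt x.1 x.2) heq)
      have hcard := card_le_crossings (f := f) (c := A * Real.cos (κ * c))
        ({⟨ep, sp⟩, ⟨eq, sq⟩, ⟨er, sr⟩} : Finset G.EdgeSpace) (by
          intro x hx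
          simp only [Finset.mem_insert, Finset.mem_singleton] at hx
          rcases hx with rfl | rfl | rfl
          · exact hinv hp
          · exact hinv hq
          · exact hinv hr)
      rw [Finset.card_eq_three.2 ⟨_, _, _, hpt h1, hpt h3, hpt h2, rfl⟩] at hcard
      have := hcard.trans hc
      norm_num at this
    have hout : ∀ c, c ∉ Icc 0 (Real.pi / κ) →
        c ∈ thinLevels fun p => Real.arccos (f p / A) / κ := by
      intro c hc p q r hp
      refine absurd ?_ hc
      rw [← hp]
      exact ⟨div_nonneg (Real.arccos_nonneg _) hκ.le, div_le_div_of_nonneg_right (Real.arccos_le_pi _) hκ.le⟩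
    refine dense_iff_inter_open.2 fun U hU hUne => ?_
    by_cases hin : (U ∩ Ioo 0 (Real.pi / κ)).Nonempty
    · obtain ⟨c, hc⟩ := hin
      have hφ : Continuous fun v : ℝ => Real.arccos (v / A) / κ := by
        have := Real.continuous_arccos
        fun_prop
      have hkc : κ * c ∈ Ioo 0 Real.pi := by
        refine ⟨mul_pos hκ hc.2.1, ?_⟩
        have := hc.2.2
        rw [lt_div_iff₀ hκ] at this
        linarith
      -- the levels of the height near `c` correspond to an open set of levels of `f`
      have hV : IsOpen ((fun v : ℝ => Real.arccos (v / A) / κ) ⁻¹' U ∩ Ioo (-A) A) :=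
        (hU.preimage hφ).inter isOpen_Ioo
      have hcos1 : Real.cos (κ * c) < 1 := by
        rw [← Real.cos_zero]
        exact Real.cos_lt_cos_of_nonneg_of_le_pi le_rfl hkc.2.le hkc.1
      have hcos2 : -1 < Real.cos (κ * c) := by
        rw [← Real.cos_pi]
        exact Real.cos_lt_cos_of_nonneg_of_le_pi hkc.1.le le_rfl hkc.2
      have hne : ((fun v : ℝ => Real.arccos (v / A) / κ) ⁻¹' U ∩ Ioo (-A) A).Nonempty := by
        refine ⟨A * Real.cos (κ * c), ?_, by nlinarith, by nlinarith⟩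
        have : Real.arccos (A * Real.cos (κ * c) / A) / κ = c := by
          rw [mul_div_cancel_left₀ _ hA.ne', Real.arccos_cos hkc.1.le hkc.2.le,
            mul_div_cancel_left₀ _ hκ.ne']
        rw [mem_preimage, this]
        exact hc.1
      obtain ⟨v, hv, hv'⟩ := (Measure.dense_of_ae hcr).inter_open_nonempty _ hV hne
      refine ⟨_, hv.1, hthin _ ?_⟩
      have h1 : v / A ∈ Icc (-1 : ℝ) 1 :=
        ⟨by rw [le_div_iff₀ hA]; linarith [hv.2.1], by rw [div_le_iff₀ hA]; linarith [hv.2.2]⟩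
      rw [mul_div_cancel₀ _ hκ.ne', Real.cos_arccos h1.1 h1.2, mul_div_cancel₀ _ hA.ne']
      exact hv' hv.2
    · obtain ⟨c, hc⟩ := hUne
      by_contra! hcon
      have hUsub : U ⊆ Icc 0 (Real.pi / κ) \ Ioo 0 (Real.pi / κ) := fun u hu =>
        ⟨by_contra fun h => hcon.subset ⟨hu, hout u h⟩, fun h => hin ⟨u, hu, h⟩⟩
      rw [Icc_sdiff_Ioo_same (div_pos Real.pi_pos hκ).le] at hUsub
      exact (hU.measure_pos volume ⟨c, hc⟩).ne'
        (measure_mono_null hUsub ((Set.toFinite _).measure_zero _))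

end Height

/-! ### The Sobolev space and its quadratic forms -/

section Forms

variable {E : Type*} {G : MetricGraph E} {f g : G.Point → ℝ} {L : ℝ}

/-- The `L²` inner product of two functions on the graph. -/
noncomputable def massForm (f g : G.Point → ℝ) : ℝ := ∫ x, val f x * val g x ∂G.lengthMeasure

/-- The integral of a function over the graph. -/
noncomputable def total (f : G.Point → ℝ) : ℝ := ∫ x, val f x ∂G.lengthMeasure

theorem val_lin (a b : ℝ) (f g : G.Point → ℝ) (x : Σ _ : E, ℝ) :
    val (fun p => a * f p + b * g p) x = a * val f x + b * val g x := rfl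

theorem der_const (c : ℝ) : der (fun _ : G.Point => c) = 0 := by
  funext x
  exact congrFun (deriv_const' c) x.2

theorem massForm_comm (f g : G.Point → ℝ) : massForm f g = massForm g f := by
  simp only [massForm, mul_comm]

theorem energy_comm (f g : G.Point → ℝ) : energy f g = energy g f := by
  simp only [energy, innerL2, mul_comm]

theorem val_const (c : ℝ) : val (fun _ : G.Point => c) = fun _ => c := rfl

theorem energy_const_left (c : ℝ) (f : G.Point → ℝ) : energy (fun _ : G.Point => c) f = 0 := by
  have : edgeDeriv (fun _ : G.Point => c) = fun _ _ => 0 := by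
    funext e t
    exact congrFun (deriv_const' c) t
  simp [energy, innerL2, this]

theorem massForm_self (f : G.Point → ℝ) :
    massForm f f = ∫ x, val f x ^ 2 ∂G.lengthMeasure := by simp only [massForm, pow_two]

theorem massForm_const_left (c : ℝ) (f : G.Point → ℝ) :
    massForm (fun _ : G.Point => c) f = c * total f := by
  rw [massForm, val_const, integral_const_mul, total]

theorem massForm_self_nonneg (f : G.Point → ℝ) : 0 ≤ massForm f f := by
  rw [massForm_self]
  exact integral_nonneg fun _ => sq_nonneg _

theorem total_const (hL : 0 ≤ L) (hlen : HasSum G.length L) (c : ℝ) :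
    total (fun _ : G.Point => c) = c * L := by
  rw [total, val_const, integral_const, measureReal_def, lengthMeasure_univ hlen,
    ENNReal.toReal_ofReal hL, smul_eq_mul, mul_comm]

/-- The Hölder estimate on an edge. -/
theorem abs_onEdge_sub_le (hf : MemH1 f) (e : E) {s t : ℝ} (hs : s ∈ Icc 0 (G.length e))
    (ht : t ∈ Icc 0 (G.length e)) :
    |onEdge f e t - onEdge f e s| ≤ √(energy f f * |t - s|) := by
  wlog hst : s ≤ t generalizing s t
  · rw [abs_sub_comm, abs_sub_comm t]
    exact this ht hs (le_of_not_ge hst)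
  have hsub : Ioc s t ⊆ Ioc 0 (G.length e) := Ioc_subset_Ioc hs.1 ht.2
  have hac : AbsolutelyContinuousOnInterval (onEdge f e) s t :=
    (hf.absolutelyContinuous e).mono
      (by rw [uIcc_of_le hst, uIcc_of_le (G.length_pos e).le]; exact Icc_subset_Icc hs.1 ht.2)
  have hint := hac.intervalIntegrable_deriv
  have hsq : IntegrableOn (fun u => edgeDeriv f e u ^ 2) (Ioc 0 (G.length e)) :=
    (hf.memL2_deriv.memLp e).integrable_sq
  have hle : ∫ u in s..t, edgeDeriv f e u ^ 2 ≤ energy f f := by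
    have h1 : ∫ u in s..t, edgeDeriv f e u ^ 2 ≤
        ∫ u in (0 : ℝ)..(G.length e), edgeDeriv f e u ^ 2 := by
      rw [intervalIntegral.integral_of_le hst, intervalIntegral.integral_of_le (G.length_pos e).le]
      exact setIntegral_mono_set hsq (Filter.Eventually.of_forall fun _ => sq_nonneg _)
        (Filter.Eventually.of_forall hsub)
    refine h1.trans ?_
    have h2 := hf.memL2_deriv.summable.le_tsum e fun e' _ =>
      intervalIntegral.integral_nonneg (G.length_pos e').le fun _ _ => sq_nonneg _
    simpa only [energy, innerL2, pow_two] using h2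
  rw [← hac.integral_deriv_eq_sub]
  refine Real.le_sqrt_of_sq_le ?_
  rw [sq_abs, abs_of_nonneg (sub_nonneg.2 hst)]
  change (∫ u in s..t, edgeDeriv f e u) ^ 2 ≤ _
  set I := ∫ u in s..t, edgeDeriv f e u with hI
  set D := ∫ u in s..t, edgeDeriv f e u ^ 2 with hD
  have isq : IntervalIntegrable (fun u => edgeDeriv f e u ^ 2) volume s t :=
    (intervalIntegrable_iff_integrableOn_Ioc_of_le hst).2 (hsq.mono_set hsub)
  have h1 : ∀ r : ℝ, 0 ≤ D - 2 * r * I + r ^ 2 * (t - s) := by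
    intro r
    have h2 : ∫ u in s..t, (edgeDeriv f e u - r) ^ 2 = D - 2 * r * I + r ^ 2 * (t - s) := by
      have e3 : ∫ _ in s..t, r ^ 2 = r ^ 2 * (t - s) := by
        rw [intervalIntegral.integral_const, smul_eq_mul, mul_comm]
      have i2 : IntervalIntegrable (fun u => 2 * r * edgeDeriv f e u) volume s t :=
        hint.const_mul _
      rw [hD, hI, ← e3, ← intervalIntegral.integral_const_mul, ← intervalIntegral.integral_sub isq
        i2, ← intervalIntegral.integral_add (isq.sub i2) intervalIntegrable_const]
      refine intervalIntegral.integral_congr fun u _ => ?_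
      ring
    rw [← h2]
    exact intervalIntegral.integral_nonneg hst fun _ _ => sq_nonneg _
  rcases eq_or_lt_of_le hst with h0 | h0
  · rw [hI, h0]
    simp
  · have h2 := h1 (I / (t - s))
    have h4 : t - s ≠ 0 := (sub_pos.2 h0).ne'
    have h3 : D - 2 * (I / (t - s)) * I + (I / (t - s)) ^ 2 * (t - s) = D - I ^ 2 / (t - s) := by
      field_simp
      ring
    rw [h3, sub_nonneg, div_le_iff₀ (sub_pos.2 h0)] at h2
    exact h2.trans (mul_le_mul_of_nonneg_right hle (sub_nonneg.2 hst))

variable [Countable E]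

theorem energy_eq_integral (hf : MemH1 f) (hg : MemH1 g) :
    energy f g = ∫ x, der f x * der g x ∂G.lengthMeasure :=
  innerL2_eq_integral hf.memL2_deriv hg.memL2_deriv

theorem memH1_iff : MemH1 f ↔ Continuous f ∧
    (∀ e, AbsolutelyContinuousOnInterval (onEdge f e) 0 (G.length e)) ∧
    MemLp (val f) 2 G.lengthMeasure ∧ MemLp (der f) 2 G.lengthMeasure :=
  ⟨fun h => ⟨h.continuous, h.absolutelyContinuous, h.memLp_val, h.memLp_der⟩,
    fun h => ⟨h.1, h.2.1, memL2_iff_memLp.2 h.2.2.1, memL2_iff_memLp.2 h.2.2.2⟩⟩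

theorem der_lin (hf : ∀ e, AbsolutelyContinuousOnInterval (onEdge f e) 0 (G.length e))
    (hg : ∀ e, AbsolutelyContinuousOnInterval (onEdge g e) 0 (G.length e)) (a b : ℝ) :
    der (fun p => a * f p + b * g p) =ᵐ[G.lengthMeasure] fun x => a * der f x + b * der g x := by
  change ∀ᵐ x ∂G.lengthMeasure, _
  rw [ae_lengthMeasure_iff]
  intro e
  rw [ae_restrict_iff' measurableSet_Ioc]
  filter_upwards [(hf e).ae_differentiableAt, (hg e).ae_differentiableAt] with t h1 h2 ht
  have hmem : t ∈ uIcc 0 (G.length e) := by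
    rw [uIcc_of_le (G.length_pos e).le]
    exact Ioc_subset_Icc_self ht
  exact (((h1 hmem).hasDerivAt.const_mul a).add ((h2 hmem).hasDerivAt.const_mul b)).deriv

theorem MemH1.lin (hf : MemH1 f) (hg : MemH1 g) (a b : ℝ) : MemH1 fun p => a * f p + b * g p where
  continuous := (hf.continuous.const_mul a).add (hg.continuous.const_mul b)
  absolutelyContinuous e :=
    ((hf.absolutelyContinuous e).const_mul a).add ((hg.absolutelyContinuous e).const_mul b)
  memL2 := memL2_iff_memLp.2 ((hf.memLp_val.const_mul a).add (hg.memLp_val.const_mul b))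
  memL2_deriv := memL2_iff_memLp.2 (MemLp.ae_eq
    (der_lin hf.absolutelyContinuous hg.absolutelyContinuous a b).symm
    ((hf.memLp_der.const_mul a).add (hg.memLp_der.const_mul b)))

theorem memH1_const (hlen : HasSum G.length L) (c : ℝ) : MemH1 fun _ : G.Point => c := by
  have := isFiniteMeasure_lengthMeasure hlen
  refine memH1_iff.2 ⟨continuous_const, fun e => ?_, memLp_const c, ?_⟩
  · exact (LipschitzWith.const c).lipschitzOnWith.absolutelyContinuousOnInterval
  · rw [der_const]
    exact MemLp.zero

theorem massForm_lin_left (hf : MemH1 f) (hg : MemH1 g) {v : G.Point → ℝ} (hv : MemH1 v)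
    (a b : ℝ) : massForm (fun p => a * f p + b * g p) v = a * massForm f v + b * massForm g v := by
  have i1 : Integrable (fun x => a * (val f x * val v x)) G.lengthMeasure :=
    (hf.memLp_val.integrable_mul hv.memLp_val).const_mul a
  have i2 : Integrable (fun x => b * (val g x * val v x)) G.lengthMeasure :=
    (hg.memLp_val.integrable_mul hv.memLp_val).const_mul b
  rw [massForm, massForm, massForm, ← integral_const_mul, ← integral_const_mul,
    ← integral_add i1 i2]
  refine integral_congr_ae (Filter.Eventually.of_forall fun x => ?_)
  simp only [val_lin]
  ring

theorem energy_lin_left (hf : MemH1 f) (hg : MemH1 g) {v : G.Point → ℝ} (hv : MemH1 v)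
    (a b : ℝ) : energy (fun p => a * f p + b * g p) v = a * energy f v + b * energy g v := by
  have i1 : Integrable (fun x => a * (der f x * der v x)) G.lengthMeasure :=
    (hf.memLp_der.integrable_mul hv.memLp_der).const_mul a
  have i2 : Integrable (fun x => b * (der g x * der v x)) G.lengthMeasure :=
    (hg.memLp_der.integrable_mul hv.memLp_der).const_mul b
  rw [energy_eq_integral (hf.lin hg a b) hv, energy_eq_integral hf hv, energy_eq_integral hg hv,
    ← integral_const_mul, ← integral_const_mul, ← integral_add i1 i2]
  refine integral_congr_ae ?_
  filter_upwards [der_lin hf.absolutelyContinuous hg.absolutelyContinuous a b] with x hx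
  rw [hx]
  ring

theorem massForm_lin_self (hf : MemH1 f) (hg : MemH1 g) (a b : ℝ) :
    massForm (fun p => a * f p + b * g p) (fun p => a * f p + b * g p) =
      a ^ 2 * massForm f f + 2 * a * b * massForm f g + b ^ 2 * massForm g g := by
  rw [massForm_lin_left hf hg (hf.lin hg a b), massForm_comm f, massForm_comm g,
    massForm_lin_left hf hg hf, massForm_lin_left hf hg hg, massForm_comm g f]
  ring

theorem energy_lin_self (hf : MemH1 f) (hg : MemH1 g) (a b : ℝ) :
    energy (fun p => a * f p + b * g p) (fun p => a * f p + b * g p) =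
      a ^ 2 * energy f f + 2 * a * b * energy f g + b ^ 2 * energy g g := by
  rw [energy_lin_left hf hg (hf.lin hg a b), energy_comm f, energy_comm g,
    energy_lin_left hf hg hf, energy_lin_left hf hg hg, energy_comm g f]
  ring

theorem MemH1.integrable_val (hlen : HasSum G.length L) (hf : MemH1 f) :
    Integrable (val f) G.lengthMeasure := by
  have := isFiniteMeasure_lengthMeasure hlen
  exact hf.memLp_val.integrable one_le_two

theorem MemH1.integrable_der (hlen : HasSum G.length L) (hf : MemH1 f) :
    Integrable (der f) G.lengthMeasure := by
  have := isFiniteMeasure_lengthMeasure hlen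
  exact hf.memLp_der.integrable one_le_two

theorem total_lin (hlen : HasSum G.length L) (hf : MemH1 f) (hg : MemH1 g) (a b : ℝ) :
    total (fun p => a * f p + b * g p) = a * total f + b * total g := by
  rw [total, total, total, ← integral_const_mul, ← integral_const_mul,
    ← integral_add ((hf.integrable_val hlen).const_mul a) ((hg.integrable_val hlen).const_mul b)]
  rfl

theorem energy_self (hf : MemH1 f) : energy f f = ∫ x, der f x ^ 2 ∂G.lengthMeasure := by
  simp only [energy_eq_integral hf hf, pow_two]

theorem energy_self_nonneg (hf : MemH1 f) : 0 ≤ energy f f := by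
  rw [energy_self hf]
  exact integral_nonneg fun _ => sq_nonneg _

theorem massForm_self_pos (hf : MemH1 f) (hne : f ≠ 0) : 0 < massForm f f := by
  refine lt_of_le_of_ne (massForm_self_nonneg f) fun h0 => ?_
  rw [massForm_self, eq_comm, integral_eq_zero_iff_of_nonneg (fun _ => sq_nonneg _)
    hf.memLp_val.integrable_sq] at h0
  have h1 := ae_lengthMeasure_iff.1 h0
  refine hne (funext fun p => ?_)
  obtain ⟨e, s, rfl⟩ := exists_pt_eq p
  have hc := continuous_onEdge hf.continuous e
  have h2 : Icc 0 (G.length e) ⊆ {t | onEdge f e t = 0} := by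
    rw [← closure_Ioo (G.length_pos e).ne]
    refine closure_minimal ?_ (isClosed_eq hc continuous_const)
    intro t ht
    by_contra hcon
    have hopen : IsOpen (Ioo 0 (G.length e) ∩ {t | onEdge f e t ≠ 0}) :=
      isOpen_Ioo.inter (isOpen_ne_fun hc continuous_const)
    refine (hopen.measure_pos volume ⟨t, ht, hcon⟩).ne' ?_
    have h3 := h1 e
    rw [ae_restrict_iff' measurableSet_Ioc] at h3
    refine measure_mono_null ?_ (ae_iff.1 h3)
    intro u hu hgood
    exact hu.2 (pow_eq_zero_iff (two_ne_zero) |>.1 (hgood (Ioo_subset_Ioc_self hu.1)))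
  have h3 := h2 s.2
  change onEdge f e s = 0 at h3
  rwa [onEdge_coe] at h3

theorem integral_abs_der_le (hL : 0 ≤ L) (hlen : HasSum G.length L) (hf : MemH1 f) :
    ∫ x, |der f x| ∂G.lengthMeasure ≤ √(L * energy f f) := by
  have := isFiniteMeasure_lengthMeasure hlen
  refine Real.le_sqrt_of_sq_le ?_
  set I := ∫ x, |der f x| ∂G.lengthMeasure with hI
  -- the variance of `|f'|` is nonnegative
  have h1 : ∀ r : ℝ, 0 ≤ energy f f - 2 * r * I + r ^ 2 * L := by
    intro r
    have h2 : ∫ x, (|der f x| - r) ^ 2 ∂G.lengthMeasure = energy f f - 2 * r * I + r ^ 2 * L := by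
      have i1 := hf.memLp_der.integrable_sq
      have i2 := (hf.integrable_der hlen).abs.const_mul (2 * r)
      have i3 : Integrable (fun _ => r ^ 2) G.lengthMeasure := integrable_const (r ^ 2)
      have e3 : ∫ _, r ^ 2 ∂G.lengthMeasure = r ^ 2 * L := by
        rw [← total_const hL hlen]
        rfl
      have i12 : Integrable (fun x => der f x ^ 2 - 2 * r * |der f x|) G.lengthMeasure := i1.sub i2
      rw [energy_self hf, hI, ← integral_const_mul, ← e3, ← integral_sub i1 i2,
        ← integral_add i12 i3]
      refine integral_congr_ae (Filter.Eventually.of_forall fun x => ?_)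
      have := sq_abs (der f x)
      linear_combination this
    rw [← h2]
    exact integral_nonneg fun _ => sq_nonneg _
  rcases eq_or_lt_of_le hL with h0 | h0
  · have h2 : I = 0 := by
      have : G.lengthMeasure = 0 := by
        rw [← Measure.measure_univ_eq_zero, lengthMeasure_univ hlen, ← h0, ENNReal.ofReal_zero]
      rw [hI, this, integral_zero_measure]
    rw [h2, ← h0]
    simp
  · have h2 := h1 (I / L)
    have h3 : energy f f - 2 * (I / L) * I + (I / L) ^ 2 * L = energy f f - I ^ 2 / L := by
      field_simp
      ring
    rw [h3, sub_nonneg, div_le_iff₀ h0] at h2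
    linarith

theorem abs_sub_le_sqrt (hdc : G.DoublyConnected) (hL : 0 ≤ L) (hlen : HasSum G.length L)
    (hf : MemH1 f) (x y : G.Point) : |f x - f y| ≤ √(L * energy f f) := by
  have h1 := two_mul_abs_sub_le hdc hf.continuous hf.absolutelyContinuous
    (hf.integrable_der hlen) x y
  have h2 := integral_abs_der_le hL hlen hf
  have := abs_nonneg (f x - f y)
  linarith

/-- A function of mean zero is bounded by its oscillation. -/
theorem abs_le_sqrt (hdc : G.DoublyConnected) (hL : 0 < L) (hlen : HasSum G.length L)
    (hf : MemH1 f) (h0 : total f = 0) (p : G.Point) : |f p| ≤ √(L * energy f f) := by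
  have := isFiniteMeasure_lengthMeasure hlen
  have h1 : ∫ x, val (fun q => 1 * f q + (-f p) * 1) x ∂G.lengthMeasure = -f p * L := by
    have := total_lin hlen hf (memH1_const hlen 1) 1 (-f p)
    rw [h0, total_const hL.le hlen] at this
    simpa [total] using this
  have h2 : ‖∫ x, val (fun q => 1 * f q + (-f p) * 1) x ∂G.lengthMeasure‖ ≤
      √(L * energy f f) * G.lengthMeasure.real univ := by
    refine norm_integral_le_of_norm_le_const (ae_le_of_forall_le fun q => ?_)
    have := abs_sub_le_sqrt hdc hL.le hlen hf q p
    rwa [one_mul, mul_one, ← sub_eq_add_neg]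
  rw [h1, measureReal_def, lengthMeasure_univ hlen, ENNReal.toReal_ofReal hL.le, norm_mul, norm_neg,
    Real.norm_of_nonneg hL.le] at h2
  exact le_of_mul_le_mul_right h2 hL

theorem MemH1.isTrial (hdc : G.DoublyConnected) (hL : 0 < L) (hlen : HasSum G.length L)
    (hf : MemH1 f) (h0 : total f = 0) : IsTrial f (√(L * energy f f)) L where
  memH1 := hf
  connected := hdc
  centered := isCentered_map_val hL hlen hf.continuous (Real.sqrt_nonneg _)
    (abs_le_sqrt hdc hL hlen hf h0) h0

theorem mul_massForm_le_energy (hdc : G.DoublyConnected) (hL : 0 < L) (hlen : HasSum G.length L)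
    (hf : MemH1 f) (h0 : total f = 0) :
    4 * Real.pi ^ 2 / L ^ 2 * massForm f f ≤ energy f f := by
  rw [massForm_self, energy_self hf]
  exact (hf.isTrial hdc hL hlen h0).mul_integral_sq_le

/-- A doubly connected, locally finite graph on which the lower bound is attained is a symmetric
necklace. -/
theorem isSymmetricNecklace_of_energy_le (hfin : G.LocallyFinite) (hdc : G.DoublyConnected)
    (hL : 0 < L) (hlen : HasSum G.length L) (hf : MemH1 f) (h0 : total f = 0) (hne : f ≠ 0)
    (hle : energy f f ≤ 4 * Real.pi ^ 2 / L ^ 2 * massForm f f) : G.IsSymmetricNecklace := by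
  have hpos := massForm_self_pos hf hne
  rw [energy_self hf, massForm_self] at hle
  rw [massForm_self] at hpos
  obtain ⟨A, hA, h1, h2, h3, h4⟩ := (hf.isTrial hdc hL hlen h0).exists_eikonal hpos hle
  have hE := nonempty_of_hasSum_length hL hlen
  exact (isHeight_arccos hf.continuous hf.absolutelyContinuous hA
    (div_pos (by positivity) hL) h1 h2 h3 h4).isSymmetricNecklace hfin hdc (Classical.arbitrary E)

end Forms

end MetricGraph

theorem AbsolutelyContinuousOnInterval.congr {F F' : ℝ → ℝ} {a b : ℝ}
    (hF : AbsolutelyContinuousOnInterval F a b) (h : EqOn F F' (uIcc a b)) :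
    AbsolutelyContinuousOnInterval F' a b := by
  rw [absolutelyContinuousOnInterval_iff] at hF ⊢
  intro ε hε
  obtain ⟨δ, hδ, h1⟩ := hF ε hε
  refine ⟨δ, hδ, fun I hI hsum => ?_⟩
  have h2 := h1 I hI hsum
  rwa [Finset.sum_congr rfl fun i hi => by rw [h (hI.1 i hi).1, h (hI.1 i hi).2]] at h2

namespace MetricGraph

/-! ### Existence of a minimiser of the Rayleigh quotient -/

section Existence

variable {E : Type*} {G : MetricGraph E} {f g : G.Point → ℝ} {L : ℝ}

theorem lipschitzWith_onEdge {K : NNReal} (hf : LipschitzWith K f) (e : E) :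
    LipschitzWith K (onEdge f e) := by
  have h1 : LipschitzWith (K * 1) fun t => f (G.pt e t) := hf.comp (lipschitzWith_pt e)
  have h2 := h1.comp (LipschitzWith.projIcc (G.length_pos e).le)
  rwa [mul_one, mul_one] at h2

/-- The distance to a point, truncated at one, which also covers points at infinite distance. -/
noncomputable def truncDist (x p : G.Point) : ℝ := (min (edist p x) 1).toReal

theorem truncDist_le_one (x p : G.Point) : |truncDist x p| ≤ 1 := by
  rw [truncDist, abs_of_nonneg ENNReal.toReal_nonneg]
  exact ENNReal.toReal_le_of_le_ofReal zero_le_one (by simp)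

theorem lipschitzWith_truncDist (x : G.Point) : LipschitzWith 1 (truncDist x) := by
  have hfin : ∀ p : G.Point, min (edist p x) 1 ≠ ⊤ := fun p =>
    ne_top_of_le_ne_top ENNReal.one_ne_top (min_le_right _ _)
  have key : ∀ p q : G.Point, edist p q ≠ ⊤ →
      truncDist x p - truncDist x q ≤ (edist p q).toReal := by
    intro p q hpq
    have h1 : min (edist p x) 1 ≤ edist p q + min (edist q x) 1 := by
      rcases le_total (edist q x) 1 with h | h
      · rw [min_eq_left h]
        exact (min_le_left _ _).trans (edist_triangle _ _ _)
      · rw [min_eq_right h]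
        exact (min_le_right _ _).trans le_add_self
    have h2 := ENNReal.toReal_mono (ENNReal.add_ne_top.2 ⟨hpq, hfin q⟩) h1
    rw [ENNReal.toReal_add hpq (hfin q)] at h2
    unfold truncDist
    linarith
  intro p q
  rw [ENNReal.coe_one, one_mul]
  rcases eq_or_ne (edist p q) ⊤ with h | h
  · rw [h]
    exact le_top
  · rw [edist_dist, Real.dist_eq]
    refine ENNReal.ofReal_le_of_le_toReal (abs_le.2 ⟨?_, key p q h⟩)
    have := key q p (by rwa [edist_comm])
    rw [edist_comm] at this
    linarith

theorem tendsto_val {w : ℕ → G.Point → ℝ} {v : G.Point → ℝ}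
    (hv : ∀ p, Filter.Tendsto (fun n => w n p) Filter.atTop (nhds (v p))) (x : Σ _ : E, ℝ) :
    Filter.Tendsto (fun n => val (w n) x) Filter.atTop (nhds (val v x)) := hv _

theorem measurable_val_of_tendsto {w : ℕ → G.Point → ℝ} {v : G.Point → ℝ}
    (hw : ∀ n, Continuous (w n))
    (hv : ∀ p, Filter.Tendsto (fun n => w n p) Filter.atTop (nhds (v p))) : Measurable (val v) :=
  measurable_of_tendsto_metrizable (fun n => measurable_val (hw n))
    (tendsto_pi_nhds.2 (tendsto_val hv))

variable [Countable E]

theorem memH1_of_lipschitzWith (hlen : HasSum G.length L) {K : NNReal} (hf : LipschitzWith K f)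
    {C : ℝ} (hC : ∀ p, |f p| ≤ C) : MemH1 f := by
  have := isFiniteMeasure_lengthMeasure hlen
  refine memH1_iff.2 ⟨hf.continuous, fun e => ?_, ?_, ?_⟩
  · exact (lipschitzWith_onEdge hf e).lipschitzOnWith.absolutelyContinuousOnInterval
  · exact MemLp.of_bound (measurable_val hf.continuous).aestronglyMeasurable C
      (ae_le_of_forall_le hC)
  · exact MemLp.of_bound (measurable_der f).aestronglyMeasurable K
      (Filter.Eventually.of_forall fun x => norm_deriv_le_of_lipschitz (lipschitzWith_onEdge hf x.1))

/-- The truncated distance to a vertex, minus its mean, is a nonzero function of mean zero. -/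
theorem exists_admissible (hfin : G.LocallyFinite) (hL : 0 < L) (hlen : HasSum G.length L) :
    ∃ f : G.Point → ℝ, MemH1 f ∧ total f = 0 ∧ massForm f f = 1 := by
  obtain ⟨e⟩ := nonempty_of_hasSum_length hL hlen
  have hl := G.length_pos e
  set x := G.pt e ⟨0, le_rfl, hl.le⟩
  set y := G.pt e ⟨G.length e / 2, by linarith, by linarith⟩
  have hxy : y ≠ x := by
    intro h
    have h1 := eq_of_pt_eq_pt_of_interior h (by simpa using hl) (by simpa using hl)
    have h2 := congrArg Subtype.val (eq_of_heq (Sigma.mk.inj h1).2)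
    simp only at h2
    linarith
  have hf := memH1_of_lipschitzWith hlen (lipschitzWith_truncDist x) (truncDist_le_one x)
  set g : G.Point → ℝ := fun p => 1 * truncDist x p + (-(total (truncDist x) / L)) * 1
  have hg : MemH1 g := hf.lin (memH1_const hlen 1) _ _
  have hg0 : total g = 0 := by
    rw [total_lin hlen hf (memH1_const hlen 1), total_const hL.le hlen]
    field_simp
    ring
  have hgne : g ≠ 0 := by
    intro h
    have h1 : truncDist x x = truncDist x y := by
      have h2 := congrFun h x
      have h3 := congrFun h y
      simp only [g, Pi.zero_apply] at h2 h3
      linarith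
    have h2 : truncDist x x = 0 := by simp [truncDist]
    rw [h2, truncDist, eq_comm, ENNReal.toReal_eq_zero_iff] at h1
    rcases h1 with h1 | h1
    · rcases min_choice (edist y x) 1 with h3 | h3
      · rw [h3] at h1
        exact hxy (eq_of_edist_eq_zero_of_locallyFinite hfin h1)
      · rw [h3] at h1
        exact one_ne_zero h1
    · exact ENNReal.one_ne_top (top_le_iff.1 (h1 ▸ min_le_right _ _))
  have hpos := massForm_self_pos hg hgne
  have hsq := Real.sq_sqrt hpos.le
  have hs := Real.sqrt_pos.2 hpos
  refine ⟨_, hg.lin hg (1 / √(massForm g g)) 0, ?_, ?_⟩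
  · rw [total_lin hlen hg hg, hg0]
    ring
  · rw [massForm_lin_self hg hg]
    nth_rw 2 [← hsq]
    field_simp
    ring

/-- The rational coordinates on an edge are dense: they carry the diagonal argument. -/
theorem exists_rat_mem_near {l s δ : ℝ} (hl : 0 < l) (hs : s ∈ Icc 0 l) (hδ : 0 < δ) :
    ∃ q : ℚ, (q : ℝ) ∈ Icc 0 l ∧ |(q : ℝ) - s| < δ := by
  obtain ⟨q, h1, h2⟩ := exists_rat_btwn (show max 0 (s - δ) < min l (s + δ) from
    max_lt (lt_min hl (by linarith [hs.1])) (lt_min (by linarith [hs.2]) (by linarith)))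
  rw [max_lt_iff] at h1
  rw [lt_min_iff] at h2
  exact ⟨q, ⟨h1.1.le, h2.1.le⟩, abs_lt.2 ⟨by linarith, by linarith⟩⟩

/-- Functions with bounded energy and mean zero have a pointwise convergent subsequence. -/
theorem exists_subseq_tendsto (hdc : G.DoublyConnected) (hL : 0 < L) (hlen : HasSum G.length L)
    {M : ℝ} {u : ℕ → G.Point → ℝ} (hu : ∀ n, MemH1 (u n)) (h0 : ∀ n, total (u n) = 0)
    (hM : ∀ n, energy (u n) (u n) ≤ M) :
    ∃ φ : ℕ → ℕ, StrictMono φ ∧ ∃ v : G.Point → ℝ,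
      ∀ p, Filter.Tendsto (fun n => u (φ n) p) Filter.atTop (nhds (v p)) := by
  have hM0 : 0 ≤ M := (energy_self_nonneg (hu 0)).trans (hM 0)
  have hb : ∀ n p, u n p ∈ Icc (-√(L * M)) (√(L * M)) := fun n p =>
    abs_le.1 ((abs_le_sqrt hdc hL hlen (hu n) (h0 n) p).trans
      (Real.sqrt_le_sqrt (mul_le_mul_of_nonneg_left (hM n) hL.le)))
  obtain ⟨w, -, φ, hφ, hlim⟩ := (isCompact_univ_pi fun _ : E × ℚ =>
    isCompact_Icc (a := -√(L * M)) (b := √(L * M))).tendsto_subseq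
    (x := fun n i => onEdge (u n) i.1 i.2) fun n i _ => hb n _
  rw [tendsto_pi_nhds] at hlim
  have hcauchy : ∀ p, ∃ v, Filter.Tendsto (fun n => u (φ n) p) Filter.atTop (nhds v) := by
    intro p
    obtain ⟨e, s, rfl⟩ := exists_pt_eq p
    refine cauchySeq_tendsto_of_complete (Metric.cauchySeq_iff.2 fun ε hε => ?_)
    obtain ⟨q, hq, hqs⟩ := exists_rat_mem_near (G.length_pos e) s.2
      (show 0 < (ε / 3) ^ 2 / (M + 1) by positivity)
    have hclose : ∀ n, |onEdge (u n) e q - onEdge (u n) e s| ≤ ε / 3 := by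
      intro n
      refine (abs_onEdge_sub_le (hu n) e s.2 hq).trans ?_
      rw [← Real.sqrt_sq (show (0 : ℝ) ≤ ε / 3 by positivity)]
      refine Real.sqrt_le_sqrt ?_
      rw [lt_div_iff₀ (by positivity)] at hqs
      nlinarith [hM n, abs_nonneg ((q : ℝ) - s)]
    obtain ⟨N, hN⟩ := Metric.cauchySeq_iff.1 (hlim (e, q)).cauchySeq (ε / 3) (by positivity)
    refine ⟨N, fun m hm n hn => ?_⟩
    have h1 := hN m hm n hn
    have h2 := abs_le.1 (hclose (φ m))
    have h3 := abs_le.1 (hclose (φ n))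
    simp only [Real.dist_eq, Function.comp_apply, onEdge_coe] at h1 h2 h3 ⊢
    rw [abs_lt] at h1 ⊢
    constructor <;> linarith
  choose v hv using hcauchy
  exact ⟨φ, hφ, v, hv⟩

/-- Bounded pointwise convergence implies convergence of the integrals. -/
theorem tendsto_integral_comp (hlen : HasSum G.length L) {w : ℕ → G.Point → ℝ} {v : G.Point → ℝ}
    {B : ℝ} (hw : ∀ n, Continuous (w n)) (hB : ∀ n p, |w n p| ≤ B)
    (hv : ∀ p, Filter.Tendsto (fun n => w n p) Filter.atTop (nhds (v p))) {φ : ℝ → ℝ → ℝ}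
    (hφ : Continuous fun z : ℝ × ℝ => φ z.1 z.2) {K : ℝ}
    (hK : ∀ a b, |a| ≤ B → |b| ≤ B → |φ a b| ≤ K) :
    Filter.Tendsto (fun n => ∫ x, φ (val (w n) x) (val v x) ∂G.lengthMeasure) Filter.atTop
      (nhds (∫ x, φ (val v x) (val v x) ∂G.lengthMeasure)) := by
  have := isFiniteMeasure_lengthMeasure hlen
  have hm := measurable_val_of_tendsto hw hv
  have hvB : ∀ p, |v p| ≤ B := fun p =>
    le_of_tendsto (hv p).abs (Filter.Eventually.of_forall fun n => hB n p)
  refine tendsto_integral_of_dominated_convergence (fun _ => K) (fun n => ?_)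
    (integrable_const K) (fun n => ?_) (Filter.Eventually.of_forall fun x => ?_)
  · exact (hφ.measurable.comp ((measurable_val (hw n)).prodMk hm)).aestronglyMeasurable
  · filter_upwards [ae_le_of_forall_le (hB n), ae_le_of_forall_le hvB] with x h1 h2
    exact hK _ _ h1 h2
  · exact (hφ.tendsto (val v x, val v x)).comp ((tendsto_val hv x).prodMk_nhds tendsto_const_nhds)

end Existence

/-! ### Limits of minimising sequences -/

section Existence

variable {E : Type*} {G : MetricGraph E} {f g : G.Point → ℝ} {L : ℝ}

/-- Hölder continuity along the edges implies continuity. -/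
theorem continuous_of_abs_onEdge_sub_le (hfin : G.LocallyFinite) {M : ℝ}
    (h : ∀ e, ∀ s ∈ Icc 0 (G.length e), ∀ t ∈ Icc 0 (G.length e),
      |onEdge f e t - onEdge f e s| ≤ √(M * |t - s|)) : Continuous f := by
  rw [continuous_iff_continuousAt]
  intro p
  obtain ⟨r, hr, hstar⟩ := exists_star p (finite_reps hfin p)
  rw [ContinuousAt, Metric.tendsto_nhds]
  intro ε hε
  set δ : ℝ := ε ^ 2 / (|M| + 1) with hδ
  have hδpos : 0 < δ := by positivity
  filter_upwards [Metric.eball_mem_nhds p (lt_min hr (ENNReal.ofReal_pos.2 hδpos))] with q hq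
  rw [Metric.mem_eball, lt_min_iff, edist_comm] at hq
  obtain ⟨e, s, t, rfl, rfl, hst⟩ := hstar q hq.1
  rw [← hst, edist_dist, ENNReal.ofReal_lt_ofReal_iff hδpos, Subtype.dist_eq, Real.dist_eq,
    abs_sub_comm] at hq
  have h1 := h e s s.2 t t.2
  rw [onEdge_coe, onEdge_coe] at h1
  rw [Real.dist_eq]
  refine h1.trans_lt ?_
  rw [Real.sqrt_lt' hε]
  have h2 := hq.2
  rw [hδ, lt_div_iff₀ (by positivity)] at h2
  have h3 : M * |(t : ℝ) - s| ≤ |M| * |(t : ℝ) - s| :=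
    mul_le_mul_of_nonneg_right (le_abs_self M) (abs_nonneg _)
  nlinarith [abs_nonneg ((t : ℝ) - s)]

theorem setIntegral_lengthMeasure {g : (Σ _ : E, ℝ) → ℝ} (hg : Integrable g G.lengthMeasure) (e : E)
    {s t : ℝ} (hs : 0 ≤ s) (hst : s ≤ t) (ht : t ≤ G.length e) :
    ∫ x in Sigma.mk e '' Ioc s t, g x ∂G.lengthMeasure = ∫ u in s..t, g ⟨e, u⟩ := by
  have hm : MeasurableSet (@Sigma.mk E (fun _ => ℝ) e '' Ioc s t) :=
    (measurableEmbedding_mk e).measurableSet_image.2 measurableSet_Ioc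
  rw [← integral_indicator hm]
  have h1 := hasSum_integral_lengthMeasure (hg.indicator hm)
  have h2 : ∀ e', e' ≠ e → ∫ u in (0 : ℝ)..(G.length e'),
      (@Sigma.mk E (fun _ => ℝ) e '' Ioc s t).indicator g ⟨e', u⟩ = 0 := by
    intro e' he'
    have h3 : ∀ u, (@Sigma.mk E (fun _ => ℝ) e '' Ioc s t).indicator g ⟨e', u⟩ = 0 := by
      refine fun u => indicator_of_notMem ?_ g
      rintro ⟨v, -, hv⟩
      exact he' (congrArg Sigma.fst hv).symm
    simp only [h3, intervalIntegral.integral_zero]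
  rw [h1.unique (hasSum_single e h2), intervalIntegral.integral_of_le (G.length_pos e).le,
    intervalIntegral.integral_of_le hst]
  have h3 : (fun u => (@Sigma.mk E (fun _ => ℝ) e '' Ioc s t).indicator g ⟨e, u⟩) =
      (Ioc s t).indicator fun u => g ⟨e, u⟩ := by
    funext u
    simp only [indicator]
    congr 1
    rw [sigma_mk_injective.mem_set_image]
  rw [h3, setIntegral_indicator measurableSet_Ioc,
    inter_eq_self_of_subset_right (Ioc_subset_Ioc hs ht)]

variable [Countable E]

/-- The differences of the values are the integrals of the derivative. -/
theorem sub_eq_setIntegral (hlen : HasSum G.length L) (hf : MemH1 f) (e : E) {s t : ℝ}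
    (hs : 0 ≤ s) (hst : s ≤ t) (ht : t ≤ G.length e) :
    onEdge f e t - onEdge f e s = ∫ x in Sigma.mk e '' Ioc s t, der f x ∂G.lengthMeasure := by
  rw [setIntegral_lengthMeasure (hf.integrable_der hlen) e hs hst ht]
  refine (AbsolutelyContinuousOnInterval.integral_deriv_eq_sub
    ((hf.absolutelyContinuous e).mono ?_)).symm
  rw [uIcc_of_le hst, uIcc_of_le (G.length_pos e).le]
  exact Icc_subset_Icc hs ht

/-- A function whose differences are integrals of a square integrable function belongs to `H¹`, with
this function as its derivative. -/
theorem memH1_of_sub_eq_setIntegral (hlen : HasSum G.length L) (hc : Continuous f) {C : ℝ}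
    (hC : ∀ p, |f p| ≤ C) {g : (Σ _ : E, ℝ) → ℝ} (hg : MemLp g 2 G.lengthMeasure)
    (h : ∀ e s t, 0 ≤ s → s ≤ t → t ≤ G.length e →
      onEdge f e t - onEdge f e s = ∫ x in Sigma.mk e '' Ioc s t, g x ∂G.lengthMeasure) :
    MemH1 f ∧ der f =ᵐ[G.lengthMeasure] g := by
  have := isFiniteMeasure_lengthMeasure hlen
  have hgi := hg.integrable one_le_two
  have hge : ∀ e, IntervalIntegrable (fun u => g ⟨e, u⟩) volume 0 (G.length e) := by
    intro e
    rw [intervalIntegrable_iff_integrableOn_Ioc_of_le (G.length_pos e).le]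
    have h1 := hgi
    rw [lengthMeasure, integrable_sum_measure_iff] at h1
    exact (measurableEmbedding_mk e).integrable_map_iff.1 (h1.1 e)
  have hprim : ∀ e, EqOn (fun t => onEdge f e 0 + ∫ u in (0 : ℝ)..t, g ⟨e, u⟩) (onEdge f e)
      (uIcc 0 (G.length e)) := by
    intro e t ht
    rw [uIcc_of_le (G.length_pos e).le] at ht
    have h1 := h e 0 t le_rfl ht.1 ht.2
    rw [setIntegral_lengthMeasure hgi e le_rfl ht.1 ht.2] at h1
    change onEdge f e 0 + ∫ u in (0 : ℝ)..t, g ⟨e, u⟩ = onEdge f e t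
    linarith
  have hac : ∀ e, AbsolutelyContinuousOnInterval (onEdge f e) 0 (G.length e) := by
    intro e
    refine AbsolutelyContinuousOnInterval.congr ?_ (hprim e)
    exact (LipschitzWith.const (onEdge f e 0)).lipschitzOnWith.absolutelyContinuousOnInterval.add
      ((hge e).absolutelyContinuousOnInterval_intervalIntegral left_mem_uIcc)
  have hder : der f =ᵐ[G.lengthMeasure] g := by
    change ∀ᵐ x ∂G.lengthMeasure, _
    rw [ae_lengthMeasure_iff]
    intro e
    rw [ae_restrict_iff' measurableSet_Ioc]
    filter_upwards [(hge e).ae_hasDerivAt_integral, measure_eq_zero_iff_ae_notMem.1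
      (measure_singleton (μ := volume) (G.length e))] with t ht htl hmem
    have hlt : t < G.length e := lt_of_le_of_ne hmem.2 htl
    have h1 := ht (by
      rw [uIcc_of_le (G.length_pos e).le]; exact Ioc_subset_Icc_self hmem) 0 left_mem_uIcc
    have h2 : HasDerivAt (onEdge f e) (g ⟨e, t⟩) t := by
      refine (h1.const_add (onEdge f e 0)).congr_of_eventuallyEq ?_
      filter_upwards [Icc_mem_nhds hmem.1 hlt] with r hr
      exact (hprim e (by rwa [uIcc_of_le (G.length_pos e).le])).symm
    exact h2.deriv
  refine ⟨memH1_iff.2 ⟨hc, hac, ?_, hg.ae_eq hder.symm⟩, hder⟩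
  exact MemLp.of_bound (measurable_val hc).aestronglyMeasurable C (ae_le_of_forall_le hC)

/-- Bounded pointwise limits of sequences that are Cauchy in energy belong to `H¹`. -/
theorem memH1_of_tendsto (hfin : G.LocallyFinite) (hlen : HasSum G.length L)
    {w : ℕ → G.Point → ℝ} {v : G.Point → ℝ} {B M : ℝ} (hw : ∀ n, MemH1 (w n))
    (hB : ∀ n p, |w n p| ≤ B) (hM : ∀ n, energy (w n) (w n) ≤ M)
    (hv : ∀ p, Filter.Tendsto (fun n => w n p) Filter.atTop (nhds (v p)))
    (hcauchy : ∀ ε > 0, ∃ N, ∀ m ≥ N, ∀ n ≥ N,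
      energy (fun p => 1 * w m p + (-1) * w n p) (fun p => 1 * w m p + (-1) * w n p) < ε) :
    MemH1 v ∧ Filter.Tendsto (fun n => energy (w n) (w n)) Filter.atTop (nhds (energy v v)) := by
  have := isFiniteMeasure_lengthMeasure hlen
  have hvB : ∀ p, |v p| ≤ B := fun p =>
    le_of_tendsto (hv p).abs (Filter.Eventually.of_forall fun n => hB n p)
  have hedge : ∀ e t, Filter.Tendsto (fun n => onEdge (w n) e t) Filter.atTop
      (nhds (onEdge v e t)) := fun e t => tendsto_val hv ⟨e, t⟩
  have hc : Continuous v := by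
    refine continuous_of_abs_onEdge_sub_le hfin (M := M) fun e s hs t ht => ?_
    refine le_of_tendsto ((hedge e t).sub (hedge e s)).abs (Filter.Eventually.of_forall fun n => ?_)
    refine (abs_onEdge_sub_le (hw n) e hs ht).trans (Real.sqrt_le_sqrt ?_)
    exact mul_le_mul_of_nonneg_right (hM n) (abs_nonneg _)
  let D : ℕ → Lp ℝ 2 G.lengthMeasure := fun n => (hw n).memLp_der.toLp (der (w n))
  have hnorm : ∀ F : Lp ℝ 2 G.lengthMeasure, ‖F‖ ^ 2 = ∫ x, F x ^ 2 ∂G.lengthMeasure := by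
    intro F
    rw [← real_inner_self_eq_norm_sq, L2.inner_def]
    refine integral_congr_ae (Filter.Eventually.of_forall fun x => ?_)
    simp [pow_two]
  have hDC : CauchySeq D := by
    rw [Metric.cauchySeq_iff]
    intro ε hε
    obtain ⟨N, hN⟩ := hcauchy (ε ^ 2) (by positivity)
    refine ⟨N, fun m hm n hn => ?_⟩
    rw [dist_eq_norm]
    refine lt_of_pow_lt_pow_left₀ 2 hε.le ?_
    rw [hnorm]
    refine lt_of_eq_of_lt ?_ (hN m hm n hn)
    rw [energy_self ((hw m).lin (hw n) 1 (-1))]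
    refine integral_congr_ae ?_
    filter_upwards [der_lin (hw m).absolutelyContinuous (hw n).absolutelyContinuous 1 (-1),
      Lp.coeFn_sub (D m) (D n), (hw m).memLp_der.coeFn_toLp, (hw n).memLp_der.coeFn_toLp]
      with x h1 h2 h3 h4
    rw [h1, h2, Pi.sub_apply, h3, h4]
    ring
  obtain ⟨F, hF⟩ := cauchySeq_tendsto_of_complete hDC
  have hint : ∀ e s t, 0 ≤ s → s ≤ t → t ≤ G.length e →
      onEdge v e t - onEdge v e s = ∫ x in Sigma.mk e '' Ioc s t, F x ∂G.lengthMeasure := by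
    intro e s t hs hst ht
    have hm : MeasurableSet (@Sigma.mk E (fun _ => ℝ) e '' Ioc s t) :=
      (measurableEmbedding_mk e).measurableSet_image.2 measurableSet_Ioc
    have h1 : Filter.Tendsto (fun n => ∫ x in Sigma.mk e '' Ioc s t, D n x ∂G.lengthMeasure)
        Filter.atTop (nhds (∫ x in Sigma.mk e '' Ioc s t, F x ∂G.lengthMeasure)) := by
      have h2 := (tendsto_const_nhds (x := indicatorConstLp 2 hm
        (measure_ne_top G.lengthMeasure _) (1 : ℝ))).inner (𝕜 := ℝ) hF
      simpa only [L2.inner_indicatorConstLp_one] using h2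
    have h2 : ∀ n, ∫ x in Sigma.mk e '' Ioc s t, D n x ∂G.lengthMeasure =
        onEdge (w n) e t - onEdge (w n) e s := by
      intro n
      rw [sub_eq_setIntegral hlen (hw n) e hs hst ht]
      exact integral_congr_ae (ae_restrict_of_ae (hw n).memLp_der.coeFn_toLp)
    simp only [h2] at h1
    exact tendsto_nhds_unique ((hedge e t).sub (hedge e s)) h1
  obtain ⟨hvH, hder⟩ := memH1_of_sub_eq_setIntegral hlen hc hvB (Lp.memLp F) hint
  refine ⟨hvH, ?_⟩
  have h1 : ∀ n, energy (w n) (w n) = ‖D n‖ ^ 2 := by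
    intro n
    rw [hnorm, energy_self (hw n)]
    refine integral_congr_ae ?_
    filter_upwards [(hw n).memLp_der.coeFn_toLp] with x hx
    rw [hx]
  have h2 : energy v v = ‖F‖ ^ 2 := by
    rw [hnorm, energy_self hvH]
    refine integral_congr_ae ?_
    filter_upwards [hder] with x hx
    rw [hx]
  simp only [h1, h2]
  exact hF.norm.pow 2

/-- The Rayleigh quotient on the functions of mean zero attains its minimum. -/
theorem exists_minimizer (hfin : G.LocallyFinite) (hdc : G.DoublyConnected) (hL : 0 < L)
    (hlen : HasSum G.length L) :
    ∃ (c : ℝ) (u : G.Point → ℝ), MemH1 u ∧ total u = 0 ∧ massForm u u = 1 ∧ energy u u = c ∧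
      ∀ f : G.Point → ℝ, MemH1 f → total f = 0 → c * massForm f f ≤ energy f f := by
  set S : Set ℝ := {r | ∃ f : G.Point → ℝ, MemH1 f ∧ total f = 0 ∧ massForm f f = 1 ∧
    energy f f = r} with hS
  have hSne : S.Nonempty := by
    obtain ⟨f, h1, h2, h3⟩ := exists_admissible hfin hL hlen
    exact ⟨_, f, h1, h2, h3, rfl⟩
  have hSbdd : BddBelow S := by
    refine ⟨0, ?_⟩
    rintro r ⟨f, h1, -, -, rfl⟩
    exact energy_self_nonneg h1
  set c := sInf S with hc
  have hray : ∀ f : G.Point → ℝ, MemH1 f → total f = 0 → c * massForm f f ≤ energy f f := by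
    intro f hf h0
    rcases eq_or_lt_of_le (massForm_self_nonneg f) with h1 | h1
    · rw [← h1, mul_zero]
      exact energy_self_nonneg hf
    · have hs := Real.sqrt_pos.2 h1
      have hsq := Real.sq_sqrt h1.le
      have h2 : c ≤ (1 / √(massForm f f)) ^ 2 * energy f f := by
        refine csInf_le hSbdd ⟨_, hf.lin hf (1 / √(massForm f f)) 0, ?_, ?_, ?_⟩
        · rw [total_lin hlen hf hf, h0]
          ring
        · rw [massForm_lin_self hf hf]
          nth_rw 2 [← hsq]
          field_simp
          ring
        · rw [energy_lin_self hf hf]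
          ring
      rw [div_pow, hsq, one_pow, one_div, inv_mul_eq_div, le_div_iff₀ h1] at h2
      exact h2
  have hseq : ∀ n : ℕ, ∃ f : G.Point → ℝ, MemH1 f ∧ total f = 0 ∧ massForm f f = 1 ∧
      energy f f < c + 1 / (n + 1) := by
    intro n
    obtain ⟨r, ⟨f, h1, h2, h3, rfl⟩, h4⟩ := exists_lt_of_csInf_lt hSne
      (show sInf S < c + 1 / (n + 1 : ℝ) from lt_add_of_pos_right _ (by positivity))
    exact ⟨f, h1, h2, h3, h4⟩
  choose u hu hu0 hu1 hue using hseq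
  have hM : ∀ n, energy (u n) (u n) ≤ c + 1 := by
    intro n
    have : (1 : ℝ) / (n + 1) ≤ 1 := by
      rw [div_le_one (by positivity)]
      linarith [Nat.cast_nonneg (α := ℝ) n]
    linarith [hue n]
  obtain ⟨φ, hφ, v, hv⟩ := exists_subseq_tendsto hdc hL hlen hu hu0 hM
  set w : ℕ → G.Point → ℝ := fun n => u (φ n) with hw
  have hwH : ∀ n, MemH1 (w n) := fun n => hu _
  set B := √(L * (c + 1)) with hB
  have hwB : ∀ n p, |w n p| ≤ B := fun n p =>
    (abs_le_sqrt hdc hL hlen (hu _) (hu0 _) p).trans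
      (Real.sqrt_le_sqrt (mul_le_mul_of_nonneg_left (hM _) hL.le))
  have hwlim : Filter.Tendsto (fun n => energy (w n) (w n)) Filter.atTop (nhds c) := by
    have h1 : Filter.Tendsto (fun n : ℕ => c + 1 / ((φ n : ℝ) + 1)) Filter.atTop (nhds (c + 0)) :=
      (tendsto_one_div_add_atTop_nhds_zero_nat.comp hφ.tendsto_atTop).const_add c
    rw [add_zero] at h1
    refine tendsto_of_tendsto_of_tendsto_of_le_of_le tendsto_const_nhds h1 (fun n => ?_)
      fun n => (hue _).le
    have := hray (w n) (hu _) (hu0 _)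
    rwa [hu1, mul_one] at this
  have hwc : ∀ n, Continuous (w n) := fun n => (hu _).continuous
  -- convergence in the mean square
  have hdist : Filter.Tendsto (fun n => ∫ x, (val (w n) x - val v x) ^ 2 ∂G.lengthMeasure)
      Filter.atTop (nhds 0) := by
    have := tendsto_integral_comp hlen hwc hwB hv (φ := fun a b => (a - b) ^ 2) (by fun_prop)
      (K := (B + B) ^ 2) fun a b ha hb => by
        rw [abs_pow]
        exact pow_le_pow_left₀ (abs_nonneg _) ((abs_sub _ _).trans (add_le_add ha hb)) 2
    simpa using this
  have htot : total v = 0 := by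
    have h1 := tendsto_integral_comp hlen hwc hwB hv (φ := fun a _ => a) (by fun_prop)
      (K := B) fun a b ha _ => ha
    refine tendsto_nhds_unique h1 ?_
    have h2 : ∀ n, ∫ x, val (w n) x ∂G.lengthMeasure = 0 := fun n => hu0 _
    simp only [h2]
    exact tendsto_const_nhds
  have hmass : massForm v v = 1 := by
    have h1 := tendsto_integral_comp hlen hwc hwB hv (φ := fun a _ => a * a) (by fun_prop)
      (K := B * B) fun a b ha _ => by
        rw [abs_mul]
        exact mul_le_mul ha ha (abs_nonneg _) ((abs_nonneg _).trans ha)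
    refine tendsto_nhds_unique h1 ?_
    have h2 : ∀ n, ∫ x, val (w n) x * val (w n) x ∂G.lengthMeasure = 1 := fun n => hu1 _
    simp only [h2]
    exact tendsto_const_nhds
  have hvm := measurable_val_of_tendsto hwc hv
  have hfinm := isFiniteMeasure_lengthMeasure hlen
  have hvL : MemLp (val v) 2 G.lengthMeasure :=
    MemLp.of_bound hvm.aestronglyMeasurable B (ae_le_of_forall_le fun p =>
      le_of_tendsto (hv p).abs (Filter.Eventually.of_forall fun n => hwB n p))
  have hmm : ∀ m n, massForm (fun p => 1 * w m p + (-1) * w n p)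
      (fun p => 1 * w m p + (-1) * w n p) ≤
      2 * (∫ x, (val (w m) x - val v x) ^ 2 ∂G.lengthMeasure) +
      2 * ∫ x, (val (w n) x - val v x) ^ 2 ∂G.lengthMeasure := by
    intro m n
    have i : ∀ n, Integrable (fun x => 2 * (val (w n) x - val v x) ^ 2) G.lengthMeasure := fun n =>
      (((hwH n).memLp_val.sub hvL).integrable_sq).const_mul 2
    rw [massForm_self, ← integral_const_mul, ← integral_const_mul, ← integral_add (i m) (i n)]
    refine integral_mono ((hwH m).lin (hwH n) 1 (-1)).memLp_val.integrable_sq ((i m).add (i n))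
      fun x => ?_
    simp only [val_lin]
    nlinarith [sq_nonneg (val (w m) x - val v x + (val (w n) x - val v x))]
  have hpar : ∀ m n, energy (fun p => 1 * w m p + (-1) * w n p)
      (fun p => 1 * w m p + (-1) * w n p) ≤ 2 * (energy (w m) (w m) - c) +
      2 * (energy (w n) (w n) - c) + c * massForm (fun p => 1 * w m p + (-1) * w n p)
      (fun p => 1 * w m p + (-1) * w n p) := by
    -- the parallelogram identity and the minimality of `c`
    intro m n
    have h1 := hray _ ((hwH m).lin (hwH n) 1 1) (by
      rw [total_lin hlen (hwH m) (hwH n), hu0, hu0]; ring)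
    rw [massForm_lin_self (hwH m) (hwH n), energy_lin_self (hwH m) (hwH n), hu1, hu1] at h1
    rw [massForm_lin_self (hwH m) (hwH n), energy_lin_self (hwH m) (hwH n), hu1, hu1]
    linarith
  have hc0 : 0 ≤ c := le_csInf hSne fun r hr => by
    obtain ⟨f, h1, -, -, rfl⟩ := hr
    exact energy_self_nonneg h1
  have hcauchy : ∀ ε > 0, ∃ N, ∀ m ≥ N, ∀ n ≥ N,
      energy (fun p => 1 * w m p + (-1) * w n p) (fun p => 1 * w m p + (-1) * w n p) < ε := by
    intro ε hε
    have h1 : Filter.Tendsto (fun n => 2 * (energy (w n) (w n) - c) +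
        c * (2 * ∫ x, (val (w n) x - val v x) ^ 2 ∂G.lengthMeasure)) Filter.atTop
        (nhds (2 * (c - c) + c * (2 * 0))) :=
      ((hwlim.sub_const c).const_mul 2).add ((hdist.const_mul 2).const_mul c)
    rw [show 2 * (c - c) + c * (2 * 0) = 0 by ring] at h1
    obtain ⟨N, hN⟩ := Filter.eventually_atTop.1 (h1.eventually (gt_mem_nhds (half_pos hε)))
    refine ⟨N, fun m hm n hn => ?_⟩
    have h2 := hN m hm
    have h3 := hN n hn
    have h4 := hpar m n
    have h5 := mul_le_mul_of_nonneg_left (hmm m n) hc0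
    linarith
  obtain ⟨hvH, hve⟩ := memH1_of_tendsto hfin hlen hwH hwB (fun n => hM _) hv hcauchy
  exact ⟨c, v, hvH, htot, hmass, tendsto_nhds_unique hve hwlim, hray⟩

end Existence

/-! ### The second eigenvalue -/

section Spectrum

variable {E : Type*} {G : MetricGraph E} [Countable E] {u : G.Point → ℝ} {L b c : ℝ}

/-- The eigenvalue equation is the weak equation tested with `H¹`: that `b u` is square integrable is
automatic. -/
theorem isNeumannEigenfunction_iff : IsNeumannEigenfunction b u ↔
    u ≠ 0 ∧ MemH1 u ∧ ∀ v : G.Point → ℝ, MemH1 v → energy u v = b * massForm u v := by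
  have hmem : MemH1 u → G.MemL2 fun e t => b * onEdge u e t := fun hu =>
    memL2_iff_memLp.2 (hu.memLp_val.const_mul b)
  have hinner : MemH1 u → ∀ v : G.Point → ℝ, MemH1 v →
      G.innerL2 (fun e t => b * onEdge u e t) (onEdge v) = b * massForm u v := by
    intro hu v hv
    rw [innerL2_eq_integral (hmem hu) hv.memL2, massForm, ← integral_const_mul]
    refine integral_congr_ae (Filter.Eventually.of_forall fun x => ?_)
    exact mul_assoc _ _ _
  constructor
  · rintro ⟨h1, h2, -, h3⟩
    exact ⟨h1, h2, fun v hv => by rw [h3 v hv, hinner h2 v hv]⟩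
  · rintro ⟨h1, h2, h3⟩
    exact ⟨h1, h2, hmem h2, fun v hv => by rw [h3 v hv, hinner h2 v hv]⟩

theorem eq_zero_of_forall_quadratic_nonneg {a b : ℝ} (h : ∀ t : ℝ, 0 ≤ 2 * t * a + t ^ 2 * b) :
    a = 0 := by
  have hK : 0 < |b| + 1 := by positivity
  have h1 := h (-a / (|b| + 1))
  have h2 : 2 * (-a / (|b| + 1)) * a + (-a / (|b| + 1)) ^ 2 * b =
      a ^ 2 * (b - 2 * (|b| + 1)) / (|b| + 1) ^ 2 := by
    field_simp
    ring
  rw [h2, div_nonneg_iff] at h1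
  have h3 := le_abs_self b
  have h4 : 0 < (|b| + 1) ^ 2 := by positivity
  have h5 : 0 ≤ a ^ 2 * (b - 2 * (|b| + 1)) := by
    rcases h1 with h1 | h1
    · exact h1.1
    · linarith [h1.2]
  have h6 : a ^ 2 ≤ 0 := by
    by_contra! hcon
    nlinarith
  exact pow_eq_zero_iff two_ne_zero |>.1 (le_antisymm h6 (sq_nonneg a))

/-- The Euler–Lagrange equation of a minimiser. -/
theorem energy_eq_mul_massForm (hL : 0 < L) (hlen : HasSum G.length L) (hu : MemH1 u)
    (h0 : total u = 0) (hle : energy u u ≤ c * massForm u u)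
    (hmin : ∀ f : G.Point → ℝ, MemH1 f → total f = 0 → c * massForm f f ≤ energy f f)
    {v : G.Point → ℝ} (hv : MemH1 v) : energy u v = c * massForm u v := by
  have h1H := memH1_const hlen (G := G) 1
  set z : G.Point → ℝ := fun p => 1 * v p + (-(total v / L)) * 1 with hz
  have hzH : MemH1 z := hv.lin h1H _ _
  have hz0 : total z = 0 := by
    rw [total_lin hlen hv h1H, total_const hL.le hlen]
    field_simp
    ring
  have he : energy u z = energy u v := by
    rw [energy_comm, energy_lin_left hv h1H hu, energy_const_left, energy_comm v]
    ring
  have hm : massForm u z = massForm u v := by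
    rw [massForm_comm, massForm_lin_left hv h1H hu, massForm_const_left, massForm_comm v, h0]
    ring
  rw [← he, ← hm]
  refine sub_eq_zero.1 (eq_zero_of_forall_quadratic_nonneg (b := energy z z - c * massForm z z)
    fun t => ?_)
  have h1 := hmin _ (hu.lin hzH 1 t) (by rw [total_lin hlen hu hzH, h0, hz0]; ring)
  rw [energy_lin_self hu hzH, massForm_lin_self hu hzH] at h1
  linarith

theorem isNeumannEigenfunction_one (hL : 0 < L) (hlen : HasSum G.length L) :
    IsNeumannEigenfunction 0 fun _ : G.Point => (1 : ℝ) := by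
  refine isNeumannEigenfunction_iff.2 ⟨fun h => ?_, memH1_const hlen 1, fun v _ => ?_⟩
  · obtain ⟨e⟩ := nonempty_of_hasSum_length hL hlen
    exact one_ne_zero (congrFun h (G.pt e ⟨0, le_rfl, (G.length_pos e).le⟩))
  · rw [energy_const_left, zero_mul]

/-- The eigenfunctions below the minimum of the Rayleigh quotient are the constants. -/
theorem eq_const_of_isNeumannEigenfunction (hdc : G.DoublyConnected) (hL : 0 < L)
    (hlen : HasSum G.length L)
    (hmin : ∀ f : G.Point → ℝ, MemH1 f → total f = 0 → c * massForm f f ≤ energy f f)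
    (hbc : b < c) (hu : IsNeumannEigenfunction b u) (x y : G.Point) : u x = u y := by
  obtain ⟨hne, hH, heq⟩ := isNeumannEigenfunction_iff.1 hu
  have hpos := massForm_self_pos hH hne
  have h1 := heq u hH
  have h2 : b * total u = 0 := by
    have := heq _ (memH1_const hlen 1)
    rw [energy_comm, energy_const_left, massForm_comm, massForm_const_left, one_mul] at this
    exact this.symm
  rcases mul_eq_zero.1 h2 with h3 | h3
  · have h4 := abs_sub_le_sqrt hdc hL.le hlen hH x y
    rw [h1, h3, zero_mul, mul_zero, Real.sqrt_zero] at h4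
    exact sub_eq_zero.1 (abs_eq_zero.1 (le_antisymm h4 (abs_nonneg _)))
  · have h4 := hmin u hH h3
    rw [h1] at h4
    exact absurd (le_of_mul_le_mul_right h4 hpos) (not_le.2 hbc)

/-- The minimum of the Rayleigh quotient over the functions of mean zero is the second eigenvalue. -/
theorem isNeumannEigenvalue_two (hdc : G.DoublyConnected) (hL : 0 < L) (hlen : HasSum G.length L)
    (hc : 0 ≤ c) (hu : MemH1 u) (h0 : total u = 0) (hne : u ≠ 0)
    (hle : energy u u ≤ c * massForm u u)
    (hmin : ∀ f : G.Point → ℝ, MemH1 f → total f = 0 → c * massForm f f ≤ energy f f) :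
    G.IsNeumannEigenvalue 2 c := by
  have h1e := isNeumannEigenfunction_one (G := G) hL hlen
  have hue : IsNeumannEigenfunction c u := isNeumannEigenfunction_iff.2
    ⟨hne, hu, fun v hv => energy_eq_mul_massForm hL hlen hu h0 hle hmin hv⟩
  constructor
  · have hsub : {v : G.Point → ℝ | ∃ b < c, IsNeumannEigenfunction b v} ⊆
        (Submodule.span ℝ {fun _ : G.Point => (1 : ℝ)} : Submodule ℝ (G.Point → ℝ)) := by
      rintro v ⟨b, hb, hv⟩
      obtain ⟨e⟩ := nonempty_of_hasSum_length hL hlen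
      refine Submodule.mem_span_singleton.2
        ⟨v (G.pt e ⟨0, le_rfl, (G.length_pos e).le⟩), funext fun p => ?_⟩
      rw [eq_const_of_isNeumannEigenfunction hdc hL hlen hmin hb hv p
        (G.pt e ⟨0, le_rfl, (G.length_pos e).le⟩)]
      simp
    have h1 := (Submodule.rank_mono (Submodule.span_le.2 hsub)).trans (rank_span_le _)
    rw [Cardinal.mk_singleton] at h1
    refine h1.trans_lt ?_
    norm_num
  · have hli : LinearIndependent ℝ ![fun _ : G.Point => (1 : ℝ), u] := by
      rw [LinearIndependent.pair_iff]
      intro s t hst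
      have h1 : total (fun p => s * (fun _ : G.Point => (1 : ℝ)) p + t * u p) = 0 := by
        have : (fun p => s * (fun _ : G.Point => (1 : ℝ)) p + t * u p) = fun _ => 0 := hst
        rw [this, total_const hL.le hlen, zero_mul]
      rw [total_lin hlen (memH1_const hlen 1) hu, h0, total_const hL.le hlen] at h1
      have hs : s = 0 := by
        rw [mul_zero, add_zero, one_mul] at h1
        exact (mul_eq_zero.1 h1).resolve_right hL.ne'
      refine ⟨hs, ?_⟩
      rw [hs, zero_smul, zero_add] at hst
      exact (smul_eq_zero.1 hst).resolve_right hne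
    have hmem : ∀ i, ![fun _ : G.Point => (1 : ℝ), u] i ∈
        Submodule.span ℝ {v : G.Point → ℝ | ∃ b ≤ c, IsNeumannEigenfunction b v} := by
      intro i
      refine Submodule.subset_span ?_
      fin_cases i
      · exact ⟨0, hc, h1e⟩
      · exact ⟨c, le_rfl, hue⟩
    have hli' : LinearIndependent ℝ fun i => (⟨_, hmem i⟩ :
        Submodule.span ℝ {v : G.Point → ℝ | ∃ b ≤ c, IsNeumannEigenfunction b v}) :=
      LinearIndependent.of_comp (Submodule.subtype _) hli
    have := hli'.cardinal_lift_le_rank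
    simpa using this

end Spectrum

/-! ### Functions that fold a graph onto an interval -/

section TwoSheeted

variable {E : Type*} {G : MetricGraph E} {h : G.Point → ℝ} {U : Bool → Set G.Point} {L : ℝ}

/-- Near an interior point of an edge, all points lie on that edge, and the distance is that of the
coordinates. -/
theorem exists_interior_star {e : E} {s : Icc (0 : ℝ) (G.length e)} (h0 : 0 < (s : ℝ))
    (h1 : (s : ℝ) < G.length e) : ∃ r : ℝ≥0∞, 0 < r ∧ ∀ q, edist (G.pt e s) q < r →
      ∃ t, G.pt e t = q ∧ edist s t = edist (G.pt e s) q := by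
  obtain ⟨r, hr, hstar⟩ := exists_star (G.pt e s) (finite_reps_of_interior h0 h1)
  refine ⟨r, hr, fun q hq => ?_⟩
  obtain ⟨e', s', t, hs', hq', hd⟩ := hstar q hq
  have h2 := eq_of_pt_eq_pt_of_interior hs'.symm h0 h1
  obtain rfl : e = e' := congrArg Sigma.fst h2
  obtain rfl : s = s' := eq_of_heq (Sigma.mk.inj h2).2
  exact ⟨t, hq', hd⟩

/-- The point with coordinate `t` on the edge `e`, for a coordinate that is moved into the edge. -/
noncomputable def ptProj (G : MetricGraph E) (e : E) (t : ℝ) : G.Point :=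
  G.pt e (projIcc 0 _ (G.length_pos e).le t)

theorem continuous_ptProj (e : E) : Continuous (ptProj G e) :=
  (continuous_pt e).comp continuous_projIcc

theorem ptProj_of_mem {e : E} {t : ℝ} (ht : t ∈ Icc 0 (G.length e)) :
    ptProj G e t = G.pt e ⟨t, ht⟩ := by
  rw [ptProj, projIcc_of_mem _ ht]

theorem eventually_edist_ptProj_eq {e : E} {s : ℝ} (hs : s ∈ Ioo 0 (G.length e)) :
    ∀ᶠ t in nhds s, edist (ptProj G e s) (ptProj G e t) = edist s t := by
  have hs' := Ioo_subset_Icc_self hs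
  obtain ⟨r, hr, hstar⟩ := exists_interior_star (s := ⟨s, hs'⟩) hs.1 hs.2
  have h1 : ∀ᶠ t in nhds s, edist (ptProj G e s) (ptProj G e t) < r := by
    filter_upwards [(continuous_ptProj e).continuousAt (Metric.eball_mem_nhds (ptProj G e s) hr)]
      with t ht
    rwa [mem_preimage, Metric.mem_eball, edist_comm] at ht
  filter_upwards [h1, Ioo_mem_nhds hs.1 hs.2] with t ht htm
  have ht' := Ioo_subset_Icc_self htm
  rw [ptProj_of_mem hs', ptProj_of_mem ht'] at ht ⊢
  obtain ⟨t', h2, h3⟩ := hstar _ ht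
  have h4 := eq_of_pt_eq_pt_of_interior h2.symm htm.1 htm.2
  obtain rfl : (⟨t, ht'⟩ : Icc (0 : ℝ) (G.length e)) = t' := eq_of_heq (Sigma.mk.inj h4).2
  exact h3.symm

theorem eq_of_ptProj_eq {e e' : E} {s s' : ℝ} (hs : s ∈ Ioo 0 (G.length e))
    (hs' : s' ∈ Ioo 0 (G.length e')) (heq : ptProj G e s = ptProj G e' s') : e = e' ∧ s = s' := by
  rw [ptProj_of_mem (Ioo_subset_Icc_self hs), ptProj_of_mem (Ioo_subset_Icc_self hs')] at heq
  have h4 := eq_of_pt_eq_pt_of_interior heq hs.1 hs.2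
  obtain rfl : e = e' := congrArg Sigma.fst h4
  exact ⟨rfl, congrArg Subtype.val (eq_of_heq (Sigma.mk.inj h4).2)⟩

/-- The function `h` folds the graph, apart from countably many points, onto an interval by two
sheets on which it is injective and locally isometric. -/
structure IsTwoSheeted (h : G.Point → ℝ) (U : Bool → Set G.Point) : Prop where
  lip : LipschitzWith 1 h
  isOpen : ∀ b, IsOpen (U b)
  injOn : ∀ b, InjOn h (U b)
  iso : ∀ b, ∀ p ∈ U b, ∀ᶠ q in nhds p, edist (h p) (h q) = edist p q
  countable : (⋃ b, U b)ᶜ.Countable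

namespace IsTwoSheeted

/-- The regular points of a sheet on an edge. -/
def sheet (h : G.Point → ℝ) (U : Bool → Set G.Point) (b : Bool) (e : E) : Set ℝ :=
  Ioo 0 (G.length e) ∩ {t | DifferentiableAt ℝ (onEdge h e) t} ∩ ptProj G e ⁻¹' U b

theorem measurableSet_sheet (hh : IsTwoSheeted h U) (b : Bool) (e : E) :
    MeasurableSet (sheet h U b e) :=
  (measurableSet_Ioo.inter (measurableSet_of_differentiableAt ℝ (onEdge h e))).inter
    ((hh.isOpen b).preimage (continuous_ptProj e)).measurableSet

theorem injOn_sheet (hh : IsTwoSheeted h U) (b : Bool) (e : E) :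
    InjOn (onEdge h e) (sheet h U b e) := by
  intro s hs t ht hst
  exact (eq_of_ptProj_eq hs.1.1 ht.1.1 (hh.injOn b hs.2 ht.2 hst)).2

theorem abs_deriv_eq_one (hh : IsTwoSheeted h U) {b : Bool} {e : E} {t : ℝ}
    (ht : t ∈ sheet h U b e) : |deriv (onEdge h e) t| = 1 := by
  have h1 := hasDerivAt_iff_tendsto_slope.1 (ht.1.2 : DifferentiableAt ℝ (onEdge h e) t).hasDerivAt
  refine tendsto_nhds_unique h1.abs (tendsto_const_nhds.congr' ?_)
  have h2 : ∀ᶠ s in nhds t, edist (onEdge h e t) (onEdge h e s) = edist t s := by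
    filter_upwards [eventually_edist_ptProj_eq ht.1.1,
      (continuous_ptProj e).continuousAt.eventually (hh.iso b _ ht.2)] with s hs hs'
    rw [← hs, ← hs']
    rfl
  filter_upwards [h2.filter_mono nhdsWithin_le_nhds, self_mem_nhdsWithin] with s hs hne
  have h3 : |onEdge h e s - onEdge h e t| = |s - t| := by
    rw [edist_dist, edist_dist, ENNReal.ofReal_eq_ofReal_iff dist_nonneg dist_nonneg,
      Real.dist_eq, Real.dist_eq, abs_sub_comm, abs_sub_comm t] at hs
    exact hs
  rw [slope_def_field, abs_div, h3, div_self (abs_pos.2 (sub_ne_zero.2 hne)).ne']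

theorem volume_image_sheet (hh : IsTwoSheeted h U) (b : Bool) (e : E) :
    volume (onEdge h e '' sheet h U b e) = volume (sheet h U b e) := by
  have h1 := lintegral_image_eq_lintegral_abs_deriv_mul (hh.measurableSet_sheet b e)
    (fun t ht => (ht.1.2 : DifferentiableAt ℝ (onEdge h e) t).hasDerivAt.hasDerivWithinAt)
    (hh.injOn_sheet b e) fun _ => 1
  rw [setLIntegral_one] at h1
  rw [h1, ← setLIntegral_one]
  refine setLIntegral_congr_fun (hh.measurableSet_sheet b e) fun t ht => ?_
  rw [hh.abs_deriv_eq_one ht, ENNReal.ofReal_one, one_mul]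

theorem ae_mem_sheet (hh : IsTwoSheeted h U) (e : E) :
    ∀ᵐ t : ℝ, t ∈ Ioc 0 (G.length e) → ∃ b, t ∈ sheet h U b e := by
  have h1 : {t | t ∈ Ioo 0 (G.length e) ∧ ptProj G e t ∈ (⋃ b, U b)ᶜ}.Countable := by
    refine MapsTo.countable_of_injOn (f := ptProj G e) (t := (⋃ b, U b)ᶜ) (fun t ht => ht.2) ?_
      hh.countable
    intro s hs t ht hst
    exact (eq_of_ptProj_eq hs.1 ht.1 hst).2
  filter_upwards [h1.ae_notMem volume, (lipschitzWith_onEdge hh.lip e).ae_differentiableAt,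
    (countable_singleton (G.length e)).ae_notMem volume] with t h2 h3 h4 ht
  have ht' : t ∈ Ioo 0 (G.length e) := ⟨ht.1, lt_of_le_of_ne ht.2 h4⟩
  have h5 : ptProj G e t ∈ ⋃ b, U b := by
    by_contra hcon
    exact h2 ⟨ht', hcon⟩
  obtain ⟨b, hb⟩ := mem_iUnion.1 h5
  exact ⟨b, ⟨ht', h3⟩, hb⟩

/-- The length of the graph is at most twice the length of the interval. -/
theorem lengthMeasure_univ_le [Countable E] (hh : IsTwoSheeted h U) {m M : ℝ}
    (hm : ∀ p, h p ∈ Icc m M) : G.lengthMeasure univ ≤ 2 * ENNReal.ofReal (M - m) := by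
  have h1 : ∀ b, ∑' e, volume (sheet h U b e) ≤ ENNReal.ofReal (M - m) := by
    intro b
    simp_rw [← hh.volume_image_sheet b]
    rw [← measure_iUnion, ← Real.volume_Icc]
    · refine measure_mono (iUnion_subset fun e => ?_)
      rintro _ ⟨t, -, rfl⟩
      exact hm _
    · intro e e' hne
      rw [Function.onFun, Set.disjoint_left]
      rintro _ ⟨s, hs, rfl⟩ ⟨t, ht, hst⟩
      exact hne (eq_of_ptProj_eq ht.1.1 hs.1.1 (hh.injOn b ht.2 hs.2 hst)).1.symm
    · intro e
      exact (hh.measurableSet_sheet b e).image_of_continuousOn_injOn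
        (lipschitzWith_onEdge hh.lip e).continuous.continuousOn (hh.injOn_sheet b e)
  have h2 : ∀ e, volume (Ioc 0 (G.length e)) ≤
      volume (sheet h U true e) + volume (sheet h U false e) := by
    intro e
    refine le_trans (measure_mono_ae (t := sheet h U true e ∪ sheet h U false e) ?_)
      (measure_union_le _ _)
    filter_upwards [hh.ae_mem_sheet e] with t ht hmem
    obtain ⟨b, hb⟩ := ht hmem
    cases b
    · exact Or.inr hb
    · exact Or.inl hb
  rw [← lintegral_one, lintegral_lengthMeasure]
  simp only [lintegral_one, Measure.restrict_apply MeasurableSet.univ, univ_inter]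
  refine (ENNReal.tsum_le_tsum h2).trans ?_
  rw [ENNReal.tsum_add, two_mul]
  exact add_le_add (h1 true) (h1 false)

theorem abs_der_le_one (hh : IsTwoSheeted h U) (x : Σ _ : E, ℝ) : |der h x| ≤ 1 :=
  norm_deriv_le_of_lipschitz (lipschitzWith_onEdge hh.lip x.1)

/-- The values of `h` are distributed uniformly with density two over an interval. -/
theorem exists_map_val_eq [Countable E] (hh : IsTwoSheeted h U) (hdc : G.DoublyConnected)
    (hL : 0 < L) (hlen : HasSum G.length L) :
    ∃ m, (∀ p, h p ∈ Icc m (m + L / 2)) ∧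
      G.lengthMeasure.map (val h) = (2 : ℝ≥0∞) • volume.restrict (Ioc m (m + L / 2)) := by
  have hfinm := isFiniteMeasure_lengthMeasure hlen
  have hc := hh.lip.continuous
  have hac : ∀ e, AbsolutelyContinuousOnInterval (onEdge h e) 0 (G.length e) := fun e =>
    (lipschitzWith_onEdge hh.lip e).lipschitzOnWith.absolutelyContinuousOnInterval
  have hosc : ∀ x y, 2 * (h x - h y) ≤ L := by
    intro x y
    have hint : Integrable (der h) G.lengthMeasure :=
      Integrable.of_bound (measurable_der h).aestronglyMeasurable 1
        (Filter.Eventually.of_forall hh.abs_der_le_one)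
    have h1 := two_mul_abs_sub_le hdc hc hac hint x y
    have h2 : ∫ z, |der h z| ∂G.lengthMeasure ≤ 1 * L := by
      rw [← total_const hL.le hlen]
      exact integral_mono hint.abs (integrable_const 1) hh.abs_der_le_one
    have := le_abs_self (h x - h y)
    linarith
  obtain ⟨e₀⟩ := nonempty_of_hasSum_length hL hlen
  set p₀ : G.Point := G.pt e₀ ⟨0, le_rfl, (G.length_pos e₀).le⟩
  have hne : (range h).Nonempty := ⟨_, p₀, rfl⟩
  have hbb : BddBelow (range h) := ⟨h p₀ - L / 2, by
    rintro _ ⟨p, rfl⟩; linarith [hosc p₀ p]⟩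
  have hba : BddAbove (range h) := ⟨h p₀ + L / 2, by
    rintro _ ⟨p, rfl⟩; linarith [hosc p p₀]⟩
  set m := sInf (range h) with hm
  set M := sSup (range h) with hM
  have hmM : ∀ p, h p ∈ Icc m M := fun p => ⟨csInf_le hbb ⟨p, rfl⟩, le_csSup hba ⟨p, rfl⟩⟩
  have hMm : M - m ≤ L / 2 := by
    have h1 : M ≤ m + L / 2 := by
      refine csSup_le hne ?_
      rintro _ ⟨x, rfl⟩
      have : h x - L / 2 ≤ m := le_csInf hne (by rintro _ ⟨y, rfl⟩; linarith [hosc x y])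
      linarith
    linarith
  have hLm : L ≤ 2 * (M - m) := by
    have h1 := hh.lengthMeasure_univ_le hmM
    rw [lengthMeasure_univ hlen, ← ENNReal.ofReal_ofNat, ← ENNReal.ofReal_mul (by norm_num)] at h1
    have h0 : 0 ≤ 2 * (M - m) := by linarith [(hmM p₀).1.trans (hmM p₀).2]
    exact (ENNReal.ofReal_le_ofReal_iff h0).1 h1
  have hMeq : M = m + L / 2 := by linarith
  rw [hMeq] at hmM
  have hfin2 : IsFiniteMeasure ((2 : ℝ≥0∞) • volume.restrict (Ioc m (m + L / 2))) :=
    Measure.smul_finite _ (by norm_num)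
  refine ⟨m, hmM, (Measure.eq_of_le_of_measure_univ_eq ?_ ?_).symm⟩
  · -- every level of the interval is crossed twice
    refine Measure.le_iff.2 fun B hB => ?_
    rw [Measure.smul_apply, Measure.restrict_apply hB, smul_eq_mul,
      Measure.map_apply (measurable_val hc) hB]
    have h1 := lintegral_crossings_le hc hac (w := B.indicator 1) (measurable_one.indicator hB)
    calc 2 * volume (B ∩ Ioc m (m + L / 2))
        = ∫⁻ c in Ioc m (m + L / 2), 2 * B.indicator 1 c := by
          rw [lintegral_const_mul _ (measurable_one.indicator hB), lintegral_indicator_one hB,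
            Measure.restrict_apply hB]
      _ ≤ ∫⁻ c in Ioc m (m + L / 2), B.indicator 1 c * crossings h c := by
          refine lintegral_mono_ae ?_
          rw [ae_restrict_iff' measurableSet_Ioc]
          filter_upwards [ae_two_le_crossings hdc hc,
            (countable_singleton (m + L / 2)).ae_notMem volume] with c h2 h3 hmem
          rw [mul_comm]
          gcongr
          obtain ⟨_, ⟨x, rfl⟩, hx⟩ := exists_lt_of_csInf_lt hne hmem.1
          obtain ⟨_, ⟨y, rfl⟩, hy⟩ := exists_lt_of_lt_csSup hne
            (show c < M from hMeq ▸ lt_of_le_of_ne hmem.2 h3)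
          exact h2 ⟨x, hx⟩ ⟨y, hy⟩
      _ ≤ ∫⁻ c, B.indicator 1 c * crossings h c := setLIntegral_le_lintegral _ _
      _ ≤ ∫⁻ x, B.indicator 1 (val h x) * ‖der h x‖ₑ ∂G.lengthMeasure := h1
      _ ≤ ∫⁻ x, (val h ⁻¹' B).indicator 1 x ∂G.lengthMeasure := by
          refine lintegral_mono fun x => ?_
          have h4 : ‖der h x‖ₑ ≤ 1 := by
            rw [← ofReal_norm, ← ENNReal.ofReal_one]
            exact ENNReal.ofReal_le_ofReal (hh.abs_der_le_one x)
          exact mul_le_of_le_one_right' h4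
      _ = G.lengthMeasure (val h ⁻¹' B) := lintegral_indicator_one (measurable_val hc hB)
  · rw [Measure.smul_apply, Measure.restrict_apply MeasurableSet.univ, univ_inter, Real.volume_Ioc,
      Measure.map_apply (measurable_val hc) MeasurableSet.univ, preimage_univ,
      lengthMeasure_univ hlen, smul_eq_mul, ← ENNReal.ofReal_ofNat,
      ← ENNReal.ofReal_mul (by norm_num)]
    congr 1
    ring

/-- The cosine of the folding function attains the lower bound of the Rayleigh quotient. -/
theorem exists_energy_le [Countable E] (hh : IsTwoSheeted h U) (hdc : G.DoublyConnected)
    (hL : 0 < L) (hlen : HasSum G.length L) :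
    ∃ f : G.Point → ℝ, MemH1 f ∧ total f = 0 ∧ 0 < massForm f f ∧
      energy f f ≤ 4 * Real.pi ^ 2 / L ^ 2 * massForm f f := by
  have hfinm := isFiniteMeasure_lengthMeasure hlen
  obtain ⟨m, hm, hmap⟩ := hh.exists_map_val_eq hdc hL hlen
  set κ := 2 * Real.pi / L with hκ
  have hpi := Real.pi_pos
  have hκpos : 0 < κ := by positivity
  have hκL : κ * (L / 2) = Real.pi := by rw [hκ]; field_simp
  have hvm := measurable_val hh.lip.continuous
  have hint : ∀ g : ℝ → ℝ, Continuous g → ∫ x, g (val h x) ∂G.lengthMeasure =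
      2 * (κ⁻¹ * ∫ θ in (0 : ℝ)..Real.pi, g (m + θ / κ)) := by
    intro g hg
    rw [← integral_map hvm.aemeasurable hg.aestronglyMeasurable, hmap, integral_smul_measure,
      ← intervalIntegral.integral_of_le (by linarith)]
    have h1 := intervalIntegral.integral_comp_div (a := 0) (b := Real.pi)
      (fun c => g (m + c)) hκpos.ne'
    rw [h1, intervalIntegral.integral_comp_add_left, zero_div, add_zero, ← hκL,
      mul_div_cancel_left₀ _ hκpos.ne', smul_eq_mul, smul_eq_mul, inv_mul_cancel_left₀ hκpos.ne']
    simp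
  have hg1 : ∀ θ : ℝ, κ * (m + θ / κ - m) = θ := fun θ => by
    field_simp
    ring
  set f : G.Point → ℝ := fun p => Real.cos (κ * (h p - m)) with hf
  have hcosl : LipschitzWith (Real.toNNReal κ) fun c : ℝ => Real.cos (κ * (c - m)) := by
    refine LipschitzWith.of_dist_le_mul fun c d => ?_
    have h1 := Real.lipschitzWith_cos.dist_le_mul (κ * (c - m)) (κ * (d - m))
    rw [NNReal.coe_one, one_mul] at h1
    refine h1.trans (le_of_eq ?_)
    rw [Real.coe_toNNReal κ hκpos.le, Real.dist_eq, Real.dist_eq, ← mul_sub, abs_mul,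
      abs_of_pos hκpos]
    congr 2
    ring
  have hfl : LipschitzWith (Real.toNNReal κ * 1) f := hcosl.comp hh.lip
  have hfH : MemH1 f := memH1_of_lipschitzWith hlen hfl (C := 1) fun p => Real.abs_cos_le_one _
  have htot : total f = 0 := by
    have h1 := hint (fun c => Real.cos (κ * (c - m))) (by fun_prop)
    simp only [hg1] at h1
    rw [integral_cos, Real.sin_pi, Real.sin_zero, sub_zero, mul_zero, mul_zero] at h1
    exact h1
  have hmass : massForm f f = 2 * (κ⁻¹ * (Real.pi / 2)) := by
    have h1 := hint (fun c => Real.cos (κ * (c - m)) ^ 2) (by fun_prop)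
    simp only [hg1] at h1
    rw [integral_cos_sq, Real.sin_pi, Real.sin_zero] at h1
    rw [massForm_self]
    refine Eq.trans h1 ?_
    ring
  have hen : energy f f ≤ κ ^ 2 * (2 * (κ⁻¹ * (Real.pi / 2))) := by
    have h1 := hint (fun c => Real.sin (κ * (c - m)) ^ 2) (by fun_prop)
    simp only [hg1] at h1
    rw [integral_sin_sq, Real.sin_pi, Real.sin_zero] at h1
    have h2 : 2 * (κ⁻¹ * (Real.pi / 2)) = ∫ x, Real.sin (κ * (val h x - m)) ^ 2 ∂G.lengthMeasure := by
      rw [h1]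
      ring
    rw [h2, energy_self hfH, ← integral_const_mul]
    refine integral_mono_ae hfH.memLp_der.integrable_sq ?_ ?_
    · refine Integrable.of_bound (C := κ ^ 2) ?_ (Filter.Eventually.of_forall fun x => ?_)
      · exact (((Real.continuous_sin.measurable.comp
          ((hvm.sub_const m).const_mul κ)).pow_const 2).const_mul (κ ^ 2)).aestronglyMeasurable
      · rw [Real.norm_of_nonneg (by positivity)]
        exact mul_le_of_le_one_right (sq_nonneg _) (Real.sin_sq_le_one _)
    · change ∀ᵐ x ∂G.lengthMeasure, _
      rw [ae_lengthMeasure_iff]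
      intro e
      refine ae_restrict_of_ae ?_
      filter_upwards [(lipschitzWith_onEdge hh.lip e).ae_differentiableAt] with t ht
      have h3 : HasDerivAt (onEdge f e)
          (-Real.sin (κ * (onEdge h e t - m)) * (κ * deriv (onEdge h e) t)) t :=
        ((ht.hasDerivAt.sub_const m).const_mul κ).cos
      have h4 : der f ⟨e, t⟩ = -Real.sin (κ * (onEdge h e t - m)) * (κ * deriv (onEdge h e) t) :=
        h3.deriv
      rw [h4]
      have h5 : deriv (onEdge h e) t ^ 2 ≤ 1 := by
        have := hh.abs_der_le_one ⟨e, t⟩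
        exact (sq_le_one_iff_abs_le_one _).2 this
      have h6 : (-Real.sin (κ * (onEdge h e t - m)) * (κ * deriv (onEdge h e) t)) ^ 2 =
          κ ^ 2 * Real.sin (κ * (onEdge h e t - m)) ^ 2 * deriv (onEdge h e) t ^ 2 := by ring
      rw [h6]
      exact mul_le_of_le_one_right (by positivity) h5
  refine ⟨f, hfH, htot, by rw [hmass]; positivity, ?_⟩
  rw [hmass]
  refine hen.trans (le_of_eq ?_)
  congr 1
  rw [hκ]
  ring

end IsTwoSheeted

end TwoSheeted

/-! ### Symmetric necklaces are folded onto intervals -/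

section Necklace

/-- The vertices of a necklace on the real line: consecutive ones have distance `a i`. -/
noncomputable def knotPosition (a : ℤ → ℝ) (i : ℤ) : ℝ :=
  ∑ k ∈ Finset.Ico 0 i, a k - ∑ k ∈ Finset.Ico i 0, a k

theorem knotPosition_add_one (a : ℤ → ℝ) (i : ℤ) :
    knotPosition a (i + 1) = knotPosition a i + a i := by
  unfold knotPosition
  rcases le_or_gt 0 i with h | h
  · rw [Finset.Ico_eq_empty (a := i + 1) (by lia), Finset.Ico_eq_empty (a := i) (by lia)]
    have h1 : Finset.Ico 0 (i + 1) = insert i (Finset.Ico 0 i) := by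
      ext k
      simp only [Finset.mem_Ico, Finset.mem_insert]
      lia
    rw [h1, Finset.sum_insert (by simp)]
    ring
  · rw [Finset.Ico_eq_empty (a := 0) (b := i + 1) (by lia),
      Finset.Ico_eq_empty (a := 0) (b := i) (by lia)]
    have h1 : Finset.Ico i 0 = insert i (Finset.Ico (i + 1) 0) := by
      ext k
      simp only [Finset.mem_Ico, Finset.mem_insert]
      lia
    rw [h1, Finset.sum_insert (by simp)]
    ring

theorem monotone_knotPosition {a : ℤ → ℝ} (ha : ∀ i, 0 ≤ a i) : Monotone (knotPosition a) :=
  monotone_int_of_le_succ fun i => by rw [knotPosition_add_one]; linarith [ha i]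

variable {I : Set ℤ} {a : I → ℝ} {ha : ∀ i, 0 < a i}

/-- The lengths of the pumpkins, continued by zero. -/
noncomputable def extendLength (a : I → ℝ) (i : ℤ) : ℝ :=
  open Classical in if h : i ∈ I then a ⟨i, h⟩ else 0

theorem extendLength_coe (i : I) : extendLength a i = a i := by
  rw [extendLength, dif_pos i.2]

theorem extendLength_nonneg (ha : ∀ i, 0 < a i) (i : ℤ) : 0 ≤ extendLength a i := by
  unfold extendLength
  split_ifs
  · exact (ha _).le
  · exact le_rfl

/-- The projection of a necklace to the real line. -/
noncomputable def necklaceHeight (a : I → ℝ) (ha : ∀ i, 0 < a i) : (necklace I a ha).Point → ℝ :=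
  Quotient.lift (fun x => knotPosition (extendLength a) x.1.1 + (x.2 : ℝ)) (by
    have hend : ∀ y : (I × Bool) × Bool,
        knotPosition (extendLength a) ((necklace I a ha).endpoint y).1.1 +
          (((necklace I a ha).endpoint y).2 : ℝ) =
        knotPosition (extendLength a) ((y.1.1 : ℤ) + if y.2 then 1 else 0) := by
      rintro ⟨⟨i, b⟩, c⟩
      cases c
      · simp [endpoint]
      · simp only [endpoint, if_true, knotPosition_add_one, extendLength_coe]
        rfl
    rintro x y (rfl | ⟨b, c, rfl, rfl, h⟩)
    · rfl
    · have h1 : (b.1.1 : ℤ) + (if b.2 then 1 else 0) = (c.1.1 : ℤ) + if c.2 then 1 else 0 := h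
      rw [hend, hend, h1])

theorem necklaceHeight_pt (e : I × Bool) (t : Icc (0 : ℝ) ((necklace I a ha).length e)) :
    necklaceHeight a ha ((necklace I a ha).pt e t) = knotPosition (extendLength a) e.1 + (t : ℝ) :=
  rfl

/-- The interiors of the edges on one side of a necklace. -/
def necklaceSheet (a : I → ℝ) (ha : ∀ i, 0 < a i) (b : Bool) : Set (necklace I a ha).Point :=
  {p | ∃ (i : I) (t : Icc (0 : ℝ) ((necklace I a ha).length (i, b))), 0 < (t : ℝ) ∧ (t : ℝ) < a i ∧
    (necklace I a ha).pt (i, b) t = p}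

theorem necklaceSheet_nhds {b : Bool} {p : (necklace I a ha).Point}
    (hp : p ∈ necklaceSheet a ha b) : ∀ᶠ q in nhds p, q ∈ necklaceSheet a ha b ∧
      edist (necklaceHeight a ha p) (necklaceHeight a ha q) = edist p q := by
  obtain ⟨i, s, h0, h1, rfl⟩ := hp
  obtain ⟨r, hr, hstar⟩ := exists_interior_star (G := necklace I a ha) (e := (i, b)) h0 h1
  have hδ : 0 < min (s : ℝ) (a i - s) := lt_min h0 (sub_pos.2 h1)
  filter_upwards [Metric.eball_mem_nhds _ (lt_min hr (ENNReal.ofReal_pos.2 hδ))] with q hq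
  rw [Metric.mem_eball, lt_min_iff, edist_comm] at hq
  obtain ⟨t, rfl, hd⟩ := hstar q hq.1
  have h2 := hq.2
  rw [← hd, edist_dist, ENNReal.ofReal_lt_ofReal_iff hδ, Subtype.dist_eq, Real.dist_eq, abs_lt] at h2
  have h3 := min_le_left (s : ℝ) (a i - s)
  have h4 := min_le_right (s : ℝ) (a i - s)
  refine ⟨⟨i, t, by linarith, by linarith, rfl⟩, ?_⟩
  rw [← hd, necklaceHeight_pt, necklaceHeight_pt, edist_add_left]
  rfl

theorem isTwoSheeted_necklaceHeight :
    IsTwoSheeted (necklaceHeight a ha) (necklaceSheet a ha) where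
  lip := by
    refine lipschitzWith_one_of_edges fun e s t => ?_
    rw [necklaceHeight_pt, necklaceHeight_pt, edist_add_left]
    exact le_rfl
  isOpen b := isOpen_iff_mem_nhds.2 fun p hp => (necklaceSheet_nhds hp).mono fun q hq => hq.1
  injOn b := by
    rintro _ ⟨i, s, hs, hs', rfl⟩ _ ⟨j, t, ht, ht', rfl⟩ hst
    rw [necklaceHeight_pt, necklaceHeight_pt] at hst
    have hlt : ∀ i j : I, ∀ s t : ℝ, s < a i → 0 < t → (i : ℤ) < j →
        knotPosition (extendLength a) i + s < knotPosition (extendLength a) j + t := by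
      intro i j s t hs ht hij
      have h1 := monotone_knotPosition (extendLength_nonneg ha) (show (i : ℤ) + 1 ≤ j by lia)
      rw [knotPosition_add_one, extendLength_coe] at h1
      linarith
    rcases lt_trichotomy (i : ℤ) j with h | h | h
    · exact absurd hst (hlt i j s t hs' ht h).ne
    · obtain rfl : i = j := Subtype.ext h
      have h1 : (s : ℝ) = t := by
        simpa using hst
      rw [Subtype.ext h1]
    · exact absurd hst.symm (hlt j i t s ht' hs h).ne
  iso b p hp := (necklaceSheet_nhds hp).mono fun q hq => hq.2
  countable := by
    refine (countable_range fun x : (I × Bool) × Bool =>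
      (necklace I a ha).pt ((necklace I a ha).endpoint x).1
        ((necklace I a ha).endpoint x).2).mono ?_
    intro p hp
    obtain ⟨⟨i, b⟩, t, rfl⟩ := exists_pt_eq p
    by_cases h0 : (t : ℝ) = 0
    · refine ⟨((i, b), false), ?_⟩
      have : t = ⟨0, le_rfl, ((necklace I a ha).length_pos (i, b)).le⟩ := Subtype.ext h0
      rw [this]
      rfl
    by_cases h1 : (t : ℝ) = a i
    · refine ⟨((i, b), true), ?_⟩
      have : t = ⟨_, ((necklace I a ha).length_pos (i, b)).le, le_rfl⟩ := Subtype.ext h1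
      rw [this]
      rfl
    have hmem : (necklace I a ha).pt (i, b) t ∈ necklaceSheet a ha b :=
      ⟨i, t, lt_of_le_of_ne t.2.1 (Ne.symm h0), lt_of_le_of_ne t.2.2 h1, rfl⟩
    exact absurd (mem_iUnion.2 ⟨b, hmem⟩) hp

theorem IsTwoSheeted.comp_isometry {E E' : Type*} {G : MetricGraph E} {N : MetricGraph E'}
    {h : N.Point → ℝ} {U : Bool → Set N.Point} (hh : IsTwoSheeted h U)
    (φ : G.Point ≃ᵢ N.Point) : IsTwoSheeted (h ∘ φ) fun b => φ ⁻¹' U b where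
  lip := by
    intro p q
    rw [← φ.edist_eq p q]
    exact hh.lip (φ p) (φ q)
  isOpen b := (hh.isOpen b).preimage φ.continuous
  injOn b p hp q hq hpq := φ.injective (hh.injOn b hp hq hpq)
  iso b p hp := by
    filter_upwards [φ.continuous.continuousAt.eventually (hh.iso b _ hp)] with q hq
    rw [Function.comp_apply, Function.comp_apply, hq, φ.edist_eq]
  countable := by
    rw [← preimage_iUnion, ← preimage_compl]
    exact hh.countable.preimage φ.injective

theorem IsSymmetricNecklace.exists_isTwoSheeted {E : Type*} {G : MetricGraph E}
    (h : G.IsSymmetricNecklace) : ∃ (h : G.Point → ℝ) (U : Bool → Set G.Point),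
      IsTwoSheeted h U := by
  obtain ⟨I, a, ha, -, -, ⟨φ⟩⟩ := h
  exact ⟨_, _, isTwoSheeted_necklaceHeight.comp_isometry φ⟩

end Necklace

end MetricGraph

open MetricGraph in
theorem mainTheorem5 {E : Type*} [Countable E] (G : MetricGraph E) (hfin : G.LocallyFinite)
    (hdc : G.DoublyConnected) (L : ℝ) (hL : 0 < L) (hlen : HasSum G.length L) :
    ∃ μ₂ : ℝ, G.IsNeumannEigenvalue 2 μ₂ ∧
      4 * Real.pi ^ 2 / L ^ 2 ≤ μ₂ ∧
      (μ₂ = 4 * Real.pi ^ 2 / L ^ 2 ↔ G.IsSymmetricNecklace) := by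
  obtain ⟨c, u, hu, h0, h1, hc, hmin⟩ := exists_minimizer hfin hdc hL hlen
  have hne : u ≠ 0 := by
    rintro rfl
    have h2 : massForm (0 : G.Point → ℝ) 0 = 0 * total (0 : G.Point → ℝ) := massForm_const_left 0 _
    rw [h1, zero_mul] at h2
    exact one_ne_zero h2
  have hle : energy u u ≤ c * massForm u u := by rw [h1, mul_one, hc]
  have hbound : 4 * Real.pi ^ 2 / L ^ 2 ≤ c := by
    have := mul_massForm_le_energy hdc hL hlen hu h0
    rwa [h1, mul_one, hc] at this
  refine ⟨c, isNeumannEigenvalue_two hdc hL hlen ((by positivity : (0 : ℝ) ≤ _).trans hbound) hu h0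
    hne hle hmin, hbound, fun heq => ?_, fun hneck => ?_⟩
  · exact isSymmetricNecklace_of_energy_le hfin hdc hL hlen hu h0 hne (heq ▸ hle)
  · obtain ⟨h, U, hh⟩ := hneck.exists_isTwoSheeted
    obtain ⟨f, hf, hf0, hfpos, hfle⟩ := hh.exists_energy_le hdc hL hlen
    exact le_antisymm (le_of_mul_le_mul_right ((hmin f hf hf0).trans hfle) hfpos) hbound
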